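/- Fix a field $\mathbb{k}$. **Modules over $\mathsf{FB}\times\mathsf{FB}$.** Let $\mathsf{FB}$ be the category of finite sets and bijections. A $\mathbb{k}(\mathsf{FB}\times\mathsf{FB})$-module is a functor $F$ from $\mathsf{FB}\times\mathsf{FB}$ to $\mathbb{k}$-vector spaces. The Day convolution is $$(F\circledcirc G)(X,Y)=\bigoplus_{X=X_1\amalg X_2,\ Y=Y_1\amalg Y_2}F(X_1,Y_1)\otimes G(X_2,Y_2);$$ it is symmetric monoidal, with symmetry $\tau$ (without signs). Let $S_\circledcirc^*F=\bigoplus_{d\ge 0}(F^{\circledcirc d})_{\mathfrak{S}_d}$. The shifts are $(\delta_{a,b}F)(X,Y)=F(X\amalg\{1,\dots,a\},\,Y\amalg\{1,\dots,b\})$. **Walled Brauer categories.** The upward walled Brauer category $\mathsf{uwb}$ has as objects the pairs of finite sets. A morphism $(X,Y)\to(U,V)$ of degree $n$ is a pair of bijections $X\amalg\{1,\dots,n\}\cong U$, $Y\amalg\{1,\dots,n\}\cong V$, up to the diagonal action of $\mathfrak{S}_n$; degrees add under composition. Put $\mathsf{dwb}=\mathsf{uwb}^{\mathrm{op}}$.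 The category $\mathsf{FB}\times\mathsf{FB}$ embeds in $\mathsf{dwb}$ as the morphisms of degree $0$, a pair of bijections being sent to the opposite of the pair of inverse bijections. A $\mathbb{k}\mathsf{dwb}$-module structure on a $\mathbb{k}(\mathsf{FB}\times\mathsf{FB})$-module $F$ is an extension of $F$ to a functor from $\mathsf{dwb}$ to $\mathbb{k}$-vector spaces. Its *contraction* $i^*:\delta_{1,1}F\to F$ is the action of the canonical morphisms $(X\amalg\{1\},Y\amalg\{1\})\to(X,Y)$ of $\mathsf{dwb}$. **Operads.** An operad (not necessarily with unit) is a $\mathbb{k}(\mathsf{FB}\times\mathsf{FB})$-module $\mathscr{O}$ with $\mathscr{O}(X,Y)=0$ unless $|Y|=1$ (here $X$ is the set of inputs and $Y$ that of outputs), together with a morphism $\widetilde\mu:\delta_{1,0}\mathscr{O}\circledcirc\delta_{0,1}\mathscr{O}\to\mathscr{O}$, $u\otimes v\mapsto u\circ v$ (partial composition, which glues the marked input of $u$ to the marked output of $v$), such that * $(u\circ v)\circ w=u\circ(v\circ w)$ for $u\otimes v\otimes w\in\delta_{1,0}\mathscr{O}\circledcirc\delta_{1,1}\mathscr{O}\circledcirc\delta_{0,1}\mathscr{O}$;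 * for $u\otimes v\otimes w\in\delta_{2,0}\mathscr{O}\circledcirc\delta_{0,1}\mathscr{O}\circledcirc\delta_{0,1}\mathscr{O}$, grafting first $v$ and then $w$ onto the two marked inputs of $u$ gives the same result as grafting first $w$ and then $v$ onto the same respective inputs. A morphism of operads is a morphism of $\mathbb{k}(\mathsf{FB}\times\mathsf{FB})$-modules compatible with $\widetilde\mu$. Partial composition induces a product $\overline\mu:\delta_{1,1}\mathscr{O}\circledcirc\delta_{1,1}\mathscr{O}\to\delta_{1,1}\mathscr{O}$, which glues the marked input of the first factor to the marked output of the second one. Let $\pi:\delta_{1,1}\mathscr{O}\to|\delta_{1,1}\mathscr{O}|$ be the coequalizer of $\overline\mu$ and $\overline\mu\circ\tau$. Grafting an element of $\delta_{0,1}\mathscr{O}$ onto an additional marked input gives a map $\delta_{1,0}(\delta_{1,1}\mathscr{O})\circledcirc\delta_{0,1}\mathscr{O}\to\delta_{1,1}\mathscr{O}$, and this passes to the quotient as $$\alpha:\delta_{1,0}|\delta_{1,1}\mathscr{O}|\circledcirc\delta_{0,1}\mathscr{O}\to|\delta_{1,1}\mathscr{O}|.$$ **Theorem.** Let $\mathscr{O}$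 be an operad, not necessarily with unit. 1. There is a unique $\mathbb{k}\mathsf{dwb}$-module structure on $S_\circledcirc^*(\mathscr{O}\oplus|\delta_{1,1}\mathscr{O}|)$, extending its $\mathbb{k}(\mathsf{FB}\times\mathsf{FB})$-module structure, whose contraction $i^*$ is given by edge contraction: with $\cdot$ denoting the product of the symmetric algebra, $$i^*(u\cdot v\cdot z)=\widetilde\mu(u\otimes v)\cdot z,\qquad i^*(w\cdot v\cdot z)=\alpha(w\otimes v)\cdot z,\qquad i^*(a\cdot z)=\pi(a)\cdot z$$ for all $u\in\delta_{1,0}\mathscr{O}$, $v\in\delta_{0,1}\mathscr{O}$, $w\in\delta_{1,0}|\delta_{1,1}\mathscr{O}|$, $a\in\delta_{1,1}\mathscr{O}$ and $z\in S_\circledcirc^*(\mathscr{O}\oplus|\delta_{1,1}\mathscr{O}|)$. This structure is natural: a morphism of operads $\mathscr{O}\to\mathscr{P}$ induces a morphism of $\mathbb{k}\mathsf{dwb}$-modules $S_\circledcirc^*(\mathscr{O}\oplus|\delta_{1,1}\mathscr{O}|)\to S_\circledcirc^*(\mathscr{P}\oplus|\delta_{1,1}\mathscr{P}|)$. 2.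 The morphism $S_\circledcirc^*(\mathscr{O}\oplus|\delta_{1,1}\mathscr{O}|)\to S_\circledcirc^*\mathscr{O}$ induced by the projection $\mathscr{O}\oplus|\delta_{1,1}\mathscr{O}|\to\mathscr{O}$ is surjective, and there is a unique $\mathbb{k}\mathsf{dwb}$-module structure on $S_\circledcirc^*\mathscr{O}$, extending its $\mathbb{k}(\mathsf{FB}\times\mathsf{FB})$-module structure, for which it is a morphism of $\mathbb{k}\mathsf{dwb}$-modules. This structure is natural: a morphism of operads $\mathscr{O}\to\mathscr{P}$ induces a morphism of $\mathbb{k}\mathsf{dwb}$-modules $S_\circledcirc^*\mathscr{O}\to S_\circledcirc^*\mathscr{P}$. -/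

import Mathlib

open CategoryTheory
open scoped DirectSum TensorProduct

universe u

/-! ### Finite sets and bijections, and modules over `FB × FB` -/

/-- A finite set: an object of the groupoid `FB` of finite sets and bijections. -/
structure FB where
  carrier : Type
  [fin : Finite carrier]

attribute [instance] FB.fin

instance : Category FB where
  Hom X Y := X.carrier ≃ Y.carrier
  id X := Equiv.refl X.carrier
  comp e f := Equiv.trans e f

/-- The category of `k(FB × FB)`-modules: functors from `FB × FB` to `k`-vector spaces. -/
abbrev FBBMod (k : Type u) [Field k] := (FB × FB) ⥤ ModuleCat.{u} k

section FBBMod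

variable {k : Type u} [Field k]

/-- The value `F(X, Y)`. -/
abbrev FBBMod.ev (F : FBBMod k) (X Y : Type) [Finite X] [Finite Y] : Type u :=
  F.obj ((⟨X⟩ : FB), (⟨Y⟩ : FB))

/-- The map `F(X, Y) → F(X', Y')` induced by a pair of bijections. -/
def FBBMod.act (F : FBBMod k) {X X' Y Y' : Type} [Finite X] [Finite X'] [Finite Y] [Finite Y']
    (e : X ≃ X') (f : Y ≃ Y') : F.ev X Y →ₗ[k] F.ev X' Y' :=
  (F.map (X := ((⟨X⟩ : FB), (⟨Y⟩ : FB))) (Y := ((⟨X'⟩ : FB), (⟨Y'⟩ : FB))) (e, f)).hom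

/-- The component at `(X, Y)` of a morphism of `k(FB × FB)`-modules. -/
def FBBMod.app {F G : FBBMod k} (φ : F ⟶ G) (X Y : Type) [Finite X] [Finite Y] :
    F.ev X Y →ₗ[k] G.ev X Y :=
  (φ.app ((⟨X⟩ : FB), (⟨Y⟩ : FB))).hom

theorem FBBMod.act_refl (F : FBBMod k) {X Y : Type} [Finite X] [Finite Y] (x : F.ev X Y) :
    F.act (Equiv.refl X) (Equiv.refl Y) x = x := by
  have := F.map_id ((⟨X⟩ : FB), (⟨Y⟩ : FB))
  exact congrArg (fun m => m.hom x) this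

theorem FBBMod.act_act (F : FBBMod k) {X X' X'' Y Y' Y'' : Type}
    [Finite X] [Finite X'] [Finite X''] [Finite Y] [Finite Y'] [Finite Y'']
    (e : X ≃ X') (f : Y ≃ Y') (e' : X' ≃ X'') (f' : Y' ≃ Y'') (x : F.ev X Y) :
    F.act e' f' (F.act e f x) = F.act (e.trans e') (f.trans f') x := by
  have := F.map_comp (X := ((⟨X⟩ : FB), (⟨Y⟩ : FB))) (Y := ((⟨X'⟩ : FB), (⟨Y'⟩ : FB)))
    (Z := ((⟨X''⟩ : FB), (⟨Y''⟩ : FB))) (e, f) (e', f')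
  exact (congrArg (fun m => m.hom x) this).symm

theorem FBBMod.app_act {F G : FBBMod k} (φ : F ⟶ G) {X X' Y Y' : Type}
    [Finite X] [Finite X'] [Finite Y] [Finite Y'] (e : X ≃ X') (f : Y ≃ Y') (x : F.ev X Y) :
    FBBMod.app φ X' Y' (F.act e f x) = G.act e f (FBBMod.app φ X Y x) := by
  have := φ.naturality (X := ((⟨X⟩ : FB), (⟨Y⟩ : FB))) (Y := ((⟨X'⟩ : FB), (⟨Y'⟩ : FB))) (e, f)
  exact congrArg (fun m => m.hom x) this

/-- Builds a `k(FB × FB)`-module from its values and its action maps. -/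
def FBBMod.mk' (V : (X Y : Type) → [Finite X] → [Finite Y] → ModuleCat.{u} k)
    (a : ∀ {X X' Y Y' : Type} [Finite X] [Finite X'] [Finite Y] [Finite Y'],
      (X ≃ X') → (Y ≃ Y') → (V X Y →ₗ[k] V X' Y'))
    (h1 : ∀ {X Y : Type} [Finite X] [Finite Y] (x : V X Y),
      a (Equiv.refl X) (Equiv.refl Y) x = x)
    (h2 : ∀ {X X' X'' Y Y' Y'' : Type}
      [Finite X] [Finite X'] [Finite X''] [Finite Y] [Finite Y'] [Finite Y'']
      (e : X ≃ X') (f : Y ≃ Y') (e' : X' ≃ X'') (f' : Y' ≃ Y'') (x : V X Y),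
      a e' f' (a e f x) = a (e.trans e') (f.trans f') x) : FBBMod k where
  obj P := V P.1.carrier P.2.carrier
  map m := ModuleCat.ofHom (a m.1 m.2)
  map_id P := by ext x; exact h1 x
  map_comp m n := by ext x; exact (h2 m.1 m.2 n.1 n.2 x).symm

/-- Builds a morphism of `k(FB × FB)`-modules from its components. -/
def FBBMod.homMk {F G : FBBMod k}
    (t : ∀ (X Y : Type) [Finite X] [Finite Y], F.ev X Y →ₗ[k] G.ev X Y)
    (h : ∀ {X X' Y Y' : Type} [Finite X] [Finite X'] [Finite Y] [Finite Y']
      (e : X ≃ X') (f : Y ≃ Y') (x : F.ev X Y),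
      t X' Y' (F.act e f x) = G.act e f (t X Y x)) : F ⟶ G where
  app P := ModuleCat.ofHom (t P.1.carrier P.2.carrier)
  naturality P Q m := by ext x; exact h m.1 m.2 x

/-- The direct sum `F ⊕ G` of two `k(FB × FB)`-modules. -/
def FBBMod.sum (F G : FBBMod k) : FBBMod k :=
  FBBMod.mk' (fun X Y _ _ => ModuleCat.of k (F.ev X Y × G.ev X Y))
    (fun e f => (F.act e f).prodMap (G.act e f))
    (fun x => by ext <;> simp [FBBMod.act_refl])
    (fun e f e' f' x => by ext <;> simp [FBBMod.act_act])

/-- The first inclusion `F(X, Y) → (F ⊕ G)(X, Y)`. -/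
def FBBMod.inl (F G : FBBMod k) {X Y : Type} [Finite X] [Finite Y] :
    F.ev X Y →ₗ[k] (F.sum G).ev X Y :=
  LinearMap.inl k (F.ev X Y) (G.ev X Y)

/-- The second inclusion `G(X, Y) → (F ⊕ G)(X, Y)`. -/
def FBBMod.inr (F G : FBBMod k) {X Y : Type} [Finite X] [Finite Y] :
    G.ev X Y →ₗ[k] (F.sum G).ev X Y :=
  LinearMap.inr k (F.ev X Y) (G.ev X Y)

/-- The projection `F ⊕ G → F`. -/
def FBBMod.fst (F G : FBBMod k) : F.sum G ⟶ F :=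
  FBBMod.homMk (fun X Y _ _ => LinearMap.fst k (F.ev X Y) (G.ev X Y)) (fun _ _ _ => rfl)

/-- The morphism `φ ⊕ ψ : F ⊕ G → F' ⊕ G'`. -/
def FBBMod.sumMap {F F' G G' : FBBMod k} (φ : F ⟶ F') (ψ : G ⟶ G') : F.sum G ⟶ F'.sum G' :=
  FBBMod.homMk
    (fun X Y _ _ => (FBBMod.app φ X Y).prodMap (FBBMod.app ψ X Y))
    (fun e f x => Prod.ext (FBBMod.app_act φ e f x.1) (FBBMod.app_act ψ e f x.2))

/-! ### Symmetric powers with respect to Day convolution -/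

/-- The fibre `f⁻¹(i)`. -/
abbrev Fib {X I : Type} (f : X → I) (i : I) : Type := {x : X // f x = i}

/-- The bijection between two fibres induced by a bijection of the ambient sets. -/
def fibEquiv {X X' I I' : Type} {f : X → I} {f' : X' → I'} {i : I} {i' : I'} (e : X ≃ X')
    (h : ∀ x, f x = i ↔ f' (e x) = i') : Fib f i ≃ Fib f' i' :=
  e.subtypeEquiv h

/-- The value at `(X, Y)` of the `d`-fold Day convolution of `F`: the direct sum, over all pairs of
ordered decompositions `X = ⨿ᵢ f⁻¹(i)` and `Y = ⨿ᵢ g⁻¹(i)` into `d` subsets, of the tensor products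
`⨂ᵢ F(f⁻¹(i), g⁻¹(i))`. -/
def FBBMod.convPow (F : FBBMod k) (d : ℕ) (X Y : Type) [Finite X] [Finite Y] : Type u :=
  ⨁ p : (X → Fin d) × (Y → Fin d), ⨂[k] i : Fin d, F.ev (Fib p.1 i) (Fib p.2 i)

noncomputable instance (F : FBBMod k) (d : ℕ) (X Y : Type) [Finite X] [Finite Y] :
    AddCommGroup (F.convPow d X Y) :=
  inferInstanceAs (AddCommGroup
    (⨁ p : (X → Fin d) × (Y → Fin d), ⨂[k] i : Fin d, F.ev (Fib p.1 i) (Fib p.2 i)))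

noncomputable instance (F : FBBMod k) (d : ℕ) (X Y : Type) [Finite X] [Finite Y] :
    Module k (F.convPow d X Y) :=
  inferInstanceAs (Module k
    (⨁ p : (X → Fin d) × (Y → Fin d), ⨂[k] i : Fin d, F.ev (Fib p.1 i) (Fib p.2 i)))

open scoped Classical in
/-- The inclusion of the summand of `convPow` indexed by the decompositions `f`, `g`. -/
noncomputable def FBBMod.convIncl (F : FBBMod k) {d : ℕ} {X Y : Type} [Finite X] [Finite Y]
    (f : X → Fin d) (g : Y → Fin d) :
    (⨂[k] i : Fin d, F.ev (Fib f i) (Fib g i)) →ₗ[k] F.convPow d X Y :=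
  DirectSum.lof k ((X → Fin d) × (Y → Fin d))
    (fun p => ⨂[k] i : Fin d, F.ev (Fib p.1 i) (Fib p.2 i)) (f, g)

open scoped Classical in
/-- A linear map out of `convPow` is given by linear maps on all summands. -/
noncomputable def FBBMod.convLift (F : FBBMod k) {d : ℕ} {X Y : Type} [Finite X] [Finite Y]
    {V : Type u} [AddCommGroup V] [Module k V]
    (φ : ∀ (f : X → Fin d) (g : Y → Fin d),
      (⨂[k] i : Fin d, F.ev (Fib f i) (Fib g i)) →ₗ[k] V) : F.convPow d X Y →ₗ[k] V :=
  DirectSum.toModule k ((X → Fin d) × (Y → Fin d)) V (fun p => φ p.1 p.2)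

theorem FBBMod.convLift_incl (F : FBBMod k) {d : ℕ} {X Y : Type} [Finite X] [Finite Y]
    {V : Type u} [AddCommGroup V] [Module k V]
    (φ : ∀ (f : X → Fin d) (g : Y → Fin d),
      (⨂[k] i : Fin d, F.ev (Fib f i) (Fib g i)) →ₗ[k] V)
    (f : X → Fin d) (g : Y → Fin d) (t : ⨂[k] i : Fin d, F.ev (Fib f i) (Fib g i)) :
    F.convLift φ (F.convIncl f g t) = φ f g t := by
  classical exact DirectSum.toModule_lof k (φ := fun p => φ p.1 p.2) (f, g) t

/-- The family `(aᵢ)` reindexed along a permutation `σ` with `f' = σ ∘ f` and `g' = σ ∘ g`: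
its entry at `i` is the entry of `a` at `σ⁻¹(i)`. -/
def FBBMod.permFam (F : FBBMod k) {d : ℕ} {X Y : Type} [Finite X] [Finite Y]
    {f f' : X → Fin d} {g g' : Y → Fin d} (σ : Equiv.Perm (Fin d))
    (hf : ∀ x, f' x = σ (f x)) (hg : ∀ y, g' y = σ (g y))
    (a : ∀ i, F.ev (Fib f i) (Fib g i)) (i : Fin d) : F.ev (Fib f' i) (Fib g' i) :=
  F.act
    (fibEquiv (f := f) (i := σ.symm i) (Equiv.refl X)
      (fun x => by rw [Equiv.refl_apply, hf, Equiv.eq_symm_apply]))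
    (fibEquiv (f := g) (i := σ.symm i) (Equiv.refl Y)
      (fun y => by rw [Equiv.refl_apply, hg, Equiv.eq_symm_apply]))
    (a (σ.symm i))

/-- The submodule spanned by all differences `t - σ · t`, where `σ` is in the symmetric group `𝔖_d`
and `t` is a pure tensor in one of the summands. -/
noncomputable def FBBMod.permRel (F : FBBMod k) (d : ℕ) (X Y : Type) [Finite X] [Finite Y] :
    Submodule k (F.convPow d X Y) :=
  Submodule.span k {z | ∃ (σ : Equiv.Perm (Fin d)) (f f' : X → Fin d) (g g' : Y → Fin d)
    (hf : ∀ x, f' x = σ (f x)) (hg : ∀ y, g' y = σ (g y))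
    (a : ∀ i, F.ev (Fib f i) (Fib g i)),
    z = F.convIncl f g (PiTensorProduct.tprod k a) -
      F.convIncl f' g' (PiTensorProduct.tprod k (F.permFam σ hf hg a))}

/-- The value at `(X, Y)` of the `d`-th symmetric power: the coinvariants for the action of the
symmetric group on the `d`-fold Day convolution. -/
def FBBMod.symPow (F : FBBMod k) (d : ℕ) (X Y : Type) [Finite X] [Finite Y] : Type u :=
  F.convPow d X Y ⧸ F.permRel d X Y

noncomputable instance (F : FBBMod k) (d : ℕ) (X Y : Type) [Finite X] [Finite Y] :
    AddCommGroup (F.symPow d X Y) :=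
  inferInstanceAs (AddCommGroup (F.convPow d X Y ⧸ F.permRel d X Y))

noncomputable instance (F : FBBMod k) (d : ℕ) (X Y : Type) [Finite X] [Finite Y] :
    Module k (F.symPow d X Y) :=
  inferInstanceAs (Module k (F.convPow d X Y ⧸ F.permRel d X Y))

/-- The quotient map from the `d`-fold Day convolution to the `d`-th symmetric power. -/
noncomputable def FBBMod.symProj (F : FBBMod k) (d : ℕ) (X Y : Type) [Finite X] [Finite Y] :
    F.convPow d X Y →ₗ[k] F.symPow d X Y :=
  (F.permRel d X Y).mkQ

/-- The value at `(X, Y)` of `S*F`, the direct sum of all symmetric powers. -/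
def FBBMod.symVal (F : FBBMod k) (X Y : Type) [Finite X] [Finite Y] : Type u :=
  ⨁ d : ℕ, F.symPow d X Y

noncomputable instance (F : FBBMod k) (X Y : Type) [Finite X] [Finite Y] :
    AddCommGroup (F.symVal X Y) :=
  inferInstanceAs (AddCommGroup (⨁ d : ℕ, F.symPow d X Y))

noncomputable instance (F : FBBMod k) (X Y : Type) [Finite X] [Finite Y] :
    Module k (F.symVal X Y) :=
  inferInstanceAs (Module k (⨁ d : ℕ, F.symPow d X Y))

/-- The inclusion of `S^d F(X, Y)` in `S*F(X, Y)`. -/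
noncomputable def FBBMod.symPowIncl (F : FBBMod k) (d : ℕ) (X Y : Type) [Finite X] [Finite Y] :
    F.symPow d X Y →ₗ[k] F.symVal X Y :=
  DirectSum.lof k ℕ (fun d => F.symPow d X Y) d

/-- The canonical map to `S*F(X, Y)` from the summand indexed by the decompositions `f`, `g`. -/
noncomputable def FBBMod.symIncl (F : FBBMod k) {d : ℕ} {X Y : Type} [Finite X] [Finite Y]
    (f : X → Fin d) (g : Y → Fin d) :
    (⨂[k] i : Fin d, F.ev (Fib f i) (Fib g i)) →ₗ[k] F.symVal X Y :=
  F.symPowIncl d X Y ∘ₗ F.symProj d X Y ∘ₗ F.convIncl f g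

/-- The class in `S*F(X, Y)` of a pure tensor `⨂ᵢ aᵢ`. -/
noncomputable def FBBMod.symMk (F : FBBMod k) {d : ℕ} {X Y : Type} [Finite X] [Finite Y]
    (f : X → Fin d) (g : Y → Fin d) (a : ∀ i, F.ev (Fib f i) (Fib g i)) : F.symVal X Y :=
  F.symIncl f g (PiTensorProduct.tprod k a)

theorem FBBMod.symMk_perm (F : FBBMod k) {d : ℕ} {X Y : Type} [Finite X] [Finite Y]
    (σ : Equiv.Perm (Fin d)) {f f' : X → Fin d} {g g' : Y → Fin d}
    (hf : ∀ x, f' x = σ (f x)) (hg : ∀ y, g' y = σ (g y))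
    (a : ∀ i, F.ev (Fib f i) (Fib g i)) :
    F.symMk f g a = F.symMk f' g' (F.permFam σ hf hg a) := by
  unfold symMk symIncl
  simp only [LinearMap.comp_apply]
  congr 1
  rw [← sub_eq_zero, ← map_sub]
  refine (Submodule.Quotient.mk_eq_zero (F.permRel d X Y)).mpr ?_
  exact Submodule.subset_span ⟨σ, f, f', g, g', hf, hg, a, rfl⟩

/-- Equality of classes of pure tensors whose entries agree up to the identity bijections. -/
theorem FBBMod.symMk_congr (F : FBBMod k) {d : ℕ} {X Y : Type} [Finite X] [Finite Y]
    {f f' : X → Fin d} {g g' : Y → Fin d} (hf : ∀ x, f x = f' x) (hg : ∀ y, g y = g' y)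
    (a : ∀ i, F.ev (Fib f i) (Fib g i)) (a' : ∀ i, F.ev (Fib f' i) (Fib g' i))
    (h : ∀ i, a' i = F.act (fibEquiv (Equiv.refl X) (fun x => by rw [hf]; rfl))
      (fibEquiv (Equiv.refl Y) (fun y => by rw [hg]; rfl)) (a i)) :
    F.symMk f g a = F.symMk f' g' a' := by
  obtain rfl : f = f' := funext hf
  obtain rfl : g = g' := funext hg
  congr 1
  funext i
  rw [h i]
  exact (F.act_refl (a i)).symm

/-- A linear map out of `S*F(X, Y)` is given by linear maps on the summands of all the Day
convolution powers that are invariant under the symmetric groups. -/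
noncomputable def FBBMod.symLift (F : FBBMod k) {X Y : Type} [Finite X] [Finite Y]
    {V : Type u} [AddCommGroup V] [Module k V]
    (φ : ∀ (d : ℕ) (f : X → Fin d) (g : Y → Fin d),
      (⨂[k] i : Fin d, F.ev (Fib f i) (Fib g i)) →ₗ[k] V)
    (h : ∀ (d : ℕ) (σ : Equiv.Perm (Fin d)) (f f' : X → Fin d) (g g' : Y → Fin d)
      (hf : ∀ x, f' x = σ (f x)) (hg : ∀ y, g' y = σ (g y))
      (a : ∀ i, F.ev (Fib f i) (Fib g i)),
      φ d f g (PiTensorProduct.tprod k a) =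
        φ d f' g' (PiTensorProduct.tprod k (F.permFam σ hf hg a))) :
    F.symVal X Y →ₗ[k] V :=
  DirectSum.toModule k ℕ V (fun d => (F.permRel d X Y).liftQ (F.convLift (φ d)) (by
    unfold permRel
    rw [Submodule.span_le]
    rintro z ⟨σ, f, f', g, g', hf, hg, a, rfl⟩
    rw [SetLike.mem_coe, LinearMap.mem_ker, map_sub, convLift_incl, convLift_incl, sub_eq_zero]
    exact h d σ f f' g g' hf hg a))

theorem FBBMod.symLift_mk (F : FBBMod k) {X Y : Type} [Finite X] [Finite Y]
    {V : Type u} [AddCommGroup V] [Module k V]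
    (φ : ∀ (d : ℕ) (f : X → Fin d) (g : Y → Fin d),
      (⨂[k] i : Fin d, F.ev (Fib f i) (Fib g i)) →ₗ[k] V) (h)
    {d : ℕ} (f : X → Fin d) (g : Y → Fin d) (a : ∀ i, F.ev (Fib f i) (Fib g i)) :
    F.symLift φ h (F.symMk f g a) = φ d f g (PiTensorProduct.tprod k a) := by
  unfold symLift symMk symIncl
  rw [LinearMap.comp_apply, LinearMap.comp_apply]
  refine (DirectSum.toModule_lof k (M := fun d => F.symPow d X Y) d _).trans ?_
  exact F.convLift_incl (φ d) f g _

theorem FBBMod.symVal_hom_ext (F : FBBMod k) {X Y : Type} [Finite X] [Finite Y]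
    {V : Type u} [AddCommGroup V] [Module k V] {φ ψ : F.symVal X Y →ₗ[k] V}
    (h : ∀ (d : ℕ) (f : X → Fin d) (g : Y → Fin d) (a : ∀ i, F.ev (Fib f i) (Fib g i)),
      φ (F.symMk f g a) = ψ (F.symMk f g a)) : φ = ψ := by
  classical
  apply DirectSum.linearMap_ext
  intro d
  apply Submodule.linearMap_qext
  apply DirectSum.linearMap_ext
  rintro ⟨f, g⟩
  apply PiTensorProduct.ext
  ext a
  exact h d f g a

theorem FBBMod.act_congr (F : FBBMod k) {X X' Y Y' : Type} [Finite X] [Finite X'] [Finite Y]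
    [Finite Y'] {e e' : X ≃ X'} {f f' : Y ≃ Y'} (he : ∀ x, e x = e' x) (hf : ∀ y, f y = f' y)
    (x : F.ev X Y) : F.act e f x = F.act e' f' x := by
  rw [Equiv.ext he, Equiv.ext hf]

/-- The bijection `f⁻¹(i) ≃ (f ∘ e⁻¹)⁻¹(i)`. -/
def fibMap {X X' I : Type} (e : X ≃ X') (f : X → I) (i : I) : Fib f i ≃ Fib (f ∘ e.symm) i :=
  fibEquiv e (fun x => by simp)

/-- The action of a pair of bijections on `S*F`: it transports the decompositions and the
entries of pure tensors. -/
noncomputable def FBBMod.symAct (F : FBBMod k) {X X' Y Y' : Type} [Finite X] [Finite X']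
    [Finite Y] [Finite Y'] (e : X ≃ X') (e' : Y ≃ Y') : F.symVal X Y →ₗ[k] F.symVal X' Y' :=
  F.symLift
    (fun _ f g => F.symIncl (f ∘ e.symm) (g ∘ e'.symm) ∘ₗ
      PiTensorProduct.map (fun i => F.act (fibMap e f i) (fibMap e' g i)))
    (by
      intro d σ f f' g g' hf hg a
      simp only [LinearMap.comp_apply, PiTensorProduct.map_tprod]
      refine (F.symMk_perm σ (f := f ∘ e.symm) (g := g ∘ e'.symm) (f' := f' ∘ e.symm)
        (g' := g' ∘ e'.symm) (fun x => hf _) (fun y => hg _)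
        (fun i => F.act (fibMap e f i) (fibMap e' g i) (a i))).trans ?_
      unfold symMk
      congr 2
      funext i
      simp only [permFam, act_act]
      exact F.act_congr (fun _ => rfl) (fun _ => rfl) _)

theorem FBBMod.symAct_mk (F : FBBMod k) {X X' Y Y' : Type} [Finite X] [Finite X']
    [Finite Y] [Finite Y'] (e : X ≃ X') (e' : Y ≃ Y') {d : ℕ} (f : X → Fin d) (g : Y → Fin d)
    (a : ∀ i, F.ev (Fib f i) (Fib g i)) :
    F.symAct e e' (F.symMk f g a) =
      F.symMk (f ∘ e.symm) (g ∘ e'.symm)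
        (fun i => F.act (fibMap e f i) (fibMap e' g i) (a i)) := by
  unfold symAct
  rw [symLift_mk, LinearMap.comp_apply, PiTensorProduct.map_tprod]
  rfl

/-- The `k(FB × FB)`-module `S*F`, the direct sum over `d` of the symmetric powers `S^d F` with
respect to Day convolution. -/
noncomputable def FBBMod.sym (F : FBBMod k) : FBBMod k :=
  FBBMod.mk' (fun X Y _ _ => ModuleCat.of k (F.symVal X Y))
    (fun e f => F.symAct e f)
    (by
      intro X Y _ _ x
      refine LinearMap.congr_fun (f := F.symAct _ _) (g := LinearMap.id)
        (F.symVal_hom_ext fun d f g a => ?_) x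
      rw [symAct_mk, LinearMap.id_apply]
      refine (F.symMk_congr (fun _ => rfl) (fun _ => rfl) _ _ (fun i => ?_)).symm
      exact F.act_congr (fun _ => rfl) (fun _ => rfl) _)
    (by
      intro X X' X'' Y Y' Y'' _ _ _ _ _ _ e f e' f' x
      refine LinearMap.congr_fun (f := F.symAct _ _ ∘ₗ F.symAct _ _) (g := F.symAct _ _)
        (F.symVal_hom_ext fun d p q a => ?_) x
      rw [LinearMap.comp_apply, symAct_mk, symAct_mk, symAct_mk]
      refine F.symMk_congr (fun _ => rfl) (fun _ => rfl) _ _ (fun i => ?_)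
      rw [act_act, act_act]
      exact F.act_congr (fun _ => rfl) (fun _ => rfl) _)

/-- The value of `S*φ` for a morphism `φ`: it applies `φ` to all entries of pure tensors. -/
noncomputable def FBBMod.symMapVal {F G : FBBMod k} (φ : F ⟶ G) (X Y : Type) [Finite X]
    [Finite Y] : F.symVal X Y →ₗ[k] G.symVal X Y :=
  F.symLift
    (fun _ f g => G.symIncl f g ∘ₗ PiTensorProduct.map (fun i => FBBMod.app φ (Fib f i) (Fib g i)))
    (by
      intro d σ f f' g g' hf hg a
      simp only [LinearMap.comp_apply, PiTensorProduct.map_tprod]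
      refine (G.symMk_perm σ hf hg _).trans ?_
      unfold symMk
      congr 2
      funext i
      simp only [permFam, app_act])

theorem FBBMod.symMapVal_mk {F G : FBBMod k} (φ : F ⟶ G) {X Y : Type} [Finite X]
    [Finite Y] {d : ℕ} (f : X → Fin d) (g : Y → Fin d) (a : ∀ i, F.ev (Fib f i) (Fib g i)) :
    FBBMod.symMapVal φ X Y (F.symMk f g a) =
      G.symMk f g (fun i => FBBMod.app φ (Fib f i) (Fib g i) (a i)) := by
  unfold symMapVal
  rw [symLift_mk, LinearMap.comp_apply, PiTensorProduct.map_tprod]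
  rfl

/-- The morphism `S*φ : S*F → S*G` induced by `φ : F → G`. -/
noncomputable def FBBMod.symMap {F G : FBBMod k} (φ : F ⟶ G) : F.sym ⟶ G.sym :=
  FBBMod.homMk (fun X Y _ _ => FBBMod.symMapVal φ X Y) (by
    intro X X' Y Y' _ _ _ _ e f x
    refine LinearMap.congr_fun (f := symMapVal φ X' Y' ∘ₗ F.symAct e f)
      (g := G.symAct e f ∘ₗ symMapVal φ X Y) (F.symVal_hom_ext fun d p q a => ?_) x
    simp only [LinearMap.comp_apply]
    rw [symAct_mk, symMapVal_mk, symMapVal_mk, symAct_mk]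
    congr 1
    funext i
    exact app_act φ _ _ _)

/-- The decomposition of `X₁ ⨿ X₂` obtained by adding `X₁` as a new first part to a decomposition
of `X₂`. -/
def consDec {X₁ X₂ : Type} {d : ℕ} (f : X₂ → Fin d) : X₁ ⊕ X₂ → Fin (d + 1) :=
  Sum.elim (fun _ => 0) (fun x => (f x).succ)

/-- The first part of `consDec f` is `X₁`. -/
def consFibZero (X₁ : Type) {X₂ : Type} {d : ℕ} (f : X₂ → Fin d) :
    X₁ ≃ Fib (consDec (X₁ := X₁) f) 0 where
  toFun x := ⟨Sum.inl x, rfl⟩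
  invFun
    | ⟨Sum.inl x, _⟩ => x
    | ⟨Sum.inr y, h⟩ => absurd h (Fin.succ_ne_zero (f y))
  left_inv _ := rfl
  right_inv
    | ⟨Sum.inl _, _⟩ => rfl
    | ⟨Sum.inr y, h⟩ => absurd h (Fin.succ_ne_zero (f y))

/-- The other parts of `consDec f` are the parts of `f`. -/
def consFibSucc (X₁ : Type) {X₂ : Type} {d : ℕ} (f : X₂ → Fin d) (i : Fin d) :
    Fib f i ≃ Fib (consDec (X₁ := X₁) f) i.succ where
  toFun x := ⟨Sum.inr x.1, congrArg Fin.succ x.2⟩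
  invFun
    | ⟨Sum.inl _, h⟩ => absurd h (Fin.succ_ne_zero i).symm
    | ⟨Sum.inr y, h⟩ => ⟨y, Fin.succ_injective _ h⟩
  left_inv _ := rfl
  right_inv
    | ⟨Sum.inl _, h⟩ => absurd h (Fin.succ_ne_zero i).symm
    | ⟨Sum.inr _, _⟩ => rfl

/-- The family obtained by adding `u` as a new first entry to the family `a`. -/
def FBBMod.consFam (F : FBBMod k) {X₁ X₂ Y₁ Y₂ : Type} [Finite X₁] [Finite X₂] [Finite Y₁]
    [Finite Y₂] {d : ℕ} {f : X₂ → Fin d} {g : Y₂ → Fin d} (u : F.ev X₁ Y₁)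
    (a : ∀ i, F.ev (Fib f i) (Fib g i)) :
    ∀ i : Fin (d + 1), F.ev (Fib (consDec (X₁ := X₁) f) i) (Fib (consDec (X₁ := Y₁) g) i) :=
  Fin.cons (α := fun i : Fin (d + 1) =>
      F.ev (Fib (consDec (X₁ := X₁) f) i) (Fib (consDec (X₁ := Y₁) g) i))
    (F.act (consFibZero X₁ f) (consFibZero Y₁ g) u)
    (fun i => F.act (consFibSucc X₁ f i) (consFibSucc Y₁ g i) (a i))

/-- The linear map `⨂ᵢ aᵢ ↦ u ⊗ ⨂ᵢ aᵢ`. -/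
noncomputable def FBBMod.consTensor (F : FBBMod k) {X₁ X₂ Y₁ Y₂ : Type} [Finite X₁] [Finite X₂]
    [Finite Y₁] [Finite Y₂] {d : ℕ} (f : X₂ → Fin d) (g : Y₂ → Fin d) (u : F.ev X₁ Y₁) :
    (⨂[k] i : Fin d, F.ev (Fib f i) (Fib g i)) →ₗ[k]
      (⨂[k] i : Fin (d + 1),
        F.ev (Fib (consDec (X₁ := X₁) f) i) (Fib (consDec (X₁ := Y₁) g) i)) :=
  PiTensorProduct.lift
    (((PiTensorProduct.tprod k (s := fun i : Fin (d + 1) =>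
        F.ev (Fib (consDec (X₁ := X₁) f) i) (Fib (consDec (X₁ := Y₁) g) i))).curryLeft
        (F.act (consFibZero X₁ f) (consFibZero Y₁ g) u)).compLinearMap
      (fun i => F.act (consFibSucc X₁ f i) (consFibSucc Y₁ g i)))

theorem FBBMod.consTensor_tprod (F : FBBMod k) {X₁ X₂ Y₁ Y₂ : Type} [Finite X₁] [Finite X₂]
    [Finite Y₁] [Finite Y₂] {d : ℕ} (f : X₂ → Fin d) (g : Y₂ → Fin d) (u : F.ev X₁ Y₁)
    (a : ∀ i, F.ev (Fib f i) (Fib g i)) :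
    F.consTensor f g u (PiTensorProduct.tprod k a) = PiTensorProduct.tprod k (F.consFam u a) := by
  unfold consTensor
  rw [PiTensorProduct.lift.tprod]
  rfl

/-- The permutation of `{0, …, d}` that fixes `0` and acts by `σ` on the other elements. -/
def succPerm {d : ℕ} (σ : Equiv.Perm (Fin d)) : Equiv.Perm (Fin (d + 1)) :=
  (finSuccEquiv d).trans ((Equiv.optionCongr σ).trans (finSuccEquiv d).symm)

theorem succPerm_zero {d : ℕ} (σ : Equiv.Perm (Fin d)) : succPerm σ 0 = 0 := by
  simp [succPerm]

theorem succPerm_succ {d : ℕ} (σ : Equiv.Perm (Fin d)) (i : Fin d) :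
    succPerm σ i.succ = (σ i).succ := by
  simp [succPerm]

theorem FBBMod.permFam_apply (F : FBBMod k) {d : ℕ} {X Y : Type} [Finite X] [Finite Y]
    {f f' : X → Fin d} {g g' : Y → Fin d} (σ : Equiv.Perm (Fin d))
    (hf : ∀ x, f' x = σ (f x)) (hg : ∀ y, g' y = σ (g y))
    (a : ∀ i, F.ev (Fib f i) (Fib g i)) (i j : Fin d) (h : σ j = i) :
    F.permFam σ hf hg a i = F.act
      (fibEquiv (Equiv.refl X) (fun x => by rw [Equiv.refl_apply, hf, ← h, σ.apply_eq_iff_eq]))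
      (fibEquiv (Equiv.refl Y) (fun y => by rw [Equiv.refl_apply, hg, ← h, σ.apply_eq_iff_eq]))
      (a j) := by
  obtain rfl : j = σ.symm i := by rw [← h, Equiv.symm_apply_apply]
  rfl

/-- Multiplication by a fixed generator `u ∈ F(X₁, Y₁)` in the symmetric algebra:
`S*F(X₂, Y₂) → S*F(X₁ ⨿ X₂, Y₁ ⨿ Y₂)`. -/
noncomputable def FBBMod.symConsMap (F : FBBMod k) {X₁ X₂ Y₁ Y₂ : Type} [Finite X₁] [Finite X₂]
    [Finite Y₁] [Finite Y₂] (u : F.ev X₁ Y₁) :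
    F.symVal X₂ Y₂ →ₗ[k] F.symVal (X₁ ⊕ X₂) (Y₁ ⊕ Y₂) :=
  F.symLift (fun _ f g => F.symIncl (consDec f) (consDec g) ∘ₗ F.consTensor f g u) (by
    intro d σ f f' g g' hf hg a
    simp only [LinearMap.comp_apply, consTensor_tprod]
    have h1 : ∀ x : X₁ ⊕ X₂, consDec f' x = succPerm σ (consDec f x) := by
      rintro (x | x)
      · exact (succPerm_zero σ).symm
      · exact (congrArg Fin.succ (hf x)).trans (succPerm_succ σ _).symm
    have h2 : ∀ x : Y₁ ⊕ Y₂, consDec g' x = succPerm σ (consDec g x) := by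
      rintro (x | x)
      · exact (succPerm_zero σ).symm
      · exact (congrArg Fin.succ (hg x)).trans (succPerm_succ σ _).symm
    refine (F.symMk_perm (succPerm σ) h1 h2 _).trans ?_
    unfold symMk
    congr 2
    funext i
    refine Fin.cases ?_ (fun j => ?_) i
    · rw [F.permFam_apply (succPerm σ) h1 h2 (F.consFam u a) 0 0 (succPerm_zero σ)]
      simp only [consFam, Fin.cons_zero]
      rw [F.act_act (consFibZero X₁ f) (consFibZero Y₁ g)]
      apply F.act_congr <;> intro x <;> rfl
    · rw [F.permFam_apply (succPerm σ) h1 h2 (F.consFam u a) j.succ (σ.symm j).succ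
        (by simp [succPerm_succ])]
      simp only [consFam, Fin.cons_succ, act_act, permFam]
      apply F.act_congr <;> intro x <;> exact Subtype.ext rfl)

theorem FBBMod.symConsMap_mk (F : FBBMod k) {X₁ X₂ Y₁ Y₂ : Type} [Finite X₁] [Finite X₂]
    [Finite Y₁] [Finite Y₂] (u : F.ev X₁ Y₁) {d : ℕ} (f : X₂ → Fin d) (g : Y₂ → Fin d)
    (a : ∀ i, F.ev (Fib f i) (Fib g i)) :
    F.symConsMap u (F.symMk f g a) = F.symMk (consDec f) (consDec g) (F.consFam u a) := by
  unfold symConsMap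
  rw [symLift_mk, LinearMap.comp_apply, consTensor_tprod]
  rfl

/-- `symConsMap` as a bilinear map. -/
noncomputable def FBBMod.symConsVal (F : FBBMod k) {X₁ X₂ Y₁ Y₂ : Type} [Finite X₁] [Finite X₂]
    [Finite Y₁] [Finite Y₂] :
    F.ev X₁ Y₁ →ₗ[k] F.symVal X₂ Y₂ →ₗ[k] F.symVal (X₁ ⊕ X₂) (Y₁ ⊕ Y₂) where
  toFun u := F.symConsMap u
  map_add' u v := by
    refine F.symVal_hom_ext fun d f g a => ?_
    rw [LinearMap.add_apply, symConsMap_mk, symConsMap_mk, symConsMap_mk]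
    unfold symMk consFam
    rw [map_add (F.act (consFibZero X₁ f) (consFibZero Y₁ g)), MultilinearMap.cons_add, map_add]
  map_smul' c u := by
    refine F.symVal_hom_ext fun d f g a => ?_
    rw [LinearMap.smul_apply, symConsMap_mk, symConsMap_mk]
    unfold symMk consFam
    rw [map_smul (F.act (consFibZero X₁ f) (consFibZero Y₁ g)), MultilinearMap.cons_smul, map_smul,
      RingHom.id_apply]

/-- The product `F ⊚ S*F → S*F` of the symmetric algebra, in the form of bilinear maps
`F(X₁, Y₁) × S*F(X₂, Y₂) → S*F(X₁ ⨿ X₂, Y₁ ⨿ Y₂)`. It sends `u` and the class of `⨂ᵢ aᵢ` to the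
class of `u ⊗ ⨂ᵢ aᵢ`. -/
noncomputable def FBBMod.symCons (F : FBBMod k) {X₁ X₂ Y₁ Y₂ : Type} [Finite X₁] [Finite X₂]
    [Finite Y₁] [Finite Y₂] :
    F.ev X₁ Y₁ →ₗ[k] F.sym.ev X₂ Y₂ →ₗ[k] F.sym.ev (X₁ ⊕ X₂) (Y₁ ⊕ Y₂) :=
  F.symConsVal


end FBBMod

/-! ### Operads without unit -/

/-- The bijection `(A ⨿ B) ⨿ C ≃ (A ⨿ C) ⨿ B`. -/
def sumRot (A B C : Type) : (A ⊕ B) ⊕ C ≃ (A ⊕ C) ⊕ B where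
  toFun
    | Sum.inl (Sum.inl a) => Sum.inl (Sum.inl a)
    | Sum.inl (Sum.inr b) => Sum.inr b
    | Sum.inr c => Sum.inl (Sum.inr c)
  invFun
    | Sum.inl (Sum.inl a) => Sum.inl (Sum.inl a)
    | Sum.inl (Sum.inr c) => Sum.inr c
    | Sum.inr b => Sum.inl (Sum.inr b)
  left_inv := by rintro ((a | b) | c) <;> rfl
  right_inv := by rintro ((a | b) | c) <;> rfl

/-- An operad, not necessarily with unit, in `k`-vector spaces, seen as a `k(FB × FB)`-module `O`
supported on the pairs `(X, Y)` with `|Y| = 1`. For `u ∈ O(X₁ ⨿ 1, Y₁)` and `v ∈ O(X₂, Y₂ ⨿ 1)`,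
`comp u v` is the partial composition that glues the marked input of `u` to the marked output of
`v`. Thus `comp` is a natural family of bilinear maps
`δ_{1,0} O (X₁, Y₁) × δ_{0,1} O (X₂, Y₂) → O (X₁ ⨿ X₂, Y₁ ⨿ Y₂)`, i.e. a morphism from the Day
convolution of `δ_{1,0} O` and `δ_{0,1} O` to `O`. -/
structure Operad (k : Type u) [Field k] where
  toMod : FBBMod k
  supp : ∀ (X Y : Type) [Finite X] [Finite Y], Nat.card Y ≠ 1 → Subsingleton (toMod.ev X Y)
  comp : ∀ {X₁ Y₁ X₂ Y₂ : Type} [Finite X₁] [Finite Y₁] [Finite X₂] [Finite Y₂],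
    toMod.ev (X₁ ⊕ Fin 1) Y₁ →ₗ[k] toMod.ev X₂ (Y₂ ⊕ Fin 1) →ₗ[k] toMod.ev (X₁ ⊕ X₂) (Y₁ ⊕ Y₂)
  comp_act : ∀ {X₁ Y₁ X₂ Y₂ X₁' Y₁' X₂' Y₂' : Type} [Finite X₁] [Finite Y₁] [Finite X₂] [Finite Y₂]
    [Finite X₁'] [Finite Y₁'] [Finite X₂'] [Finite Y₂']
    (e₁ : X₁ ≃ X₁') (f₁ : Y₁ ≃ Y₁') (e₂ : X₂ ≃ X₂') (f₂ : Y₂ ≃ Y₂')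
    (u : toMod.ev (X₁ ⊕ Fin 1) Y₁) (v : toMod.ev X₂ (Y₂ ⊕ Fin 1)),
    comp (toMod.act (Equiv.sumCongr e₁ (Equiv.refl (Fin 1))) f₁ u)
        (toMod.act e₂ (Equiv.sumCongr f₂ (Equiv.refl (Fin 1))) v) =
      toMod.act (Equiv.sumCongr e₁ e₂) (Equiv.sumCongr f₁ f₂) (comp u v)
  /-- Sequential composition: `(u ∘ v) ∘ w = u ∘ (v ∘ w)`, the output of `v` being glued to an input
  of `u` and the output of `w` to an input of `v`. -/
  assoc : ∀ {X₁ Y₁ X₂ Y₂ X₃ Y₃ : Type} [Finite X₁] [Finite Y₁] [Finite X₂] [Finite Y₂]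
    [Finite X₃] [Finite Y₃]
    (u : toMod.ev (X₁ ⊕ Fin 1) Y₁) (v : toMod.ev (X₂ ⊕ Fin 1) (Y₂ ⊕ Fin 1))
    (w : toMod.ev X₃ (Y₃ ⊕ Fin 1)),
    toMod.act (Equiv.sumAssoc X₁ X₂ X₃) (Equiv.sumAssoc Y₁ Y₂ Y₃)
        (comp (toMod.act (Equiv.sumAssoc X₁ X₂ (Fin 1)).symm (Equiv.refl (Y₁ ⊕ Y₂)) (comp u v)) w) =
      comp u (toMod.act (Equiv.refl (X₂ ⊕ X₃)) (sumRot Y₂ (Fin 1) Y₃) (comp v w))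
  /-- Parallel composition: `(u ∘ v) ∘ w = (u ∘ w) ∘ v`, the outputs of `v` and of `w` being glued to
  two different inputs of `u`. -/
  parallel : ∀ {X₁ Y₁ X₂ Y₂ X₃ Y₃ : Type} [Finite X₁] [Finite Y₁] [Finite X₂] [Finite Y₂]
    [Finite X₃] [Finite Y₃]
    (u : toMod.ev ((X₁ ⊕ Fin 1) ⊕ Fin 1) Y₁) (v : toMod.ev X₂ (Y₂ ⊕ Fin 1))
    (w : toMod.ev X₃ (Y₃ ⊕ Fin 1)),
    toMod.act (sumRot X₁ X₂ X₃) (sumRot Y₁ Y₂ Y₃)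
        (comp (toMod.act (sumRot X₁ (Fin 1) X₂) (Equiv.refl (Y₁ ⊕ Y₂)) (comp u v)) w) =
      comp (toMod.act (sumRot X₁ (Fin 1) X₃) (Equiv.refl (Y₁ ⊕ Y₃))
        (comp (toMod.act (sumRot X₁ (Fin 1) (Fin 1)) (Equiv.refl Y₁) u) w)) v

/-- A morphism of operads: a morphism of `k(FB × FB)`-modules compatible with the partial
compositions. -/
@[ext]
structure OperadHom {k : Type u} [Field k] (O P : Operad k) where
  hom : O.toMod ⟶ P.toMod
  map_comp : ∀ {X₁ Y₁ X₂ Y₂ : Type} [Finite X₁] [Finite Y₁] [Finite X₂] [Finite Y₂]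
    (u : O.toMod.ev (X₁ ⊕ Fin 1) Y₁) (v : O.toMod.ev X₂ (Y₂ ⊕ Fin 1)),
    FBBMod.app hom (X₁ ⊕ X₂) (Y₁ ⊕ Y₂) (O.comp u v) =
      P.comp (FBBMod.app hom (X₁ ⊕ Fin 1) Y₁ u) (FBBMod.app hom X₂ (Y₂ ⊕ Fin 1) v)

section Operad

variable {k : Type u} [Field k] (O : Operad k)

theorem Operad.comp_act_left {X₁ Y₁ X₂ Y₂ X₁' Y₁' : Type} [Finite X₁] [Finite Y₁] [Finite X₂]
    [Finite Y₂] [Finite X₁'] [Finite Y₁'] (e : X₁ ≃ X₁') (f : Y₁ ≃ Y₁')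
    (u : O.toMod.ev (X₁ ⊕ Fin 1) Y₁) (v : O.toMod.ev X₂ (Y₂ ⊕ Fin 1)) :
    O.comp (O.toMod.act (Equiv.sumCongr e (Equiv.refl (Fin 1))) f u) v =
      O.toMod.act (Equiv.sumCongr e (Equiv.refl X₂)) (Equiv.sumCongr f (Equiv.refl Y₂))
        (O.comp u v) := by
  rw [← O.comp_act, Equiv.sumCongr_refl, O.toMod.act_refl]

theorem Operad.comp_act_right {X₁ Y₁ X₂ Y₂ X₂' Y₂' : Type} [Finite X₁] [Finite Y₁] [Finite X₂]
    [Finite Y₂] [Finite X₂'] [Finite Y₂'] (e : X₂ ≃ X₂') (f : Y₂ ≃ Y₂')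
    (u : O.toMod.ev (X₁ ⊕ Fin 1) Y₁) (v : O.toMod.ev X₂ (Y₂ ⊕ Fin 1)) :
    O.comp u (O.toMod.act e (Equiv.sumCongr f (Equiv.refl (Fin 1))) v) =
      O.toMod.act (Equiv.sumCongr (Equiv.refl X₁) e) (Equiv.sumCongr (Equiv.refl Y₁) f)
        (O.comp u v) := by
  rw [← O.comp_act, Equiv.sumCongr_refl, O.toMod.act_refl]

/-- The product of `δ_{1,1} O`: for `a ∈ O(X₁ ⨿ 1, Y₁ ⨿ 1)` and `b ∈ O(X₂ ⨿ 1, Y₂ ⨿ 1)`, the marked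
input of `a` is glued to the marked output of `b`; the marked points of the result are the marked
input of `b` and the marked output of `a`. -/
def Operad.barMul {X₁ Y₁ X₂ Y₂ : Type} [Finite X₁] [Finite Y₁] [Finite X₂] [Finite Y₂]
    (a : O.toMod.ev (X₁ ⊕ Fin 1) (Y₁ ⊕ Fin 1)) (b : O.toMod.ev (X₂ ⊕ Fin 1) (Y₂ ⊕ Fin 1)) :
    O.toMod.ev ((X₁ ⊕ X₂) ⊕ Fin 1) ((Y₁ ⊕ Y₂) ⊕ Fin 1) :=
  O.toMod.act (Equiv.sumAssoc X₁ X₂ (Fin 1)).symm (sumRot Y₁ (Fin 1) Y₂) (O.comp a b)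

/-- The action of `O` on `δ_{1,1} O`: for `a ∈ O((X₁ ⨿ 1) ⨿ 1, Y₁ ⨿ 1)`, in which the outer marked
input and the marked output belong to `δ_{1,1}`, and `v ∈ O(X₂, Y₂ ⨿ 1)`, the inner marked input of
`a` is glued to the marked output of `v`. -/
def Operad.barAct {X₁ Y₁ X₂ Y₂ : Type} [Finite X₁] [Finite Y₁] [Finite X₂] [Finite Y₂] :
    O.toMod.ev ((X₁ ⊕ Fin 1) ⊕ Fin 1) (Y₁ ⊕ Fin 1) →ₗ[k] O.toMod.ev X₂ (Y₂ ⊕ Fin 1) →ₗ[k]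
      O.toMod.ev ((X₁ ⊕ X₂) ⊕ Fin 1) ((Y₁ ⊕ Y₂) ⊕ Fin 1) :=
  (O.comp.compr₂ (O.toMod.act (sumRot X₁ (Fin 1) X₂) (sumRot Y₁ (Fin 1) Y₂))).comp
    (O.toMod.act (sumRot X₁ (Fin 1) (Fin 1)) (Equiv.refl (Y₁ ⊕ Fin 1)))

/-- The span of all commutators `a b - b a` in `δ_{1,1} O (X, Y)`, where `a` and `b` range over
`δ_{1,1} O (X₁, Y₁)` and `δ_{1,1} O (X₂, Y₂)` for all decompositions `X₁ ⨿ X₂ ≃ X`,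
`Y₁ ⨿ Y₂ ≃ Y`. -/
def Operad.commutators (X Y : Type) [Finite X] [Finite Y] :
    Submodule k (O.toMod.ev (X ⊕ Fin 1) (Y ⊕ Fin 1)) :=
  Submodule.span k {z | ∃ (X₁ X₂ Y₁ Y₂ : Type) (_ : Finite X₁) (_ : Finite X₂) (_ : Finite Y₁)
    (_ : Finite Y₂) (e : X₁ ⊕ X₂ ≃ X) (f : Y₁ ⊕ Y₂ ≃ Y)
    (a : O.toMod.ev (X₁ ⊕ Fin 1) (Y₁ ⊕ Fin 1)) (b : O.toMod.ev (X₂ ⊕ Fin 1) (Y₂ ⊕ Fin 1)),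
    z = O.toMod.act (Equiv.sumCongr e (Equiv.refl (Fin 1))) (Equiv.sumCongr f (Equiv.refl (Fin 1)))
          (O.barMul a b) -
        O.toMod.act (Equiv.sumCongr ((Equiv.sumComm X₂ X₁).trans e) (Equiv.refl (Fin 1)))
          (Equiv.sumCongr ((Equiv.sumComm Y₂ Y₁).trans f) (Equiv.refl (Fin 1))) (O.barMul b a)}

theorem Operad.act_commutators {X X' Y Y' : Type} [Finite X] [Finite X'] [Finite Y] [Finite Y']
    (e : X ≃ X') (f : Y ≃ Y') :
    O.commutators X Y ≤ (O.commutators X' Y').comap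
      (O.toMod.act (Equiv.sumCongr e (Equiv.refl (Fin 1)))
        (Equiv.sumCongr f (Equiv.refl (Fin 1)))) := by
  unfold commutators
  rw [Submodule.span_le]
  rintro z ⟨X₁, X₂, Y₁, Y₂, _, _, _, _, e', f', a, b, rfl⟩
  refine Submodule.subset_span ⟨X₁, X₂, Y₁, Y₂, inferInstance, inferInstance, inferInstance,
    inferInstance, e'.trans e, f'.trans f, a, b, ?_⟩
  rw [map_sub, FBBMod.act_act, FBBMod.act_act]
  simp only [Equiv.sumCongr_trans, Equiv.trans_refl, Equiv.trans_assoc]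

/-- The commutator quotient `|δ_{1,1} O|`, the coequalizer of the product of `δ_{1,1} O` and of the
opposite product. -/
def Operad.wheel : FBBMod k :=
  FBBMod.mk'
    (fun X Y _ _ => ModuleCat.of k (O.toMod.ev (X ⊕ Fin 1) (Y ⊕ Fin 1) ⧸ O.commutators X Y))
    (fun {X X' Y Y'} _ _ _ _ e f => (O.commutators X Y).mapQ (O.commutators X' Y')
      (O.toMod.act (Equiv.sumCongr e (Equiv.refl (Fin 1))) (Equiv.sumCongr f (Equiv.refl (Fin 1))))
      (O.act_commutators e f))
    (by
      intro X Y _ _ x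
      obtain ⟨x, rfl⟩ := Submodule.Quotient.mk_surjective _ x
      rw [Submodule.mapQ_apply, Equiv.sumCongr_refl, Equiv.sumCongr_refl, FBBMod.act_refl])
    (by
      intro X X' X'' Y Y' Y'' _ _ _ _ _ _ e f e' f' x
      obtain ⟨x, rfl⟩ := Submodule.Quotient.mk_surjective _ x
      simp only [Submodule.mapQ_apply, FBBMod.act_act, Equiv.sumCongr_trans, Equiv.trans_refl])

/-- The projection `π : δ_{1,1} O (X, Y) → |δ_{1,1} O| (X, Y)`. -/
def Operad.proj {X Y : Type} [Finite X] [Finite Y] :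
    O.toMod.ev (X ⊕ Fin 1) (Y ⊕ Fin 1) →ₗ[k] O.wheel.ev X Y :=
  (O.commutators X Y).mkQ

theorem Operad.proj_act {X X' Y Y' : Type} [Finite X] [Finite X'] [Finite Y] [Finite Y']
    (e : X ≃ X') (f : Y ≃ Y') (x : O.toMod.ev (X ⊕ Fin 1) (Y ⊕ Fin 1)) :
    O.proj (O.toMod.act (Equiv.sumCongr e (Equiv.refl (Fin 1)))
      (Equiv.sumCongr f (Equiv.refl (Fin 1))) x) = O.wheel.act e f (O.proj x) :=
  rfl

theorem Operad.barMul_act {X₁ Y₁ X₂ Y₂ X₁' Y₁' X₂' Y₂' : Type} [Finite X₁] [Finite Y₁]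
    [Finite X₂] [Finite Y₂] [Finite X₁'] [Finite Y₁'] [Finite X₂'] [Finite Y₂']
    (e₁ : X₁ ≃ X₁') (f₁ : Y₁ ≃ Y₁') (e₂ : X₂ ≃ X₂') (f₂ : Y₂ ≃ Y₂')
    (a : O.toMod.ev (X₁ ⊕ Fin 1) (Y₁ ⊕ Fin 1)) (b : O.toMod.ev (X₂ ⊕ Fin 1) (Y₂ ⊕ Fin 1)) :
    O.barMul
        (O.toMod.act (Equiv.sumCongr e₁ (Equiv.refl (Fin 1)))
          (Equiv.sumCongr f₁ (Equiv.refl (Fin 1))) a)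
        (O.toMod.act (Equiv.sumCongr e₂ (Equiv.refl (Fin 1)))
          (Equiv.sumCongr f₂ (Equiv.refl (Fin 1))) b) =
      O.toMod.act (Equiv.sumCongr (Equiv.sumCongr e₁ e₂) (Equiv.refl (Fin 1)))
        (Equiv.sumCongr (Equiv.sumCongr f₁ f₂) (Equiv.refl (Fin 1))) (O.barMul a b) := by
  unfold barMul
  rw [O.comp_act, FBBMod.act_act, FBBMod.act_act]
  apply FBBMod.act_congr
  · rintro (x | x | x) <;> rfl
  · rintro ((x | x) | x) <;> rfl

theorem Operad.barAct_barMul_left {A B C D X Y : Type} [Finite A] [Finite B] [Finite C] [Finite D]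
    [Finite X] [Finite Y]
    (a : O.toMod.ev ((A ⊕ Fin 1) ⊕ Fin 1) (B ⊕ Fin 1)) (b : O.toMod.ev (X ⊕ Fin 1) (Y ⊕ Fin 1))
    (v : O.toMod.ev C (D ⊕ Fin 1)) :
    O.barAct (O.toMod.act (Equiv.sumCongr (sumRot A (Fin 1) X) (Equiv.refl (Fin 1)))
        (Equiv.refl ((B ⊕ Y) ⊕ Fin 1)) (O.barMul a b)) v =
      O.toMod.act (Equiv.sumCongr (sumRot A C X) (Equiv.refl (Fin 1)))
        (Equiv.sumCongr (sumRot B D Y) (Equiv.refl (Fin 1))) (O.barMul (O.barAct a v) b) := by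
  have h := O.parallel a b v
  have h2 : O.toMod.act (sumRot (A ⊕ X) (Fin 1) (Fin 1)) (Equiv.refl ((B ⊕ Y) ⊕ Fin 1))
      (O.toMod.act (Equiv.sumCongr (sumRot A (Fin 1) X) (Equiv.refl (Fin 1)))
        (Equiv.refl ((B ⊕ Y) ⊕ Fin 1)) (O.barMul a b)) =
      O.toMod.act (Equiv.sumCongr (Equiv.sumAssoc A X (Fin 1)).symm (Equiv.refl (Fin 1)))
        (sumRot B (Fin 1) Y) (O.toMod.act (sumRot A (Fin 1) (X ⊕ Fin 1))
          (Equiv.refl ((B ⊕ Fin 1) ⊕ Y)) (O.comp a b)) := by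
    unfold barMul
    simp only [FBBMod.act_act]
    apply FBBMod.act_congr
    · rintro ((x | x) | x | x) <;> rfl
    · rintro ((x | x) | x) <;> rfl
  have h3 : O.toMod.act (sumRot A (Fin 1) C) (sumRot B (Fin 1) D)
      (O.comp (O.toMod.act (sumRot A (Fin 1) (Fin 1)) (Equiv.refl (B ⊕ Fin 1)) a) v) =
      O.toMod.act (Equiv.sumCongr (Equiv.refl (A ⊕ C)) (Equiv.refl (Fin 1))) (sumRot B (Fin 1) D)
        (O.toMod.act (sumRot A (Fin 1) C) (Equiv.refl ((B ⊕ Fin 1) ⊕ D))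
      (O.comp (O.toMod.act (sumRot A (Fin 1) (Fin 1)) (Equiv.refl (B ⊕ Fin 1)) a) v)) := by
    simp only [FBBMod.act_act]
    apply FBBMod.act_congr
    · rintro ((x | x) | x) <;> rfl
    · rintro ((x | x) | x) <;> rfl
  simp only [barAct, LinearMap.comp_apply, LinearMap.compr₂_apply]
  rw [h2, O.comp_act_left, h3]
  unfold barMul
  rw [O.comp_act_left, ← h]
  simp only [FBBMod.act_act]
  apply FBBMod.act_congr
  · rintro ((x | x | x) | x) <;> rfl
  · rintro (((x | x) | x) | x) <;> rfl

theorem Operad.barAct_barMul_right {A B C D X Y : Type} [Finite A] [Finite B] [Finite C] [Finite D]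
    [Finite X] [Finite Y]
    (a : O.toMod.ev ((A ⊕ Fin 1) ⊕ Fin 1) (B ⊕ Fin 1)) (b : O.toMod.ev (X ⊕ Fin 1) (Y ⊕ Fin 1))
    (v : O.toMod.ev C (D ⊕ Fin 1)) :
    O.barAct (O.toMod.act
        (Equiv.sumCongr ((Equiv.sumComm X (A ⊕ Fin 1)).trans (sumRot A (Fin 1) X))
          (Equiv.refl (Fin 1)))
        (Equiv.sumCongr (Equiv.sumComm Y B) (Equiv.refl (Fin 1))) (O.barMul b a)) v =
      O.toMod.act
        (Equiv.sumCongr ((Equiv.sumComm X (A ⊕ C)).trans (sumRot A C X)) (Equiv.refl (Fin 1)))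
        (Equiv.sumCongr ((Equiv.sumComm Y (B ⊕ D)).trans (sumRot B D Y)) (Equiv.refl (Fin 1)))
        (O.barMul b (O.barAct a v)) := by
  have h := O.assoc b (O.toMod.act (sumRot A (Fin 1) (Fin 1)) (Equiv.refl (B ⊕ Fin 1)) a) v
  have h1 : O.comp b (O.toMod.act (sumRot A (Fin 1) (Fin 1)) (Equiv.refl (B ⊕ Fin 1)) a) =
      O.toMod.act (Equiv.sumCongr (Equiv.refl X) (sumRot A (Fin 1) (Fin 1)))
        (Equiv.refl _) (O.comp b a) := by
    have := O.comp_act_right (sumRot A (Fin 1) (Fin 1)) (Equiv.refl B) b a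
    rw [Equiv.sumCongr_refl, Equiv.sumCongr_refl] at this
    exact this
  have h2 : O.toMod.act (sumRot (A ⊕ X) (Fin 1) (Fin 1)) (Equiv.refl ((B ⊕ Y) ⊕ Fin 1))
      (O.toMod.act
        (Equiv.sumCongr ((Equiv.sumComm X (A ⊕ Fin 1)).trans (sumRot A (Fin 1) X))
          (Equiv.refl (Fin 1)))
        (Equiv.sumCongr (Equiv.sumComm Y B) (Equiv.refl (Fin 1))) (O.barMul b a)) =
      O.toMod.act (Equiv.sumCongr ((Equiv.sumAssoc X A (Fin 1)).symm.trans
        (Equiv.sumCongr (Equiv.sumComm X A) (Equiv.refl (Fin 1)))) (Equiv.refl (Fin 1)))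
        ((sumRot Y (Fin 1) B).trans (Equiv.sumCongr (Equiv.sumComm Y B) (Equiv.refl (Fin 1))))
        (O.toMod.act (Equiv.sumAssoc X (A ⊕ Fin 1) (Fin 1)).symm (Equiv.refl _)
          (O.comp b (O.toMod.act (sumRot A (Fin 1) (Fin 1)) (Equiv.refl (B ⊕ Fin 1)) a))) := by
    rw [h1]
    unfold barMul
    simp only [FBBMod.act_act]
    apply FBBMod.act_congr
    · rintro (x | (x | x) | x) <;> rfl
    · rintro ((x | x) | x) <;> rfl
  have h3 : O.toMod.act (sumRot A (Fin 1) C) (sumRot B (Fin 1) D)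
      (O.comp (O.toMod.act (sumRot A (Fin 1) (Fin 1)) (Equiv.refl (B ⊕ Fin 1)) a) v) =
      O.toMod.act (sumRot A (Fin 1) C)
        (Equiv.sumCongr (Equiv.refl (B ⊕ D)) (Equiv.refl (Fin 1)))
        (O.toMod.act (Equiv.refl _) (sumRot B (Fin 1) D)
      (O.comp (O.toMod.act (sumRot A (Fin 1) (Fin 1)) (Equiv.refl (B ⊕ Fin 1)) a) v)) := by
    simp only [FBBMod.act_act]
    apply FBBMod.act_congr
    · rintro ((x | x) | x) <;> rfl
    · rintro ((x | x) | x) <;> rfl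
  simp only [barAct, LinearMap.comp_apply, LinearMap.compr₂_apply]
  rw [h2, O.comp_act_left, h3]
  unfold barMul
  rw [O.comp_act_right, ← h]
  simp only [FBBMod.act_act]
  apply FBBMod.act_congr
  · rintro ((x | x | x) | x) <;> rfl
  · rintro (((x | x) | x) | x) <;> rfl

theorem Operad.barAct_act {X₁ Y₁ X₂ Y₂ X₁' Y₁' X₂' Y₂' : Type} [Finite X₁] [Finite Y₁]
    [Finite X₂] [Finite Y₂] [Finite X₁'] [Finite Y₁'] [Finite X₂'] [Finite Y₂']
    (e₁ : X₁ ≃ X₁') (f₁ : Y₁ ≃ Y₁') (e₂ : X₂ ≃ X₂') (f₂ : Y₂ ≃ Y₂')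
    (a : O.toMod.ev ((X₁ ⊕ Fin 1) ⊕ Fin 1) (Y₁ ⊕ Fin 1)) (v : O.toMod.ev X₂ (Y₂ ⊕ Fin 1)) :
    O.barAct
        (O.toMod.act (Equiv.sumCongr (Equiv.sumCongr e₁ (Equiv.refl (Fin 1))) (Equiv.refl (Fin 1)))
          (Equiv.sumCongr f₁ (Equiv.refl (Fin 1))) a)
        (O.toMod.act e₂ (Equiv.sumCongr f₂ (Equiv.refl (Fin 1))) v) =
      O.toMod.act (Equiv.sumCongr (Equiv.sumCongr e₁ e₂) (Equiv.refl (Fin 1)))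
        (Equiv.sumCongr (Equiv.sumCongr f₁ f₂) (Equiv.refl (Fin 1))) (O.barAct a v) := by
  have h : O.toMod.act (sumRot X₁' (Fin 1) (Fin 1)) (Equiv.refl (Y₁' ⊕ Fin 1))
      (O.toMod.act (Equiv.sumCongr (Equiv.sumCongr e₁ (Equiv.refl (Fin 1))) (Equiv.refl (Fin 1)))
          (Equiv.sumCongr f₁ (Equiv.refl (Fin 1))) a) =
      O.toMod.act (Equiv.sumCongr (Equiv.sumCongr e₁ (Equiv.refl (Fin 1))) (Equiv.refl (Fin 1)))
        (Equiv.sumCongr f₁ (Equiv.refl (Fin 1)))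
        (O.toMod.act (sumRot X₁ (Fin 1) (Fin 1)) (Equiv.refl (Y₁ ⊕ Fin 1)) a) := by
    simp only [FBBMod.act_act]
    apply FBBMod.act_congr
    · rintro ((x | x) | x) <;> rfl
    · rintro (x | x) <;> rfl
  simp only [barAct, LinearMap.comp_apply, LinearMap.compr₂_apply]
  rw [h, O.comp_act, FBBMod.act_act, FBBMod.act_act]
  apply FBBMod.act_congr
  · rintro ((x | x) | x) <;> rfl
  · rintro ((x | x) | x) <;> rfl

/-- A finite set with a distinguished element is of the form `A ⨿ 1`. -/
theorem exists_sum_one {X : Type} [Finite X] (x : X) :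
    ∃ (A : Type) (_ : Finite A) (e : A ⊕ Fin 1 ≃ X), e (Sum.inr 0) = x := by
  classical
  refine ⟨{y : X // y ≠ x}, inferInstance,
    ⟨Sum.elim Subtype.val (fun _ => x),
      fun y => if h : y = x then Sum.inr 0 else Sum.inl ⟨y, h⟩, ?_, ?_⟩, rfl⟩
  · rintro (⟨y, hy⟩ | y)
    · simp [hy]
    · simp [Subsingleton.elim y 0]
  · intro y
    by_cases h : y = x <;> simp [h]

/-- A bijection that preserves the distinguished elements restricts to the complements. -/
theorem exists_sumCongr_one {A B : Type} (e : A ⊕ Fin 1 ≃ B ⊕ Fin 1)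
    (h : e (Sum.inr 0) = Sum.inr 0) :
    ∃ e' : A ≃ B, e = Equiv.sumCongr e' (Equiv.refl (Fin 1)) := by
  have h1 : ∀ a : A, ∃ b : B, e (Sum.inl a) = Sum.inl b := by
    intro a
    rcases hb : e (Sum.inl a) with b | b
    · exact ⟨b, rfl⟩
    · rw [Subsingleton.elim b 0, ← h] at hb
      exact absurd (e.injective hb) (by simp)
  choose t ht using h1
  have hinj : Function.Injective t := fun a a' haa => by
    have := (ht a).trans ((congrArg Sum.inl haa).trans (ht a').symm)
    exact Sum.inl_injective (e.injective this)
  have hsurj : Function.Surjective t := fun b => by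
    obtain ⟨x, hx⟩ := e.surjective (Sum.inl b)
    rcases x with a | a
    · exact ⟨a, Sum.inl_injective ((ht a).symm.trans hx)⟩
    · rw [Subsingleton.elim a 0, h] at hx
      exact absurd hx (by simp)
  refine ⟨Equiv.ofBijective t ⟨hinj, hsurj⟩, ?_⟩
  ext x
  rcases x with a | a
  · exact ht a
  · rw [Subsingleton.elim a 0]
    exact h

theorem Operad.barAct_commutator_mem {X₁ X₂ Y₁ Y₂ X Y C D : Type} [Finite X₁] [Finite X₂]
    [Finite Y₁] [Finite Y₂] [Finite X] [Finite Y] [Finite C] [Finite D]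
    (e : X₁ ⊕ X₂ ≃ X ⊕ Fin 1) (f : Y₁ ⊕ Y₂ ≃ Y) (x₀ : X₁) (hx : e (Sum.inl x₀) = Sum.inr 0)
    (a : O.toMod.ev (X₁ ⊕ Fin 1) (Y₁ ⊕ Fin 1)) (b : O.toMod.ev (X₂ ⊕ Fin 1) (Y₂ ⊕ Fin 1))
    (v : O.toMod.ev C (D ⊕ Fin 1)) :
    O.barAct (O.toMod.act (Equiv.sumCongr e (Equiv.refl (Fin 1)))
          (Equiv.sumCongr f (Equiv.refl (Fin 1))) (O.barMul a b)) v -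
        O.barAct (O.toMod.act
          (Equiv.sumCongr ((Equiv.sumComm X₂ X₁).trans e) (Equiv.refl (Fin 1)))
          (Equiv.sumCongr ((Equiv.sumComm Y₂ Y₁).trans f) (Equiv.refl (Fin 1)))
          (O.barMul b a)) v ∈ O.commutators (X ⊕ C) (Y ⊕ D) := by
  obtain ⟨A, _, p, hp⟩ := exists_sum_one x₀
  obtain ⟨e', he'⟩ := exists_sumCongr_one
    ((sumRot A X₂ (Fin 1)).trans ((Equiv.sumCongr p (Equiv.refl X₂)).trans e))
    (by
      change e (Sum.inl (p (Sum.inr 0))) = _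
      rw [hp, hx])
  have he : (Equiv.sumCongr p (Equiv.refl X₂)).trans e =
      (sumRot A (Fin 1) X₂).trans (Equiv.sumCongr e' (Equiv.refl (Fin 1))) := by
    rw [← he']
    ext x
    rcases x with (x | x) | x <;> rfl
  obtain ⟨a, rfl⟩ : ∃ a' : O.toMod.ev ((A ⊕ Fin 1) ⊕ Fin 1) (Y₁ ⊕ Fin 1),
      a = O.toMod.act (Equiv.sumCongr p (Equiv.refl (Fin 1)))
        (Equiv.sumCongr (Equiv.refl Y₁) (Equiv.refl (Fin 1))) a' := by
    refine ⟨O.toMod.act (Equiv.sumCongr p (Equiv.refl (Fin 1))).symm (Equiv.refl _) a, ?_⟩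
    rw [FBBMod.act_act]
    refine ((O.toMod.act_congr (fun x => ?_) (fun y => ?_) a).trans (O.toMod.act_refl a)).symm
    · exact (Equiv.sumCongr p (Equiv.refl (Fin 1))).apply_symm_apply x
    · rcases y with y | y <;> rfl
  obtain hb : b = O.toMod.act (Equiv.sumCongr (Equiv.refl X₂) (Equiv.refl (Fin 1)))
        (Equiv.sumCongr (Equiv.refl Y₂) (Equiv.refl (Fin 1))) b := by
    rw [Equiv.sumCongr_refl, Equiv.sumCongr_refl, FBBMod.act_refl]
  have hv : v = O.toMod.act (Equiv.refl C) (Equiv.sumCongr (Equiv.refl D) (Equiv.refl (Fin 1)))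
      v := by
    rw [Equiv.sumCongr_refl, FBBMod.act_refl]
  have h1 : O.barAct (O.toMod.act (Equiv.sumCongr e (Equiv.refl (Fin 1)))
          (Equiv.sumCongr f (Equiv.refl (Fin 1))) (O.barMul (O.toMod.act
            (Equiv.sumCongr p (Equiv.refl (Fin 1)))
            (Equiv.sumCongr (Equiv.refl Y₁) (Equiv.refl (Fin 1))) a) b)) v =
      O.toMod.act (Equiv.sumCongr (Equiv.sumCongr e' (Equiv.refl C)) (Equiv.refl (Fin 1)))
        (Equiv.sumCongr (Equiv.sumCongr f (Equiv.refl D)) (Equiv.refl (Fin 1)))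
        (O.barAct (O.toMod.act (Equiv.sumCongr (sumRot A (Fin 1) X₂) (Equiv.refl (Fin 1)))
          (Equiv.refl ((Y₁ ⊕ Y₂) ⊕ Fin 1)) (O.barMul a b)) v) := by
    conv_lhs => rw [hb, O.barMul_act, FBBMod.act_act]
    rw [← O.barAct_act, ← hv, FBBMod.act_act]
    congr 2
    apply FBBMod.act_congr
    · rintro (x | x)
      · exact congrArg Sum.inl (Equiv.congr_fun he x)
      · rfl
    · rintro ((x | x) | x) <;> rfl
  have h2 : O.barAct (O.toMod.act
          (Equiv.sumCongr ((Equiv.sumComm X₂ X₁).trans e) (Equiv.refl (Fin 1)))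
          (Equiv.sumCongr ((Equiv.sumComm Y₂ Y₁).trans f) (Equiv.refl (Fin 1)))
          (O.barMul b (O.toMod.act
            (Equiv.sumCongr p (Equiv.refl (Fin 1)))
            (Equiv.sumCongr (Equiv.refl Y₁) (Equiv.refl (Fin 1))) a))) v =
      O.toMod.act (Equiv.sumCongr (Equiv.sumCongr e' (Equiv.refl C)) (Equiv.refl (Fin 1)))
        (Equiv.sumCongr (Equiv.sumCongr f (Equiv.refl D)) (Equiv.refl (Fin 1)))
        (O.barAct (O.toMod.act
          (Equiv.sumCongr ((Equiv.sumComm X₂ (A ⊕ Fin 1)).trans (sumRot A (Fin 1) X₂))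
            (Equiv.refl (Fin 1)))
          (Equiv.sumCongr (Equiv.sumComm Y₂ Y₁) (Equiv.refl (Fin 1))) (O.barMul b a)) v) := by
    conv_lhs => rw [hb, O.barMul_act, FBBMod.act_act]
    rw [← O.barAct_act, ← hv, FBBMod.act_act]
    congr 2
    apply FBBMod.act_congr
    · rintro ((x | x) | x)
      · exact congrArg Sum.inl (Equiv.congr_fun he (Sum.inr x))
      · exact congrArg Sum.inl (Equiv.congr_fun he (Sum.inl x))
      · rfl
    · rintro ((x | x) | x) <;> rfl
  rw [h1, h2, O.barAct_barMul_left, O.barAct_barMul_right]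
  refine Submodule.subset_span ⟨A ⊕ C, X₂, Y₁ ⊕ D, Y₂, inferInstance, inferInstance, inferInstance,
    inferInstance, (sumRot A C X₂).trans (Equiv.sumCongr e' (Equiv.refl C)),
    (sumRot Y₁ D Y₂).trans (Equiv.sumCongr f (Equiv.refl D)), O.barAct a v, b, ?_⟩
  simp only [FBBMod.act_act, Equiv.sumCongr_trans, Equiv.trans_refl, Equiv.trans_assoc]

theorem Operad.commutators_le_ker {X Y C D : Type} [Finite X] [Finite Y] [Finite C] [Finite D] :
    O.commutators (X ⊕ Fin 1) Y ≤
      LinearMap.ker (O.barAct.compr₂ (O.proj (X := X ⊕ C) (Y := Y ⊕ D))) := by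
  conv_lhs => unfold commutators
  rw [Submodule.span_le]
  rintro z ⟨X₁, X₂, Y₁, Y₂, _, _, _, _, e, f, a, b, rfl⟩
  rw [SetLike.mem_coe, LinearMap.mem_ker]
  ext v
  rw [LinearMap.compr₂_apply, LinearMap.zero_apply]
  refine (Submodule.Quotient.mk_eq_zero (O.commutators (X ⊕ C) (Y ⊕ D))).mpr ?_
  rw [map_sub, LinearMap.sub_apply]
  rcases hx : e.symm (Sum.inr 0) with x | x
  · exact O.barAct_commutator_mem e f x (by rw [← hx, Equiv.apply_symm_apply]) a b v
  · have := O.barAct_commutator_mem ((Equiv.sumComm X₂ X₁).trans e)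
      ((Equiv.sumComm Y₂ Y₁).trans f) x
      (by
        change e (Sum.inr x) = _
        rw [← hx, Equiv.apply_symm_apply]) b a v
    have he : (Equiv.sumComm X₁ X₂).trans ((Equiv.sumComm X₂ X₁).trans e) = e := by
      ext x
      rcases x with x | x <;> rfl
    have hf : (Equiv.sumComm Y₁ Y₂).trans ((Equiv.sumComm Y₂ Y₁).trans f) = f := by
      ext x
      rcases x with x | x <;> rfl
    rw [he, hf] at this
    rw [← neg_mem_iff, neg_sub]
    exact this

/-- The action `α` of `O` on `|δ_{1,1} O|`, as a natural family of bilinear maps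
`δ_{1,0} |δ_{1,1} O| (X₁, Y₁) × δ_{0,1} O (X₂, Y₂) → |δ_{1,1} O| (X₁ ⨿ X₂, Y₁ ⨿ Y₂)`. It is
induced by `barAct`. -/
def Operad.wheelAct {X₁ Y₁ X₂ Y₂ : Type} [Finite X₁] [Finite Y₁] [Finite X₂] [Finite Y₂] :
    O.wheel.ev (X₁ ⊕ Fin 1) Y₁ →ₗ[k] O.toMod.ev X₂ (Y₂ ⊕ Fin 1) →ₗ[k]
      O.wheel.ev (X₁ ⊕ X₂) (Y₁ ⊕ Y₂) :=
  (O.commutators (X₁ ⊕ Fin 1) Y₁).liftQ (O.barAct.compr₂ O.proj) O.commutators_le_ker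

theorem Operad.wheelAct_proj {X₁ Y₁ X₂ Y₂ : Type} [Finite X₁] [Finite Y₁] [Finite X₂] [Finite Y₂]
    (a : O.toMod.ev ((X₁ ⊕ Fin 1) ⊕ Fin 1) (Y₁ ⊕ Fin 1)) (v : O.toMod.ev X₂ (Y₂ ⊕ Fin 1)) :
    O.wheelAct (O.proj a) v = O.proj (O.barAct a v) :=
  rfl

variable {O}
variable {P : Operad k}

theorem OperadHom.map_barMul (φ : OperadHom O P) {X₁ Y₁ X₂ Y₂ : Type} [Finite X₁] [Finite Y₁]
    [Finite X₂] [Finite Y₂]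
    (a : O.toMod.ev (X₁ ⊕ Fin 1) (Y₁ ⊕ Fin 1)) (b : O.toMod.ev (X₂ ⊕ Fin 1) (Y₂ ⊕ Fin 1)) :
    FBBMod.app φ.hom ((X₁ ⊕ X₂) ⊕ Fin 1) ((Y₁ ⊕ Y₂) ⊕ Fin 1) (O.barMul a b) =
      P.barMul (FBBMod.app φ.hom (X₁ ⊕ Fin 1) (Y₁ ⊕ Fin 1) a)
        (FBBMod.app φ.hom (X₂ ⊕ Fin 1) (Y₂ ⊕ Fin 1) b) := by
  unfold Operad.barMul
  rw [FBBMod.app_act, φ.map_comp]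

theorem OperadHom.map_commutators (φ : OperadHom O P) (X Y : Type) [Finite X] [Finite Y] :
    O.commutators X Y ≤ (P.commutators X Y).comap
      (FBBMod.app φ.hom (X ⊕ Fin 1) (Y ⊕ Fin 1)) := by
  conv_lhs => unfold Operad.commutators
  rw [Submodule.span_le]
  rintro z ⟨X₁, X₂, Y₁, Y₂, _, _, _, _, e, f, a, b, rfl⟩
  refine Submodule.subset_span ⟨X₁, X₂, Y₁, Y₂, inferInstance, inferInstance, inferInstance,
    inferInstance, e, f, FBBMod.app φ.hom _ _ a, FBBMod.app φ.hom _ _ b, ?_⟩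
  rw [map_sub, FBBMod.app_act, FBBMod.app_act, φ.map_barMul, φ.map_barMul]

/-- The morphism `|δ_{1,1} O| → |δ_{1,1} P|` induced by a morphism of operads `O → P`. -/
def OperadHom.wheelMap (φ : OperadHom O P) : O.wheel ⟶ P.wheel :=
  FBBMod.homMk
    (fun X Y _ _ => (O.commutators X Y).mapQ (P.commutators X Y)
      (FBBMod.app φ.hom (X ⊕ Fin 1) (Y ⊕ Fin 1)) (φ.map_commutators X Y))
    (by
      intro X X' Y Y' _ _ _ _ e f x
      obtain ⟨x, rfl⟩ := Submodule.Quotient.mk_surjective _ x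
      exact congrArg (P.commutators X' Y').mkQ (FBBMod.app_act φ.hom _ _ x))

/-- The `k(FB × FB)`-module `O ⊕ |δ_{1,1} O|`. -/
def Operad.wheeled (O : Operad k) : FBBMod k := O.toMod.sum O.wheel

/-- The morphism `O ⊕ |δ_{1,1} O| → P ⊕ |δ_{1,1} P|` induced by a morphism of operads `O → P`. -/
def OperadHom.wheeledMap (φ : OperadHom O P) : O.wheeled ⟶ P.wheeled :=
  FBBMod.sumMap φ.hom φ.wheelMap

/-- The projection `O ⊕ |δ_{1,1} O| → O`. -/
def Operad.wheeledProj (O : Operad k) : O.wheeled ⟶ O.toMod := FBBMod.fst O.toMod O.wheel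

end Operad

/-! ### The walled Brauer categories -/

/-- An object of the walled Brauer categories: a pair of finite sets. -/
structure Uwb where
  left : Type
  right : Type
  [finLeft : Finite left]
  [finRight : Finite right]

attribute [instance] Uwb.finLeft Uwb.finRight

/-- A morphism `(X, Y) → (U, V)` of degree `n` of the ordered upward walled Brauer category: a pair
of bijections `X ⨿ n ≃ U` and `Y ⨿ n ≃ V`. -/
structure Uwb.OrdHom (P Q : Uwb) where
  deg : ℕ
  left : P.left ⊕ Fin deg ≃ Q.left
  right : P.right ⊕ Fin deg ≃ Q.right

/-- Two ordered morphisms are identified if they differ by a permutation of the `n` pairs. -/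
instance Uwb.ordHomSetoid (P Q : Uwb) : Setoid (Uwb.OrdHom P Q) where
  r φ ψ := ∃ σ : Fin φ.deg ≃ Fin ψ.deg,
    φ.left = (Equiv.sumCongr (Equiv.refl P.left) σ).trans ψ.left ∧
      φ.right = (Equiv.sumCongr (Equiv.refl P.right) σ).trans ψ.right
  iseqv :=
    { refl := fun φ => ⟨Equiv.refl _, by simp, by simp⟩
      symm := by
        rintro φ ψ ⟨σ, h1, h2⟩
        refine ⟨σ.symm, ?_, ?_⟩
        · rw [h1]
          ext (x | x) <;> simp
        · rw [h2]
          ext (x | x) <;> simp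
      trans := by
        rintro φ ψ χ ⟨σ, h1, h2⟩ ⟨τ, h3, h4⟩
        refine ⟨σ.trans τ, ?_, ?_⟩
        · rw [h1, h3]
          ext (x | x) <;> simp
        · rw [h2, h4]
          ext (x | x) <;> simp }

/-- For bijections `f : X ⨿ n ≃ U` and `g : U ⨿ m ≃ W`, the bijection
`X ⨿ (n + m) ≃ (X ⨿ n) ⨿ m ≃ U ⨿ m ≃ W`. -/
def Uwb.glue {X U W : Type} {n m : ℕ} (f : X ⊕ Fin n ≃ U) (g : U ⊕ Fin m ≃ W) :
    X ⊕ Fin (n + m) ≃ W :=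
  (Equiv.sumCongr (Equiv.refl X) finSumFinEquiv.symm).trans
    ((Equiv.sumAssoc X (Fin n) (Fin m)).symm.trans
      ((Equiv.sumCongr f (Equiv.refl (Fin m))).trans g))

theorem Uwb.glue_inl {X U W : Type} {n m : ℕ} (f : X ⊕ Fin n ≃ U) (g : U ⊕ Fin m ≃ W) (x : X) :
    Uwb.glue f g (Sum.inl x) = g (Sum.inl (f (Sum.inl x))) :=
  rfl

theorem Uwb.glue_castAdd {X U W : Type} {n m : ℕ} (f : X ⊕ Fin n ≃ U) (g : U ⊕ Fin m ≃ W)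
    (i : Fin n) : Uwb.glue f g (Sum.inr (finSumFinEquiv (Sum.inl i))) =
      g (Sum.inl (f (Sum.inr i))) := by
  simp [glue]

theorem Uwb.glue_natAdd {X U W : Type} {n m : ℕ} (f : X ⊕ Fin n ≃ U) (g : U ⊕ Fin m ≃ W)
    (i : Fin m) : Uwb.glue f g (Sum.inr (finSumFinEquiv (Sum.inr i))) = g (Sum.inr i) := by
  simp [glue]

/-- The composition of the ordered upward walled Brauer category. -/
def Uwb.OrdHom.comp {P Q R : Uwb} (φ : Uwb.OrdHom P Q) (ψ : Uwb.OrdHom Q R) : Uwb.OrdHom P R where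
  deg := φ.deg + ψ.deg
  left := Uwb.glue φ.left ψ.left
  right := Uwb.glue φ.right ψ.right

theorem Uwb.glue_congr {X U W : Type} {n m n' m' : ℕ} (f : X ⊕ Fin n ≃ U) (g : U ⊕ Fin m ≃ W)
    (f' : X ⊕ Fin n' ≃ U) (g' : U ⊕ Fin m' ≃ W) (σ : Fin n ≃ Fin n') (τ : Fin m ≃ Fin m')
    (hf : f = (Equiv.sumCongr (Equiv.refl X) σ).trans f')
    (hg : g = (Equiv.sumCongr (Equiv.refl U) τ).trans g') :
    Uwb.glue f g = (Equiv.sumCongr (Equiv.refl X)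
      (finSumFinEquiv.symm.trans ((Equiv.sumCongr σ τ).trans finSumFinEquiv))).trans
        (Uwb.glue f' g') := by
  subst hf hg
  ext x
  rcases x with x | x
  · rfl
  · obtain ⟨x, rfl⟩ := finSumFinEquiv.surjective x
    rcases x with x | x
    · rw [glue_castAdd]
      simp only [Equiv.trans_apply, Equiv.sumCongr_apply, Sum.map_inr, Sum.map_inl,
        Equiv.symm_apply_apply, glue_castAdd, Equiv.refl_apply]
    · rw [glue_natAdd]
      simp only [Equiv.trans_apply, Equiv.sumCongr_apply, Sum.map_inr,
        Equiv.symm_apply_apply, glue_natAdd]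

theorem Uwb.glue_assoc {X U W Z : Type} {n m p : ℕ} (f : X ⊕ Fin n ≃ U) (g : U ⊕ Fin m ≃ W)
    (h : W ⊕ Fin p ≃ Z) :
    Uwb.glue (Uwb.glue f g) h = (Equiv.sumCongr (Equiv.refl X)
      (finCongr (Nat.add_assoc n m p))).trans (Uwb.glue f (Uwb.glue g h)) := by
  ext x
  rcases x with x | x
  · rfl
  · obtain ⟨x, rfl⟩ := finSumFinEquiv.surjective x
    rcases x with x | x
    · obtain ⟨x, rfl⟩ := finSumFinEquiv.surjective x
      rcases x with x | x
      · have : finCongr (Nat.add_assoc n m p)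
            (finSumFinEquiv (Sum.inl (finSumFinEquiv (Sum.inl x)))) =
            finSumFinEquiv (Sum.inl x) := by ext; simp
        simp only [Equiv.trans_apply, Equiv.sumCongr_apply, Sum.map_inr, glue_castAdd, this,
          glue_inl]
      · have : finCongr (Nat.add_assoc n m p)
            (finSumFinEquiv (Sum.inl (finSumFinEquiv (Sum.inr x)))) =
            finSumFinEquiv (Sum.inr (finSumFinEquiv (Sum.inl x))) := by ext; simp
        simp only [Equiv.trans_apply, Equiv.sumCongr_apply, Sum.map_inr, glue_castAdd,
          glue_natAdd, this]
    · have : finCongr (Nat.add_assoc n m p) (finSumFinEquiv (Sum.inr x)) =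
          finSumFinEquiv (Sum.inr (finSumFinEquiv (Sum.inr x))) := by
        ext; simp [Nat.add_assoc]
      simp only [Equiv.trans_apply, Equiv.sumCongr_apply, Sum.map_inr, glue_natAdd, this]

/-- The degree-zero ordered morphism given by a pair of bijections. -/
def Uwb.ordBij {P Q : Uwb} (e : P.left ≃ Q.left) (f : P.right ≃ Q.right) : Uwb.OrdHom P Q where
  deg := 0
  left := (Equiv.sumEmpty P.left (Fin 0)).trans e
  right := (Equiv.sumEmpty P.right (Fin 0)).trans f

theorem Uwb.id_glue {X U W : Type} {m : ℕ} (e : X ≃ U) (g : U ⊕ Fin m ≃ W) :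
    Uwb.glue ((Equiv.sumEmpty X (Fin 0)).trans e) g =
      (Equiv.sumCongr (Equiv.refl X) (finCongr (Nat.zero_add m))).trans
        ((Equiv.sumCongr e (Equiv.refl (Fin m))).trans g) := by
  ext x
  rcases x with x | x
  · rfl
  · obtain ⟨x, rfl⟩ := finSumFinEquiv.surjective x
    rcases x with x | x
    · exact x.elim0
    · have : finCongr (Nat.zero_add m) (finSumFinEquiv (Sum.inr x)) = x := by ext; simp
      simp only [glue_natAdd, Equiv.trans_apply, Equiv.sumCongr_apply, Sum.map_inr, this,
        Equiv.refl_apply]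

theorem Uwb.glue_id {X U W : Type} {n : ℕ} (f : X ⊕ Fin n ≃ U) (e : U ≃ W) :
    Uwb.glue f ((Equiv.sumEmpty U (Fin 0)).trans e) = f.trans e := by
  ext x
  rcases x with x | x
  · rfl
  · obtain ⟨x, rfl⟩ := (finSumFinEquiv (m := n) (n := 0)).surjective x
    rcases x with x | x
    · rw [glue_castAdd]
      have : (finSumFinEquiv (Sum.inl x) : Fin (n + 0)) = x := rfl
      rw [this]
      rfl
    · exact x.elim0

/-- The upward walled Brauer category. Its morphisms of degree `n` from `(X, Y)` to `(U, V)` are the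
pairs of bijections `X ⨿ n ≃ U`, `Y ⨿ n ≃ V`, up to the diagonal action of the symmetric group
`𝔖_n`. -/
instance : Category Uwb where
  Hom P Q := Quotient (Uwb.ordHomSetoid P Q)
  id P := Quotient.mk _ (Uwb.ordBij (Equiv.refl P.left) (Equiv.refl P.right))
  comp := Quotient.map₂ Uwb.OrdHom.comp (by
    rintro φ φ' ⟨σ, h1, h2⟩ ψ ψ' ⟨τ, h3, h4⟩
    exact ⟨finSumFinEquiv.symm.trans ((Equiv.sumCongr σ τ).trans finSumFinEquiv),
      Uwb.glue_congr _ _ _ _ σ τ h1 h3, Uwb.glue_congr _ _ _ _ σ τ h2 h4⟩)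
  id_comp := by
    rintro P Q ⟨φ⟩
    refine Quotient.sound ⟨finCongr (Nat.zero_add φ.deg), ?_, ?_⟩
    · refine (Uwb.id_glue (Equiv.refl P.left) φ.left).trans ?_
      rw [Equiv.sumCongr_refl, Equiv.refl_trans]
      rfl
    · refine (Uwb.id_glue (Equiv.refl P.right) φ.right).trans ?_
      rw [Equiv.sumCongr_refl, Equiv.refl_trans]
      rfl
  comp_id := by
    rintro P Q ⟨φ⟩
    refine Quotient.sound ⟨Equiv.refl _, ?_, ?_⟩
    · refine (Uwb.glue_id φ.left (Equiv.refl Q.left)).trans ?_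
      ext x; rcases x with x | x <;> rfl
    · refine (Uwb.glue_id φ.right (Equiv.refl Q.right)).trans ?_
      ext x; rcases x with x | x <;> rfl
  assoc := by
    rintro P Q R S ⟨φ⟩ ⟨ψ⟩ ⟨χ⟩
    exact Quotient.sound ⟨finCongr (Nat.add_assoc _ _ _), Uwb.glue_assoc _ _ _,
      Uwb.glue_assoc _ _ _⟩

/-- The morphism of degree zero of the upward walled Brauer category given by a pair of
bijections. -/
def Uwb.ofBij {X X' Y Y' : Type} [Finite X] [Finite X'] [Finite Y] [Finite Y']
    (e : X ≃ X') (f : Y ≃ Y') : (⟨X, Y⟩ : Uwb) ⟶ (⟨X', Y'⟩ : Uwb) :=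
  Quotient.mk _ (Uwb.ordBij (P := ⟨X, Y⟩) (Q := ⟨X', Y'⟩) e f)

/-- The canonical morphism `(X, Y) → (X ⨿ 1, Y ⨿ 1)` of degree one. -/
def Uwb.insertPair (X Y : Type) [Finite X] [Finite Y] :
    (⟨X, Y⟩ : Uwb) ⟶ (⟨X ⊕ Fin 1, Y ⊕ Fin 1⟩ : Uwb) :=
  Quotient.mk _ { deg := 1, left := Equiv.refl _, right := Equiv.refl _ }

/-- The downward walled Brauer category. -/
abbrev Dwb : Type 1 := Uwbᵒᵖ

theorem Uwb.ofBij_trans {X X' X'' Y Y' Y'' : Type} [Finite X] [Finite X'] [Finite X''] [Finite Y]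
    [Finite Y'] [Finite Y''] (e : X ≃ X') (f : Y ≃ Y') (e' : X' ≃ X'') (f' : Y' ≃ Y'') :
    Uwb.ofBij (e.trans e') (f.trans f') = Uwb.ofBij e f ≫ Uwb.ofBij e' f' := by
  symm
  apply Quotient.sound
  refine ⟨Equiv.refl _, ?_, ?_⟩
  · refine (Uwb.glue_id _ e').trans ?_
    ext x; rcases x with x | x <;> rfl
  · refine (Uwb.glue_id _ f').trans ?_
    ext x; rcases x with x | x <;> rfl

/-- The inclusion of `FB × FB` in the downward walled Brauer category, the identity on objects,
which sends a pair of bijections to the opposite of the pair of inverse bijections. -/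
def Dwb.incl : FB × FB ⥤ Dwb where
  obj P := Opposite.op ⟨P.1.carrier, P.2.carrier⟩
  map m := (Uwb.ofBij m.1.symm m.2.symm).op
  map_id _ := rfl
  map_comp m n := congrArg Quiver.Hom.op (Uwb.ofBij_trans n.1.symm n.2.symm m.1.symm m.2.symm)

section DwbStr

variable {k : Type u} [Field k]

/-- A `k dwb`-module structure on a `k(FB × FB)`-module `F`: a functor from the downward walled
Brauer category to `k`-vector spaces (see `DwbStr.toFunctor`) that has the same values as `F` and
restricts to `F` along the inclusion of `FB × FB` (see `DwbStr.restrictIso`). -/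
@[ext]
structure DwbStr (F : FBBMod k) where
  map : ∀ {P Q : Uwb}, (P ⟶ Q) → (F.ev Q.left Q.right →ₗ[k] F.ev P.left P.right)
  map_id : ∀ (P : Uwb), map (𝟙 P) = LinearMap.id
  map_comp : ∀ {P Q R : Uwb} (g : P ⟶ Q) (h : Q ⟶ R), map (g ≫ h) = map g ∘ₗ map h
  map_ofBij : ∀ {X X' Y Y' : Type} [Finite X] [Finite X'] [Finite Y] [Finite Y']
    (e : X ≃ X') (f : Y ≃ Y'), map (Uwb.ofBij e f) = F.act e.symm f.symm

/-- The `k dwb`-module given by a `k dwb`-module structure. -/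
def DwbStr.toFunctor {F : FBBMod k} (s : DwbStr F) : Dwb ⥤ ModuleCat.{u} k where
  obj P := ModuleCat.of k (F.ev P.unop.left P.unop.right)
  map m := ModuleCat.ofHom (s.map m.unop)
  map_id P := congrArg ModuleCat.ofHom (s.map_id P.unop)
  map_comp m n := congrArg ModuleCat.ofHom (s.map_comp n.unop m.unop)

/-- The underlying `k(FB × FB)`-module of the `k dwb`-module given by a structure on `F` is `F`. -/
def DwbStr.restrictIso {F : FBBMod k} (s : DwbStr F) : Dwb.incl ⋙ s.toFunctor ≅ F :=
  NatIso.ofComponents (fun _ => Iso.refl _) (by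
    intro P Q m
    ext x
    exact LinearMap.congr_fun (s.map_ofBij m.1.symm m.2.symm) x)

/-- The contraction `δ_{1,1} F (X, Y) → F(X, Y)`: the action of the opposite of the canonical
morphism `(X, Y) → (X ⨿ 1, Y ⨿ 1)`. -/
def DwbStr.contract {F : FBBMod k} (s : DwbStr F) (X Y : Type) [Finite X] [Finite Y] :
    F.ev (X ⊕ Fin 1) (Y ⊕ Fin 1) →ₗ[k] F.ev X Y :=
  s.map (Uwb.insertPair X Y)

/-- The morphism `φ : F → G` of `k(FB × FB)`-modules is a morphism of `k dwb`-modules. -/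
def IsDwbHom {F G : FBBMod k} (s : DwbStr F) (t : DwbStr G) (φ : F ⟶ G) : Prop :=
  ∀ {P Q : Uwb} (h : P ⟶ Q) (x : F.ev Q.left Q.right),
    FBBMod.app φ P.left P.right (s.map h x) = t.map h (FBBMod.app φ Q.left Q.right x)

/-- The bijection `A ⨿ ((B ⨿ 1) ⨿ C) ≃ ((A ⨿ B) ⨿ C) ⨿ 1`. -/
def sumPullOut (A B C : Type) : A ⊕ ((B ⊕ Fin 1) ⊕ C) ≃ ((A ⊕ B) ⊕ C) ⊕ Fin 1 :=
  (Equiv.sumAssoc A (B ⊕ Fin 1) C).symm.trans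
    ((Equiv.sumCongr (Equiv.sumAssoc A B (Fin 1)).symm (Equiv.refl C)).trans
      (sumRot (A ⊕ B) (Fin 1) C))

/-- The bijection `(A ⨿ 1) ⨿ (B ⨿ C) ≃ ((A ⨿ B) ⨿ C) ⨿ 1`. -/
def sumPullOut' (A B C : Type) : (A ⊕ Fin 1) ⊕ (B ⊕ C) ≃ ((A ⊕ B) ⊕ C) ⊕ Fin 1 :=
  (sumRot A (Fin 1) (B ⊕ C)).trans
    (Equiv.sumCongr (Equiv.sumAssoc A B C).symm (Equiv.refl (Fin 1)))

/-- The generator `u ∈ O(X₁, Y₁)` times `z` in `S*(O ⊕ |δ_{1,1} O|)`. -/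
noncomputable def Operad.mulCorolla (O : Operad k) {X₁ X₂ Y₁ Y₂ : Type} [Finite X₁] [Finite X₂]
    [Finite Y₁] [Finite Y₂] (u : O.toMod.ev X₁ Y₁) (z : O.wheeled.sym.ev X₂ Y₂) :
    O.wheeled.sym.ev (X₁ ⊕ X₂) (Y₁ ⊕ Y₂) :=
  O.wheeled.symCons (FBBMod.inl O.toMod O.wheel u) z

/-- The generator `w ∈ |δ_{1,1} O| (X₁, Y₁)` times `z` in `S*(O ⊕ |δ_{1,1} O|)`. -/
noncomputable def Operad.mulWheel (O : Operad k) {X₁ X₂ Y₁ Y₂ : Type} [Finite X₁] [Finite X₂]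
    [Finite Y₁] [Finite Y₂] (w : O.wheel.ev X₁ Y₁) (z : O.wheeled.sym.ev X₂ Y₂) :
    O.wheeled.sym.ev (X₁ ⊕ X₂) (Y₁ ⊕ Y₂) :=
  O.wheeled.symCons (FBBMod.inr O.toMod O.wheel w) z

/-- The contraction of a `k dwb`-module structure on `S*(O ⊕ |δ_{1,1} O|)` is given by contracting
edges by means of the structure maps of `O`, on each of the summands of
`δ_{1,1} S*(O ⊕ |δ_{1,1} O|)`. -/
structure IsEdgeContraction (O : Operad k) (s : DwbStr O.wheeled.sym) : Prop where
  /-- On `δ_{1,0} O ⊚ δ_{0,1} O ⊚ S*`, it is `u ⊗ v ⊗ z ↦ (u ∘ v) · z`. -/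
  comp : ∀ {X₁ X₂ X₃ Y₁ Y₂ Y₃ : Type} [Finite X₁] [Finite X₂] [Finite X₃] [Finite Y₁] [Finite Y₂]
    [Finite Y₃] (u : O.toMod.ev (X₁ ⊕ Fin 1) Y₁) (v : O.toMod.ev X₂ (Y₂ ⊕ Fin 1))
    (z : O.wheeled.sym.ev X₃ Y₃),
    s.contract ((X₁ ⊕ X₂) ⊕ X₃) ((Y₁ ⊕ Y₂) ⊕ Y₃)
        (O.wheeled.sym.act (sumPullOut' X₁ X₂ X₃) (sumPullOut Y₁ Y₂ Y₃)
          (O.mulCorolla u (O.mulCorolla v z))) =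
      O.mulCorolla (O.comp u v) z
  /-- On `δ_{1,0} |δ_{1,1} O| ⊚ δ_{0,1} O ⊚ S*`, it is `w ⊗ v ⊗ z ↦ α(w ⊗ v) · z`. -/
  wheelAct : ∀ {X₁ X₂ X₃ Y₁ Y₂ Y₃ : Type} [Finite X₁] [Finite X₂] [Finite X₃] [Finite Y₁]
    [Finite Y₂] [Finite Y₃] (w : O.wheel.ev (X₁ ⊕ Fin 1) Y₁) (v : O.toMod.ev X₂ (Y₂ ⊕ Fin 1))
    (z : O.wheeled.sym.ev X₃ Y₃),
    s.contract ((X₁ ⊕ X₂) ⊕ X₃) ((Y₁ ⊕ Y₂) ⊕ Y₃)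
        (O.wheeled.sym.act (sumPullOut' X₁ X₂ X₃) (sumPullOut Y₁ Y₂ Y₃)
          (O.mulWheel w (O.mulCorolla v z))) =
      O.mulWheel (O.wheelAct w v) z
  /-- On `δ_{1,1} O ⊚ S*`, it is `a ⊗ z ↦ π(a) · z`. -/
  proj : ∀ {X₁ X₂ Y₁ Y₂ : Type} [Finite X₁] [Finite X₂] [Finite Y₁] [Finite Y₂]
    (a : O.toMod.ev (X₁ ⊕ Fin 1) (Y₁ ⊕ Fin 1)) (z : O.wheeled.sym.ev X₂ Y₂),
    s.contract (X₁ ⊕ X₂) (Y₁ ⊕ Y₂)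
        (O.wheeled.sym.act (sumRot X₁ (Fin 1) X₂) (sumRot Y₁ (Fin 1) Y₂) (O.mulCorolla a z)) =
      O.mulWheel (O.proj a) z

end DwbStr

/-! ### Walled Brauer modules from contractions -/

/-! A morphism of degree `n` in `uwb` inserts `n` pairs one after the other and then applies
bijections. Hence a `dwb`-module structure on `F` is determined by its contraction `δ_{1,1} F → F`
(`DwbStr.map_mk`). Conversely, a natural contraction extends to such a structure as soon as two
successive contractions commute. The only ambiguity in a morphism is the order of the inserted
pairs, and adjacent transpositions generate the symmetric group (`Contraction.IsComm.iter_perm`).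

On a symmetric algebra `S*M`, an edge to be contracted either joins two factors or is a loop at one
factor. A contraction compatible with products is therefore given by a pairing and a trace on `M`.
These data, with the identities they must satisfy, form `EdgeStr`. To descend to coinvariants, the
result of a contraction is first described as a relation `IsContraction`, with no ordering of the
factors. Two splittings of isomorphic families are isomorphic, so naturality of pairing and trace
makes the result unique (`IsContraction.unique`). It can also be chosen multilinearly in the entries
(`exists_isContraction`).

Commutation is a check over the graphs formed by two edges. Edges with no common factor commute
because contraction is linear over the factors it does not touch (`contract_symCons`). Otherwise the
graph is a chain (associativity), two edges entering different inputs of one factor (parallel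
composition), a cycle through two factors (symmetry of the trace), or a loop together with an edge
at the same factor (compatibility of trace and pairing). Any other graph has a factor with two
outputs, and such a factor is zero.

For `O ⊕ |δ_{1,1} O|` the trace is `π` and the pairing is made of `μ̃` and `α`. Symmetry of the
trace on cycles is exactly what the commutator quotient enforces, and the other identities follow
from the operad axioms. A wheel has no output, so every marked product is covered by one of the
three prescribed formulas. This gives uniqueness. For `O` alone the same pairing is used with trace
zero. The projection that kills wheels respects both structures and is surjective, so the structure
on the target is forced. -/

/-- The bijection `X ⨿ (n + 1) ≃ (X ⨿ n) ⨿ 1` that singles out the last element. -/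
def sumFinSucc (X : Type) (n : ℕ) : X ⊕ Fin (n + 1) ≃ (X ⊕ Fin n) ⊕ Fin 1 :=
  (Equiv.sumCongr (Equiv.refl X) finSumFinEquiv.symm).trans
    (Equiv.sumAssoc X (Fin n) (Fin 1)).symm

theorem sumFinSucc_castSucc (X : Type) (n : ℕ) (i : Fin n) :
    sumFinSucc X n (Sum.inr i.castSucc) = Sum.inl (Sum.inr i) := by
  have : (finSumFinEquiv (m := n) (n := 1)).symm i.castSucc = Sum.inl i := by
    rw [Equiv.symm_apply_eq]; rfl
  simp [sumFinSucc, this]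

theorem sumFinSucc_last (X : Type) (n : ℕ) :
    sumFinSucc X n (Sum.inr (Fin.last n)) = Sum.inr 0 := by
  have : (finSumFinEquiv (m := n) (n := 1)).symm (Fin.last n) = Sum.inr 0 := by
    rw [Equiv.symm_apply_eq]; rfl
  simp [sumFinSucc, this]

theorem forall_sum_fin_succ {X : Type} {n : ℕ} {p : X ⊕ Fin (n + 1) → Prop}
    (h1 : ∀ x, p (Sum.inl x)) (h2 : ∀ i : Fin n, p (Sum.inr i.castSucc))
    (h3 : p (Sum.inr (Fin.last n))) : ∀ x, p x := by
  rintro (x | i)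
  · exact h1 x
  · induction i using Fin.lastCases with
    | last => exact h3
    | cast i => exact h2 i

/-- The bijection `X ⨿ (n + m) ≃ (X ⨿ n) ⨿ m`. -/
def sumFinAdd (X : Type) (n m : ℕ) : X ⊕ Fin (n + m) ≃ (X ⊕ Fin n) ⊕ Fin m :=
  Uwb.glue (Equiv.refl (X ⊕ Fin n)) (Equiv.refl _)

theorem Uwb.glue_eq_trans {X U W : Type} {n m : ℕ} (f : X ⊕ Fin n ≃ U) (g : U ⊕ Fin m ≃ W) :
    Uwb.glue f g =
      (sumFinAdd X n m).trans ((Equiv.sumCongr f (Equiv.refl (Fin m))).trans g) := by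
  ext x
  rcases x with x | x
  · rfl
  · obtain ⟨x, rfl⟩ := finSumFinEquiv.surjective x
    rcases x with x | x
    · rw [Uwb.glue_castAdd, Equiv.trans_apply, sumFinAdd, Uwb.glue_castAdd]
      rfl
    · rw [Uwb.glue_natAdd, Equiv.trans_apply, sumFinAdd, Uwb.glue_natAdd]
      rfl

/-- This is the inductive factorisation of a morphism of degree `n + 1`: a standard insertion of `n`
pairs, the insertion of one more pair, then a bijection. It holds for the representing bijections
themselves, with no permutation of the pairs. -/
theorem Uwb.glue_refl_sumFinSucc {X W : Type} (n : ℕ) (l : X ⊕ Fin (n + 1) ≃ W) :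
    Uwb.glue (Equiv.refl (X ⊕ Fin n)) (Uwb.glue (Equiv.refl ((X ⊕ Fin n) ⊕ Fin 1))
      ((Equiv.sumEmpty ((X ⊕ Fin n) ⊕ Fin 1) (Fin 0)).trans ((sumFinSucc X n).symm.trans l))) =
        l := by
  rw [Uwb.glue_id]
  refine Equiv.ext (forall_sum_fin_succ (fun x => ?_) (fun i => ?_) ?_)
  · exact congrArg l ((sumFinSucc X n).symm_apply_eq.mpr rfl)
  · refine (Uwb.glue_castAdd (m := 1) _ _ i).trans (congrArg l ?_)
    exact (sumFinSucc X n).symm_apply_eq.mpr (sumFinSucc_castSucc X n i).symm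
  · refine (Uwb.glue_natAdd (n := n) (m := 1) _ _ 0).trans (congrArg l ?_)
    exact (sumFinSucc X n).symm_apply_eq.mpr (sumFinSucc_last X n).symm

/-- Splitting off the last point commutes with splitting off a block that contains it. This is the
inductive step of `Contraction.iter_add`. -/
theorem sumFinAdd_succ (X : Type) (n m : ℕ) (x : X ⊕ Fin (n + (m + 1))) :
    Equiv.sumCongr (sumFinAdd X n m) (Equiv.refl (Fin 1)) (sumFinSucc X (n + m) x) =
      sumFinSucc (X ⊕ Fin n) m (sumFinAdd X n (m + 1) x) := by
  refine forall_sum_fin_succ (n := n + m) (p := fun x =>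
    Equiv.sumCongr (sumFinAdd X n m) (Equiv.refl (Fin 1)) (sumFinSucc X (n + m) x) =
      sumFinSucc (X ⊕ Fin n) m (sumFinAdd X n (m + 1) x)) ?_ ?_ ?_ x
  · intro x; rfl
  · intro i
    rw [sumFinSucc_castSucc]
    obtain ⟨i, rfl⟩ := finSumFinEquiv.surjective i
    rcases i with i | i
    · have h1 : (finSumFinEquiv (Sum.inl i) : Fin (n + m)).castSucc =
        (finSumFinEquiv (Sum.inl i) : Fin (n + (m + 1))) := rfl
      rw [h1]
      simp [sumFinAdd, Uwb.glue, sumFinSucc]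
    · have h1 : (finSumFinEquiv (Sum.inr i) : Fin (n + m)).castSucc =
        (finSumFinEquiv (Sum.inr i.castSucc) : Fin (n + (m + 1))) := rfl
      rw [h1]
      unfold sumFinAdd
      rw [Uwb.glue_natAdd, Equiv.refl_apply, sumFinSucc_castSucc, Equiv.sumCongr_apply,
        Sum.map_inl, Uwb.glue_natAdd]
      rfl
  · rw [sumFinSucc_last]
    have h1 : (Fin.last (n + m)) =
      (finSumFinEquiv (Sum.inr (Fin.last m)) : Fin (n + (m + 1))) := rfl
    rw [h1]
    unfold sumFinAdd
    rw [Uwb.glue_natAdd, Equiv.refl_apply, sumFinSucc_last]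
    rfl

theorem sumFinSucc_congr {X X' : Type} {n : ℕ} (e : X ≃ X') {σ : Equiv.Perm (Fin n)}
    {τ : Equiv.Perm (Fin (n + 1))} (h : ∀ i, τ i.castSucc = (σ i).castSucc)
    (h' : τ (Fin.last n) = Fin.last n) (x : X ⊕ Fin (n + 1)) :
    sumFinSucc X' n (Equiv.sumCongr e τ x) =
      Equiv.sumCongr (Equiv.sumCongr e σ) (Equiv.refl (Fin 1)) (sumFinSucc X n x) := by
  revert x
  refine forall_sum_fin_succ (fun x => rfl) (fun i => ?_) ?_
  · rw [Equiv.sumCongr_apply, Sum.map_inr, h, sumFinSucc_castSucc, sumFinSucc_castSucc]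
    rfl
  · rw [Equiv.sumCongr_apply, Sum.map_inr, h', sumFinSucc_last, sumFinSucc_last]
    rfl

/-- Once the last two points have been singled out, their transposition is the rotation `sumRot`
that appears in `Contraction.IsComm`. -/
theorem sumFinSucc_swap (X : Type) (n : ℕ) (x : X ⊕ Fin (n + 1 + 1)) :
    Equiv.sumCongr (sumFinSucc X n) (Equiv.refl (Fin 1)) (sumFinSucc X (n + 1)
      (Equiv.sumCongr (Equiv.refl X) (Equiv.swap (Fin.last n).castSucc (Fin.last n).succ) x)) =
    sumRot (X ⊕ Fin n) (Fin 1) (Fin 1) (Equiv.sumCongr (sumFinSucc X n) (Equiv.refl (Fin 1))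
      (sumFinSucc X (n + 1) x)) := by
  have h1 : Equiv.swap (Fin.last n).castSucc (Fin.last n).succ (Fin.last n).castSucc =
    Fin.last (n + 1) := Equiv.swap_apply_left _ _
  have h2 : Equiv.swap (Fin.last n).castSucc (Fin.last n).succ (Fin.last (n + 1)) =
    (Fin.last n).castSucc := Equiv.swap_apply_right _ _
  have h3 : ∀ i : Fin n, Equiv.swap (Fin.last n).castSucc (Fin.last n).succ
      i.castSucc.castSucc = i.castSucc.castSucc := fun i => by
    refine Equiv.swap_apply_of_ne_of_ne ?_ ?_ <;>
    · intro h
      have := congrArg Fin.val h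
      simp at this
      omega
  revert x
  refine forall_sum_fin_succ (fun x => rfl) (fun i => ?_) ?_
  · induction i using Fin.lastCases with
    | last =>
      rw [Equiv.sumCongr_apply (Equiv.refl X), Sum.map_inr, h1, sumFinSucc_last,
        sumFinSucc_castSucc, Equiv.sumCongr_apply, Equiv.sumCongr_apply, Sum.map_inl,
        sumFinSucc_last]
      rfl
    | cast i =>
      rw [Equiv.sumCongr_apply (Equiv.refl X), Sum.map_inr, h3,
        sumFinSucc_castSucc, Equiv.sumCongr_apply, Sum.map_inl, sumFinSucc_castSucc]
      rfl
  · rw [Equiv.sumCongr_apply (Equiv.refl X), Sum.map_inr, h2, sumFinSucc_last,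
        sumFinSucc_castSucc, Equiv.sumCongr_apply, Sum.map_inl, sumFinSucc_last]
    rfl

theorem Uwb.sumFinAdd_glue_symm {X U W : Type} {n m : ℕ} (f : X ⊕ Fin n ≃ U) (g : U ⊕ Fin m ≃ W)
    (x : W) : sumFinAdd X n m ((Uwb.glue f g).symm x) =
      Equiv.sumCongr f.symm (Equiv.refl (Fin m)) (g.symm x) := by
  rw [Uwb.glue_eq_trans]
  exact (sumFinAdd X n m).apply_symm_apply _

section

variable {k : Type u} [Field k]

/-- A natural family of maps `δ_{1,1} F → F`. -/
structure Contraction (F : FBBMod k) where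
  c : ∀ (X Y : Type) [Finite X] [Finite Y], F.ev (X ⊕ Fin 1) (Y ⊕ Fin 1) →ₗ[k] F.ev X Y
  act : ∀ {X Y X' Y' : Type} [Finite X] [Finite Y] [Finite X'] [Finite Y'] (e : X ≃ X')
    (f : Y ≃ Y') (z : F.ev (X ⊕ Fin 1) (Y ⊕ Fin 1)),
    c X' Y' (F.act (Equiv.sumCongr e (Equiv.refl (Fin 1))) (Equiv.sumCongr f (Equiv.refl (Fin 1))) z)
      = F.act e f (c X Y z)

/-- The result of contracting two pairs of elements does not depend on the order. -/
def Contraction.IsComm {F : FBBMod k} (c : Contraction F) : Prop :=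
  ∀ (X Y : Type) [Finite X] [Finite Y]
    (z : F.ev ((X ⊕ Fin 1) ⊕ Fin 1) ((Y ⊕ Fin 1) ⊕ Fin 1)),
    c.c X Y (c.c _ _ (F.act (sumRot X (Fin 1) (Fin 1)) (sumRot Y (Fin 1) (Fin 1)) z)) =
      c.c X Y (c.c _ _ z)

/-- The `n`-fold iteration of a family of contractions. -/
def FBBMod.iterContract (F : FBBMod k)
    (c : ∀ (X Y : Type) [Finite X] [Finite Y], F.ev (X ⊕ Fin 1) (Y ⊕ Fin 1) →ₗ[k] F.ev X Y) :
    ∀ (n : ℕ) (X Y : Type) [Finite X] [Finite Y], F.ev (X ⊕ Fin n) (Y ⊕ Fin n) →ₗ[k] F.ev X Y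
  | 0, X, Y, _, _ => F.act (Equiv.sumEmpty X (Fin 0)) (Equiv.sumEmpty Y (Fin 0))
  | n + 1, X, Y, _, _ => F.iterContract c n X Y ∘ₗ c (X ⊕ Fin n) (Y ⊕ Fin n) ∘ₗ
      F.act (sumFinSucc X n) (sumFinSucc Y n)

theorem FBBMod.iterContract_succ (F : FBBMod k)
    (c : ∀ (X Y : Type) [Finite X] [Finite Y], F.ev (X ⊕ Fin 1) (Y ⊕ Fin 1) →ₗ[k] F.ev X Y)
    (n : ℕ) (X Y : Type) [Finite X] [Finite Y] (z : F.ev (X ⊕ Fin (n + 1)) (Y ⊕ Fin (n + 1))) :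
    F.iterContract c (n + 1) X Y z =
      F.iterContract c n X Y (c _ _ (F.act (sumFinSucc X n) (sumFinSucc Y n) z)) := rfl

/-- Bijections and one-pair insertions generate `uwb`, so the whole structure can be read off from
its contraction and the action of bijections. -/
theorem DwbStr.map_mk {F : FBBMod k} (s : DwbStr F) {P Q : Uwb} (n : ℕ)
    (l : P.left ⊕ Fin n ≃ Q.left) (r : P.right ⊕ Fin n ≃ Q.right) (z : F.ev Q.left Q.right) :
    s.map (Quotient.mk _ ⟨n, l, r⟩ : P ⟶ Q) z =
      F.iterContract @s.contract n P.left P.right (F.act l.symm r.symm z) := by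
  induction n generalizing Q with
  | zero =>
    have h : (Quotient.mk _ ⟨0, l, r⟩ : P ⟶ Q) =
        Uwb.ofBij ((Equiv.sumEmpty P.left (Fin 0)).symm.trans l)
          ((Equiv.sumEmpty P.right (Fin 0)).symm.trans r) := by
      refine Quotient.sound ⟨Equiv.refl _, ?_, ?_⟩ <;>
      · ext (x | x)
        · rfl
        · exact x.elim0
    rw [h]
    erw [s.map_ofBij]
    unfold FBBMod.iterContract
    rw [FBBMod.act_act]
    rfl
  | succ n ih =>
    let R : Uwb := ⟨P.left ⊕ Fin n, P.right ⊕ Fin n⟩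
    have h : (Quotient.mk _ ⟨n + 1, l, r⟩ : P ⟶ Q) =
        (Quotient.mk _ ⟨n, Equiv.refl _, Equiv.refl _⟩ : P ⟶ R) ≫
          Uwb.insertPair R.left R.right ≫
          Uwb.ofBij ((sumFinSucc P.left n).symm.trans l) ((sumFinSucc P.right n).symm.trans r) := by
      -- The composite has degree `n + (1 + 0)`, which is definitionally `n + 1`, so the two
      -- representatives can be compared directly.
      refine congrArg (Quotient.mk _) ?_
      exact congrArg₂ (fun l r => (⟨n + 1, l, r⟩ : Uwb.OrdHom P Q))
        (Uwb.glue_refl_sumFinSucc n l).symm (Uwb.glue_refl_sumFinSucc n r).symm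
    rw [h, s.map_comp, s.map_comp, LinearMap.comp_apply, LinearMap.comp_apply]
    erw [s.map_ofBij, ih]
    rw [FBBMod.iterContract_succ, FBBMod.act_act]
    erw [F.act_refl]
    rfl

variable {F : FBBMod k}

theorem Contraction.iter_act (c : Contraction F) (n : ℕ) {X Y X' Y' : Type} [Finite X] [Finite Y]
    [Finite X'] [Finite Y'] (e : X ≃ X') (f : Y ≃ Y') (z : F.ev (X ⊕ Fin n) (Y ⊕ Fin n)) :
    F.iterContract c.c n X' Y' (F.act (Equiv.sumCongr e (Equiv.refl (Fin n)))
      (Equiv.sumCongr f (Equiv.refl (Fin n))) z) = F.act e f (F.iterContract c.c n X Y z) := by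
  induction n with
  | zero =>
    unfold FBBMod.iterContract
    rw [FBBMod.act_act, FBBMod.act_act]
    apply F.act_congr <;>
    · rintro (x | x)
      · rfl
      · exact x.elim0
  | succ n ih =>
    rw [FBBMod.iterContract_succ, FBBMod.iterContract_succ, ← ih, ← c.act]
    congr 2
    rw [FBBMod.act_act, FBBMod.act_act]
    apply F.act_congr <;>
    exact sumFinSucc_congr (σ := Equiv.refl _) (τ := Equiv.refl _) _ (fun _ => rfl) rfl

/-- This is functoriality at the level of iterated contractions: the last `m` pairs come from the
second morphism of a composite in `uwb` and are contracted first. -/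
theorem Contraction.iter_add (c : Contraction F) (n m : ℕ) {X Y : Type} [Finite X] [Finite Y]
    (z : F.ev (X ⊕ Fin (n + m)) (Y ⊕ Fin (n + m))) :
    F.iterContract c.c (n + m) X Y z = F.iterContract c.c n X Y
      (F.iterContract c.c m _ _ (F.act (sumFinAdd X n m) (sumFinAdd Y n m) z)) := by
  induction m with
  | zero =>
    refine congrArg (F.iterContract c.c n X Y) (Eq.trans ?_ (F.act_act _ _ _ _ z).symm)
    refine (F.act_refl z).symm.trans (F.act_congr ?_ ?_ z) <;>
    · intro x
      exact (Equiv.congr_fun (Uwb.glue_id (Equiv.refl _) (Equiv.refl _)) x).symm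
  | succ m ih =>
    refine (FBBMod.iterContract_succ F c.c (n + m) X Y z).trans ?_
    rw [ih, FBBMod.iterContract_succ, ← c.act, FBBMod.act_act, FBBMod.act_act]
    congr 3
    apply F.act_congr <;> intro x <;> exact sumFinAdd_succ _ n m x

/-- Adjacent transpositions suffice. The one that moves the last point exchanges the first two
contractions to be performed, which is the commutativity hypothesis. All others fix the last point
and are handled by induction after the first contraction. -/
theorem Contraction.IsComm.iter_perm {c : Contraction F} (hc : c.IsComm) {n : ℕ}
    (σ : Equiv.Perm (Fin n)) {X Y : Type} [Finite X] [Finite Y]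
    (z : F.ev (X ⊕ Fin n) (Y ⊕ Fin n)) :
    F.iterContract c.c n X Y (F.act (Equiv.sumCongr (Equiv.refl X) σ)
      (Equiv.sumCongr (Equiv.refl Y) σ) z) = F.iterContract c.c n X Y z := by
  induction n with
  | zero =>
    rw [Subsingleton.elim σ (Equiv.refl _), Equiv.sumCongr_refl, Equiv.sumCongr_refl, F.act_refl]
  | succ n ih =>
    -- Adjacent transpositions generate the permutations as a monoid, so no case for inverses is
    -- needed.
    have hσ := Equiv.Perm.mclosure_swap_castSucc_succ n ▸ Submonoid.mem_top σ
    induction hσ using Submonoid.closure_induction generalizing z with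
    | one =>
      rw [show (1 : Equiv.Perm (Fin (n + 1))) = Equiv.refl _ from rfl, Equiv.sumCongr_refl,
        Equiv.sumCongr_refl, F.act_refl]
    | mul σ τ _ _ h1 h2 =>
      refine Eq.trans ?_ ((h1 _).trans (h2 z))
      rw [F.act_act]
      congr 1
      apply F.act_congr <;> intro x <;> rcases x with x | x <;> rfl
    | mem σ h =>
      obtain ⟨i, rfl⟩ := h
      rcases n with _ | n
      · exact i.elim0
      induction i using Fin.lastCases with
      | last =>
        rw [F.iterContract_succ c.c (n + 1) X Y z, F.iterContract_succ c.c (n + 1) X Y,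
          F.iterContract_succ c.c n, F.iterContract_succ c.c n, ← c.act, ← c.act,
          ← hc _ _ (F.act _ _ (F.act (sumFinSucc X (n + 1)) (sumFinSucc Y (n + 1)) z))]
        congr 3
        simp only [F.act_act]
        apply F.act_congr <;> exact fun x => sumFinSucc_swap _ n x
      | cast i =>
        rw [F.iterContract_succ c.c (n + 1) X Y z, F.iterContract_succ c.c (n + 1) X Y,
          -- The last point is fixed, so the transposition passes through the first contraction by
          -- naturality and acts on the remaining points.
          ← ih (Equiv.swap i.castSucc i.succ) (c.c _ _ (F.act _ _ z)), ← c.act]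
        congr 2
        simp only [F.act_act]
        have h1 : ∀ j : Fin (n + 1), Equiv.swap i.castSucc.castSucc i.castSucc.succ j.castSucc =
            (Equiv.swap i.castSucc i.succ j).castSucc := fun j => by
          rw [Fin.succ_castSucc]
          exact ((Fin.castSucc_injective _).swap_apply _ _ _).symm ▸ rfl
        have h2 : Equiv.swap i.castSucc.castSucc i.castSucc.succ (Fin.last (n + 1)) =
            Fin.last (n + 1) :=
          Equiv.swap_apply_of_ne_of_ne (Fin.castSucc_lt_last _).ne'
            (by rw [Fin.succ_castSucc]; exact (Fin.castSucc_lt_last _).ne')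
        apply F.act_congr <;> exact sumFinSucc_congr _ h1 h2

/-- The `k dwb`-module structure given by a commutative contraction. -/
noncomputable def Contraction.IsComm.dwbStr {c : Contraction F} (hc : c.IsComm) : DwbStr F where
  map {P Q} := Quotient.lift (fun φ : Uwb.OrdHom P Q => F.iterContract c.c φ.deg P.left P.right ∘ₗ
      F.act φ.left.symm φ.right.symm) (by
    rintro ⟨n, l, r⟩ ⟨m, l', r'⟩ ⟨σ, h1, h2⟩
    -- Equivalent representatives have the same degree and differ by a permutation of the pairs,
    -- which `iter_perm` absorbs.
    obtain rfl : n = m := by simpa using Fintype.card_congr σ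
    dsimp only at σ h1 h2 ⊢
    ext z
    rw [LinearMap.comp_apply, LinearMap.comp_apply, ← hc.iter_perm σ, F.act_act]
    congr 1
    subst h1 h2
    apply F.act_congr <;> exact fun x => Equiv.apply_symm_apply (Equiv.sumCongr _ σ) _)
  map_id P := by
    ext z
    exact (F.act_act _ _ _ _ z).trans (F.act_refl z)
  map_comp := by
    rintro P Q R ⟨n, l, r⟩ ⟨m, l', r'⟩
    ext z
    change F.iterContract c.c (n + m) P.left P.right
      (F.act (Uwb.glue l l').symm (Uwb.glue r r').symm z) =
      F.iterContract c.c n P.left P.right (F.act l.symm r.symm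
        (F.iterContract c.c m Q.left Q.right (F.act l'.symm r'.symm z)))
    rw [c.iter_add, ← c.iter_act, F.act_act, F.act_act]
    congr 2
    apply F.act_congr <;> exact Uwb.sumFinAdd_glue_symm _ _
  map_ofBij e f := by
    ext z
    refine (F.act_act _ _ _ _ z).trans ?_
    rfl

theorem Contraction.IsComm.dwbStr_contract {c : Contraction F} (hc : c.IsComm) (X Y : Type)
    [Finite X] [Finite Y] : hc.dwbStr.contract X Y = c.c X Y := by
  ext z
  change F.iterContract c.c 1 X Y (F.act _ _ z) = _
  rw [F.iterContract_succ]
  unfold FBBMod.iterContract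
  rw [← c.act, F.act_act, F.act_act]
  congr 1
  refine Eq.trans (F.act_congr ?_ ?_ z) (F.act_refl z) <;>
  · rintro (x | x)
    · rfl
    · rw [Subsingleton.elim x 0]; rfl

theorem DwbStr.ext_contract {s t : DwbStr F}
    (h : ∀ (X Y : Type) [Finite X] [Finite Y], s.contract X Y = t.contract X Y) : s = t := by
  refine DwbStr.ext ?_
  funext P Q φ
  obtain ⟨n, l, r⟩ := φ
  ext z
  have h1 := s.map_mk n l r z
  have h2 := t.map_mk n l r z
  have h3 : @DwbStr.contract k _ F s = @DwbStr.contract k _ F t := by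
    funext X Y _ _
    exact h X Y
  rw [h3] at h1
  exact h1.trans h2.symm

/-- By `DwbStr.map_mk` every operator of either structure is an iterated contraction preceded by a
relabelling, and a morphism of `k(FB × FB)`-modules already respects relabellings. -/
theorem isDwbHom_of_contract {F G : FBBMod k} {s : DwbStr F} {t : DwbStr G} {φ : F ⟶ G}
    (h : ∀ (X Y : Type) [Finite X] [Finite Y] (z : F.ev (X ⊕ Fin 1) (Y ⊕ Fin 1)),
      FBBMod.app φ X Y (s.contract X Y z) = t.contract X Y (FBBMod.app φ _ _ z)) :
    IsDwbHom s t φ := by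
  have key : ∀ (n : ℕ) (X Y : Type) [Finite X] [Finite Y] (z : F.ev (X ⊕ Fin n) (Y ⊕ Fin n)),
      FBBMod.app φ X Y (F.iterContract @s.contract n X Y z) =
        G.iterContract @t.contract n X Y (FBBMod.app φ _ _ z) := by
    intro n
    induction n with
    | zero => intro X Y _ _ z; exact FBBMod.app_act φ _ _ z
    | succ n ih =>
      intro X Y _ _ z
      rw [F.iterContract_succ, G.iterContract_succ, ih, h, FBBMod.app_act]
  rintro P Q ⟨n, l, r⟩ z
  refine (congrArg _ (s.map_mk n l r z)).trans (Eq.trans ?_ (t.map_mk n l r _).symm)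
  rw [key, FBBMod.app_act]

end

/-! ### Symmetric algebras with arbitrary finite index sets -/

/-- The bijection between the sources of two injective maps with the same image. -/
noncomputable def overEquiv {A B T : Type} (p : A → T) (q : B → T) (hp : Function.Injective p)
    (hq : Function.Injective q) (h : ∀ a, ∃ b, q b = p a) (h' : ∀ b, ∃ a, p a = q b) : A ≃ B :=
  Equiv.ofBijective (fun a => Classical.choose (h a))
    ⟨fun a a' haa => hp (by
        rw [← Classical.choose_spec (h a), ← Classical.choose_spec (h a')]
        exact congrArg q haa),
      fun b => by
        obtain ⟨a, ha⟩ := h' b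
        exact ⟨a, hq ((Classical.choose_spec (h a)).trans ha)⟩⟩

theorem overEquiv_spec {A B T : Type} {p : A → T} {q : B → T} (hp : Function.Injective p)
    (hq : Function.Injective q) (h : ∀ a, ∃ b, q b = p a) (h' : ∀ b, ∃ a, p a = q b) (a : A) :
    q (overEquiv p q hp hq h h' a) = p a :=
  Classical.choose_spec (h a)

/-- The head of a splitting is exactly the fibre over `i`: points of the other summand carry labels
in the image of `ε`, which avoids `i`. -/
theorem exists_fib_inl {X A P I K : Type} {f : X → I} {f' : P → K} {ε : K → I} {e : A ⊕ P ≃ X}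
    {i : I} (h0 : ∀ x, f (e (Sum.inl x)) = i) (h1 : ∀ x, f (e (Sum.inr x)) = ε (f' x))
    (hne : ∀ l, ε l ≠ i) : ∃ w : A ≃ Fib f i, ∀ x, (w x).1 = e (Sum.inl x) :=
  ⟨overEquiv (fun x => e (Sum.inl x)) Subtype.val
    (e.injective.comp Sum.inl_injective) Subtype.val_injective
    (fun x => ⟨⟨_, h0 x⟩, rfl⟩) (fun x => by
      obtain ⟨x' | y, hx⟩ := e.surjective x.1
      · exact ⟨x', hx⟩
      · exact absurd ((h1 y).symm.trans ((congrArg f hx).trans x.2)) (hne _)),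
    overEquiv_spec _ _ _ _⟩

theorem exists_fib_inr {X A P I K : Type} {f : X → I} {f' : P → K} {ε : K → I} {e : A ⊕ P ≃ X}
    {i : I} (h0 : ∀ x, f (e (Sum.inl x)) = i) (h1 : ∀ x, f (e (Sum.inr x)) = ε (f' x))
    (hne : ∀ l, ε l ≠ i) (hinj : Function.Injective ε) (l : K) :
    ∃ w : Fib f' l ≃ Fib f (ε l), ∀ x, (w x).1 = e (Sum.inr x.1) :=
  ⟨overEquiv (fun x => e (Sum.inr x.1)) Subtype.val
    (e.injective.comp (Sum.inr_injective.comp Subtype.val_injective)) Subtype.val_injective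
    (fun x => ⟨⟨_, (h1 x.1).trans (congrArg ε x.2)⟩, rfl⟩) (fun x => by
      obtain ⟨y | x', hx⟩ := e.surjective x.1
      · exact absurd ((h0 y).symm.trans ((congrArg f hx).trans x.2)).symm (hne _)
      · exact ⟨⟨x', hinj ((h1 x').symm.trans ((congrArg f hx).trans x.2))⟩, hx⟩),
    overEquiv_spec _ _ _ _⟩

section

variable {k : Type u} [Field k]

theorem FBBMod.sym_act_mk (F : FBBMod k) {X X' Y Y' : Type} [Finite X] [Finite X']
    [Finite Y] [Finite Y'] (e : X ≃ X') (e' : Y ≃ Y') {d : ℕ} (f : X → Fin d) (g : Y → Fin d)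
    (a : ∀ i, F.ev (Fib f i) (Fib g i)) :
    F.sym.act e e' (F.symMk f g a) =
      F.symMk (f ∘ e.symm) (g ∘ e'.symm)
        (fun i => F.act (fibMap e f i) (fibMap e' g i) (a i)) :=
  F.symAct_mk e e' f g a

theorem FBBMod.symCons_mk (F : FBBMod k) {X₁ X₂ Y₁ Y₂ : Type} [Finite X₁] [Finite X₂]
    [Finite Y₁] [Finite Y₂] (u : F.ev X₁ Y₁) {d : ℕ} (f : X₂ → Fin d) (g : Y₂ → Fin d)
    (a : ∀ i, F.ev (Fib f i) (Fib g i)) :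
    F.symCons u (F.symMk f g a) = F.symMk (consDec f) (consDec g) (F.consFam u a) :=
  F.symConsMap_mk u f g a

/-- Entries of a dependent family at equal indices are compared by any bijections lying over the
identity. This replaces casts throughout. -/
theorem FBBMod.fam_congr (F : FBBMod k) {I X Y : Type} [Finite X] [Finite Y] {f : X → I}
    {g : Y → I} (a : ∀ i, F.ev (Fib f i) (Fib g i)) {i j : I} (h : i = j)
    (e : Fib f i ≃ Fib f j) (e' : Fib g i ≃ Fib g j) (he : ∀ x, (e x).1 = x.1)
    (he' : ∀ x, (e' x).1 = x.1) : a j = F.act e e' (a i) := by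
  subst h
  exact (F.act_refl (a i)).symm.trans (F.act_congr (fun x => Subtype.ext (he x).symm)
    (fun x => Subtype.ext (he' x).symm) _)

/-- The class of the pure tensor of a family indexed by an arbitrary finite set. -/
noncomputable def FBBMod.symMkI (F : FBBMod k) {I X Y : Type} [Finite I] [Finite X] [Finite Y]
    (f : X → I) (g : Y → I) (a : ∀ i, F.ev (Fib f i) (Fib g i)) : F.sym.ev X Y :=
  F.symMk (Finite.equivFin I ∘ f) (Finite.equivFin I ∘ g) (fun n => F.act
    (fibEquiv (i := (Finite.equivFin I).symm n) (Equiv.refl X)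
      (fun _ => (Finite.equivFin I).eq_symm_apply))
    (fibEquiv (i := (Finite.equivFin I).symm n) (Equiv.refl Y)
      (fun _ => (Finite.equivFin I).eq_symm_apply)) (a _))

/-- Two enumerations of the label set differ by a permutation, which is trivial in the coinvariants,
so the class does not depend on the enumeration. The entries are compared along all bijections over
the identity, which leaves a caller free to use any description of the fibres. -/
theorem FBBMod.symMkI_eq_symMk (F : FBBMod k) {I X Y : Type} [Finite I] [Finite X] [Finite Y]
    {f : X → I} {g : Y → I} {a : ∀ i, F.ev (Fib f i) (Fib g i)} {n : ℕ} (ρ : I ≃ Fin n)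
    {f' : X → Fin n} {g' : Y → Fin n} {a' : ∀ i, F.ev (Fib f' i) (Fib g' i)}
    (hf : ∀ x, f' x = ρ (f x)) (hg : ∀ y, g' y = ρ (g y))
    (ha : ∀ (i : I) (e : Fib f i ≃ Fib f' (ρ i)) (e' : Fib g i ≃ Fib g' (ρ i)),
      (∀ x, (e x).1 = x.1) → (∀ x, (e' x).1 = x.1) → a' (ρ i) = F.act e e' (a i)) :
    F.symMkI f g a = F.symMk f' g' a' := by
  obtain rfl : Nat.card I = n := by rw [Nat.card_congr ρ, Nat.card_eq_fintype_card, Fintype.card_fin]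
  let σ : Equiv.Perm (Fin (Nat.card I)) := (Finite.equivFin I).symm.trans ρ
  have h1 : ∀ x, f' x = σ ((Finite.equivFin I ∘ f) x) := fun x => by simp [σ, hf]
  have h2 : ∀ x, g' x = σ ((Finite.equivFin I ∘ g) x) := fun x => by simp [σ, hg]
  refine (F.symMk_perm σ h1 h2 _).trans ?_
  congr 1
  funext n
  obtain ⟨i, rfl⟩ := ρ.surjective n
  rw [ha i (fibEquiv (Equiv.refl X) (fun x => by simp [hf]))
    (fibEquiv (Equiv.refl Y) (fun x => by simp [hg])) (fun _ => rfl) (fun _ => rfl),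
    F.permFam_apply σ h1 h2 _ (ρ i) (Finite.equivFin I i) (by simp [σ]), F.act_act,
    F.fam_congr a ((Finite.equivFin I).symm_apply_apply i)
      (fibEquiv (Equiv.refl X) (fun x => by simp)) (fibEquiv (Equiv.refl Y) (fun x => by simp))
      (fun _ => rfl) (fun _ => rfl), F.act_act]
  exact F.act_congr (fun _ => rfl) (fun _ => rfl) _

theorem FBBMod.symMkI_fin (F : FBBMod k) {X Y : Type} [Finite X] [Finite Y] {d : ℕ}
    (f : X → Fin d) (g : Y → Fin d) (a : ∀ i, F.ev (Fib f i) (Fib g i)) :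
    F.symMkI f g a = F.symMk f g a :=
  F.symMkI_eq_symMk (Equiv.refl _) (fun _ => rfl) (fun _ => rfl) (fun _ e e' he he' =>
    F.fam_congr a rfl e e' he he')

theorem FBBMod.sym_hom_ext (F : FBBMod k) {X Y : Type} [Finite X] [Finite Y]
    {V : Type u} [AddCommGroup V] [Module k V] {φ ψ : F.sym.ev X Y →ₗ[k] V}
    (h : ∀ (d : ℕ) (f : X → Fin d) (g : Y → Fin d) (a : ∀ i, F.ev (Fib f i) (Fib g i)),
      φ (F.symMkI f g a) = ψ (F.symMkI f g a)) : φ = ψ := by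
  refine F.symVal_hom_ext fun d f g a => ?_
  have := h d f g a
  rw [F.symMkI_fin] at this
  exact this

theorem FBBMod.symCons_mkI (F : FBBMod k) {X₁ X₂ Y₁ Y₂ : Type} [Finite X₁] [Finite X₂]
    [Finite Y₁] [Finite Y₂] (u : F.ev X₁ Y₁) {d : ℕ} (f : X₂ → Fin d) (g : Y₂ → Fin d)
    (a : ∀ i, F.ev (Fib f i) (Fib g i)) :
    F.symCons u (F.symMkI f g a) = F.symMkI (consDec f) (consDec g) (F.consFam u a) := by
  rw [F.symMkI_fin, F.symMkI_fin]
  exact F.symCons_mk u f g a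

theorem FBBMod.act_symMkI (F : FBBMod k) {I J X Y X' Y' : Type} [Finite I] [Finite J] [Finite X]
    [Finite Y] [Finite X'] [Finite Y'] (e : X ≃ X') (e' : Y ≃ Y') (ρ : I ≃ J)
    {f : X → I} {g : Y → I} {a : ∀ i, F.ev (Fib f i) (Fib g i)}
    {f' : X' → J} {g' : Y' → J} {a' : ∀ i, F.ev (Fib f' i) (Fib g' i)}
    (hf : ∀ x, f' (e x) = ρ (f x)) (hg : ∀ y, g' (e' y) = ρ (g y))
    (ha : ∀ (i : I) (p : Fib f i ≃ Fib f' (ρ i)) (p' : Fib g i ≃ Fib g' (ρ i)),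
      (∀ x, (p x).1 = e x.1) → (∀ x, (p' x).1 = e' x.1) → a' (ρ i) = F.act p p' (a i)) :
    F.sym.act e e' (F.symMkI f g a) = F.symMkI f' g' a' := by
  symm
  have hf' : ∀ x, f' x = ρ (f (e.symm x)) := fun x => by rw [← hf, e.apply_symm_apply]
  have hg' : ∀ x, g' x = ρ (g (e'.symm x)) := fun x => by rw [← hg, e'.apply_symm_apply]
  have hρ : ∀ (j : J) (i : I), (Finite.equivFin I) (ρ.symm j) = Finite.equivFin I i ↔ j = ρ i :=
    fun j i => by rw [EmbeddingLike.apply_eq_iff_eq, Equiv.symm_apply_eq]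
  refine Eq.trans ?_ (F.sym_act_mk e e' _ _ _).symm
  refine F.symMkI_eq_symMk (ρ.symm.trans (Finite.equivFin I)) (fun x => ?_) (fun x => ?_) ?_
  · simp [hf']
  · simp [hg']
  · intro j p p' hp hp'
    obtain ⟨i, rfl⟩ := ρ.surjective j
    rw [ha i (fibEquiv e (fun x => by simp [hf])) (fibEquiv e' (fun x => by simp [hg]))
      (fun _ => rfl) (fun _ => rfl), F.act_act, F.act_act,
      F.fam_congr a (i := i)
        (j := (Finite.equivFin I).symm ((ρ.symm.trans (Finite.equivFin I)) (ρ i))) (by simp)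
        (fibEquiv (Equiv.refl X) (fun x => by simp)) (fibEquiv (Equiv.refl Y) (fun x => by simp))
        (fun _ => rfl) (fun _ => rfl), F.act_act]
    apply F.act_congr
    · intro x
      exact Subtype.ext (hp (fibEquiv e (fun x => by simp [hf]) x)).symm
    · intro x
      exact Subtype.ext (hp' (fibEquiv e' (fun x => by simp [hg]) x)).symm

/-- The family `a` consists of `u`, with index `i`, and of the family `b`, whose index set is
identified with the complement of `i` by `ε`. -/
structure FBBMod.IsConsFam (F : FBBMod k) {I K X Y A B P Q : Type} [Finite X] [Finite Y]
    [Finite A] [Finite B] [Finite P] [Finite Q] (f : X → I) (g : Y → I)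
    (a : ∀ i, F.ev (Fib f i) (Fib g i)) (i : I) (u : F.ev A B) (f' : P → K) (g' : Q → K)
    (b : ∀ i, F.ev (Fib f' i) (Fib g' i)) (ε : K → I) (e : A ⊕ P ≃ X) (e' : B ⊕ Q ≃ Y) : Prop where
  inj : Function.Injective ε
  ne : ∀ l, ε l ≠ i
  surj : ∀ l, l ≠ i → ∃ m, ε m = l
  left_inl : ∀ x, f (e (Sum.inl x)) = i
  left_inr : ∀ x, f (e (Sum.inr x)) = ε (f' x)
  right_inl : ∀ x, g (e' (Sum.inl x)) = i
  right_inr : ∀ x, g (e' (Sum.inr x)) = ε (g' x)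
  -- At most one pair `p`, `p'` has the prescribed underlying maps. Quantifying over such pairs
  -- fixes the entry without choosing a model of the fibre.
  head : ∀ (p : A ≃ Fib f i) (p' : B ≃ Fib g i), (∀ x, (p x).1 = e (Sum.inl x)) →
    (∀ x, (p' x).1 = e' (Sum.inl x)) → a i = F.act p p' u
  tail : ∀ (l : K) (p : Fib f' l ≃ Fib f (ε l)) (p' : Fib g' l ≃ Fib g (ε l)),
    (∀ x, (p x).1 = e (Sum.inr x.1)) → (∀ x, (p' x).1 = e' (Sum.inr x.1)) →
      a (ε l) = F.act p p' (b l)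

/-- A relabelled product is the class of a family whose entry `0` is the new generator. This turns
identities between products into statements about splittings of families. -/
theorem FBBMod.act_symCons_symMkI (F : FBBMod k) {X Y A B P Q : Type} [Finite X] [Finite Y]
    [Finite A] [Finite B] [Finite P] [Finite Q] (u : F.ev A B) {d : ℕ} (f : P → Fin d)
    (g : Q → Fin d) (b : ∀ i, F.ev (Fib f i) (Fib g i)) (e : A ⊕ P ≃ X) (e' : B ⊕ Q ≃ Y) :
    ∃ (f' : X → Fin (d + 1)) (g' : Y → Fin (d + 1)) (a : ∀ i, F.ev (Fib f' i) (Fib g' i)),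
      F.IsConsFam f' g' a 0 u f g b Fin.succ e e' ∧
        F.sym.act e e' (F.symCons u (F.symMkI f g b)) = F.symMkI f' g' a := by
  refine ⟨consDec f ∘ e.symm, consDec g ∘ e'.symm, fun i => F.act (fibMap e (consDec f) i)
    (fibMap e' (consDec g) i) (F.consFam u b i), ?_, ?_⟩
  swap
  · rw [F.symCons_mkI, F.symMkI_fin, F.symMkI_fin]
    exact F.sym_act_mk e e' _ _ _
  refine ⟨Fin.succ_injective d, Fin.succ_ne_zero, fun l hl => Fin.exists_succ_eq.mpr hl,
    fun x => ?_, fun x => ?_, fun x => ?_, fun x => ?_, fun p p' hp hp' => ?_,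
    fun l p p' hp hp' => ?_⟩
  · simp [consDec]
  · simp [consDec]
  · simp [consDec]
  · simp [consDec]
  · simp only [consFam, Fin.cons_zero]
    rw [F.act_act]
    apply F.act_congr
    · exact fun x => Subtype.ext (hp x).symm
    · exact fun x => Subtype.ext (hp' x).symm
  · simp only [consFam, Fin.cons_succ]
    rw [F.act_act]
    apply F.act_congr
    · exact fun x => Subtype.ext (hp x).symm
    · exact fun x => Subtype.ext (hp' x).symm

/-- The converse passage, from splittings to products: enumerate the labels with `i` first and those
of `K` after it. The class is then visibly a product with first factor `u`. -/
theorem FBBMod.IsConsFam.symMkI_eq {F : FBBMod k} {I K X Y A B P Q : Type} [Finite I] [Finite K]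
    [Finite X] [Finite Y] [Finite A] [Finite B] [Finite P] [Finite Q] {f : X → I} {g : Y → I}
    {a : ∀ i, F.ev (Fib f i) (Fib g i)} {i : I} {u : F.ev A B} {f' : P → K} {g' : Q → K}
    {b : ∀ i, F.ev (Fib f' i) (Fib g' i)} {ε : K → I} {e : A ⊕ P ≃ X} {e' : B ⊕ Q ≃ Y}
    (h : F.IsConsFam f g a i u f' g' b ε e e') :
    F.symMkI f g a = F.sym.act e e' (F.symCons u (F.symMkI f' g' b)) := by
  let ρ := Finite.equivFin K
  -- The enumeration of `I` that starts with `i`. Its bijectivity is the partition of `I` into `i`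
  -- and the image of `ε`.
  let t : Fin (Nat.card K + 1) → I := Fin.cons i (fun n => ε (ρ.symm n))
  have ht : Function.Bijective t := by
    constructor
    · intro m n
      refine Fin.cases ?_ (fun m => ?_) m <;> refine Fin.cases ?_ (fun n => ?_) n
      · exact fun _ => rfl
      · exact fun hmn => absurd hmn.symm (h.ne _)
      · exact fun hmn => absurd hmn (h.ne _)
      · exact fun hmn => congrArg Fin.succ (ρ.symm.injective (h.inj hmn))
    · intro l
      by_cases hl : l = i
      · exact ⟨0, hl.symm⟩
      · obtain ⟨m, rfl⟩ := h.surj l hl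
        exact ⟨(ρ m).succ, congrArg ε (ρ.symm_apply_apply m)⟩
  let ρ' : I ≃ Fin (Nat.card K + 1) := (Equiv.ofBijective t ht).symm
  have h0 : ρ' i = 0 := (Equiv.ofBijective t ht).symm_apply_eq.mpr rfl
  have h1 : ∀ l, ρ' (ε l) = (ρ l).succ := fun l =>
    (Equiv.ofBijective t ht).symm_apply_eq.mpr (congrArg ε (ρ.symm_apply_apply l).symm)
  obtain ⟨p, q, c, hc, hc'⟩ := F.act_symCons_symMkI u (ρ ∘ f') (ρ ∘ g') (fun n => F.act
    (fibEquiv (i := ρ.symm n) (Equiv.refl P) (fun _ => ρ.eq_symm_apply))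
    (fibEquiv (i := ρ.symm n) (Equiv.refl Q) (fun _ => ρ.eq_symm_apply)) (b _)) e e'
  rw [F.symMkI_fin, F.symMkI_fin] at hc'
  refine Eq.trans ?_ hc'.symm
  have hp : ∀ x, p x = ρ' (f x) := fun x => by
    obtain ⟨x | x, rfl⟩ := e.surjective x
    · rw [hc.left_inl, h.left_inl, h0]
    · rw [hc.left_inr, h.left_inr, h1]
      rfl
  have hq : ∀ x, q x = ρ' (g x) := fun x => by
    obtain ⟨x | x, rfl⟩ := e'.surjective x
    · rw [hc.right_inl, h.right_inl, h0]
    · rw [hc.right_inr, h.right_inr, h1]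
      rfl
  refine F.symMkI_eq_symMk ρ' hp hq (fun l r r' hr hr' => ?_)
  by_cases hl : l = i
  · subst hl
    obtain ⟨w, hw⟩ := exists_fib_inl h.left_inl h.left_inr h.ne
    obtain ⟨w', hw'⟩ := exists_fib_inl h.right_inl h.right_inr h.ne
    -- The index `ρ' i` is generalised to `j` so that `j = 0` can be substituted in the types of the
    -- fibres.
    have h2 : ∀ (j : Fin (Nat.card K + 1)) (hj : j = 0) (r : Fib f l ≃ Fib p j)
        (r' : Fib g l ≃ Fib q j), (∀ x, (r x).1 = x.1) → (∀ x, (r' x).1 = x.1) →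
        c j = F.act r r' (a l) := by
      rintro j rfl r r' hr hr'
      rw [h.head w w' hw hw', F.act_act]
      exact hc.head _ _ (fun x => (hr _).trans (hw x)) (fun x => (hr' _).trans (hw' x))
    exact h2 _ h0 r r' hr hr'
  · obtain ⟨m, rfl⟩ := h.surj l hl
    obtain ⟨w, hw⟩ := exists_fib_inr h.left_inl h.left_inr h.ne h.inj m
    obtain ⟨w', hw'⟩ := exists_fib_inr h.right_inl h.right_inr h.ne h.inj m
    have h2 : ∀ (j : Fin (Nat.card K + 1)) (hj : j = (ρ m).succ) (r : Fib f (ε m) ≃ Fib p j)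
        (r' : Fib g (ε m) ≃ Fib q j), (∀ x, (r x).1 = x.1) → (∀ x, (r' x).1 = x.1) →
        c j = F.act r r' (a (ε m)) := by
      rintro j rfl r r' hr hr'
      let v : Fib (ρ ∘ f') (ρ m) ≃ Fib f' m := fibEquiv (Equiv.refl P) (fun _ => by simp)
      let v' : Fib (ρ ∘ g') (ρ m) ≃ Fib g' m := fibEquiv (Equiv.refl Q) (fun _ => by simp)
      rw [h.tail m w w' hw hw', F.act_act, hc.tail (ρ m) (v.trans (w.trans r))
        (v'.trans (w'.trans r')) (fun x => (hr _).trans (hw (v x)))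
        (fun x => (hr' _).trans (hw' (v' x))),
        F.fam_congr b (i := m) (j := ρ.symm (ρ m)) (ρ.symm_apply_apply m).symm
        (fibEquiv (Equiv.refl P) (fun _ => by simp)) (fibEquiv (Equiv.refl Q) (fun _ => by simp))
        (fun _ => rfl) (fun _ => rfl), F.act_act, F.act_act]
      apply F.act_congr <;> intro x <;> rfl
    exact h2 _ (h1 m) r r' hr hr'

end

/-! ### Products in the symmetric algebra: naturality, commutativity, splitting off a factor -/

/-- The bijection `A ⨿ (B ⨿ C) ≃ B ⨿ (A ⨿ C)`. -/
def sumLeftComm (A B C : Type) : A ⊕ (B ⊕ C) ≃ B ⊕ (A ⊕ C) where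
  toFun
    | Sum.inl a => Sum.inr (Sum.inl a)
    | Sum.inr (Sum.inl b) => Sum.inl b
    | Sum.inr (Sum.inr c) => Sum.inr (Sum.inr c)
  invFun
    | Sum.inl b => Sum.inr (Sum.inl b)
    | Sum.inr (Sum.inl a) => Sum.inl a
    | Sum.inr (Sum.inr c) => Sum.inr (Sum.inr c)
  left_inv := by rintro (a | b | c) <;> rfl
  right_inv := by rintro (a | b | c) <;> rfl

section

variable {k : Type u} [Field k]

theorem FBBMod.symCons_act (F : FBBMod k) {A B P Q A' B' P' Q' : Type} [Finite A] [Finite B]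
    [Finite P] [Finite Q] [Finite A'] [Finite B'] [Finite P'] [Finite Q'] (e : A ≃ A')
    (f : B ≃ B') (p : P ≃ P') (q : Q ≃ Q') (u : F.ev A B) (z : F.sym.ev P Q) :
    F.symCons (F.act e f u) (F.sym.act p q z) =
      F.sym.act (Equiv.sumCongr e p) (Equiv.sumCongr f q) (F.symCons u z) := by
  refine LinearMap.congr_fun (f := F.symCons (F.act e f u) ∘ₗ F.sym.act p q)
    (g := F.sym.act (Equiv.sumCongr e p) (Equiv.sumCongr f q) ∘ₗ F.symCons u)
    (F.sym_hom_ext fun d r s b => ?_) z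
  simp only [LinearMap.comp_apply]
  obtain ⟨r', s', c, hc, h⟩ :=
    F.act_symCons_symMkI u r s b (Equiv.sumCongr e p) (Equiv.sumCongr f q)
  rw [h, F.act_symMkI p q (Equiv.refl _) (a := b) (f' := r ∘ p.symm) (g' := s ∘ q.symm)
    (a' := fun i => F.act (fibMap p r i) (fibMap q s i) (b i)) (fun x => by simp)
    (fun x => by simp) (fun i w w' hw hw' =>
      F.act_congr (fun x => Subtype.ext (hw x).symm) (fun x => Subtype.ext (hw' x).symm) _)]
  -- The family of the relabelled product also splits with identity bijections, provided that its
  -- head and its tail are relabelled separately.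
  have h2 : F.IsConsFam r' s' c 0 (F.act e f u) (r ∘ p.symm) (s ∘ q.symm)
      (fun i => F.act (fibMap p r i) (fibMap q s i) (b i)) Fin.succ (Equiv.refl _)
        (Equiv.refl _) := by
    refine ⟨hc.inj, hc.ne, hc.surj, fun x => ?_, fun x => ?_, fun x => ?_, fun x => ?_,
      fun w w' hw hw' => ?_, fun l w w' hw hw' => ?_⟩
    · have := hc.left_inl (e.symm x)
      simpa using this
    · have := hc.left_inr (p.symm x)
      simpa using this
    · have := hc.right_inl (f.symm x)
      simpa using this
    · have := hc.right_inr (q.symm x)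
      simpa using this
    · rw [F.act_act]
      exact hc.head _ _ (fun x => hw _) (fun x => hw' _)
    · rw [F.act_act]
      exact hc.tail _ _ _ (fun x => hw _) (fun x => hw' _)
  rw [h2.symMkI_eq, F.sym.act_refl]

theorem FBBMod.symCons_act_right (F : FBBMod k) {A B P Q P' Q' : Type} [Finite A] [Finite B]
    [Finite P] [Finite Q] [Finite P'] [Finite Q']
    (p : P ≃ P') (q : Q ≃ Q') (u : F.ev A B) (z : F.sym.ev P Q) :
    F.symCons u (F.sym.act p q z) =
      F.sym.act (Equiv.sumCongr (Equiv.refl A) p) (Equiv.sumCongr (Equiv.refl B) q)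
        (F.symCons u z) := by
  rw [← F.symCons_act, F.act_refl]

theorem FBBMod.symCons_act_left (F : FBBMod k) {A B P Q A' B' : Type} [Finite A] [Finite B]
    [Finite P] [Finite Q] [Finite A'] [Finite B'] (e : A ≃ A')
    (f : B ≃ B') (u : F.ev A B) (z : F.sym.ev P Q) :
    F.symCons (F.act e f u) z =
      F.sym.act (Equiv.sumCongr e (Equiv.refl P)) (Equiv.sumCongr f (Equiv.refl Q))
        (F.symCons u z) := by
  rw [← F.symCons_act, F.sym.act_refl]

/-- Both sides come from one family with entries `u`, `v` and those of `z`. Splitting at label `0`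
gives `u` as first factor, and splitting at label `1` gives `v`. -/
theorem FBBMod.symCons_comm (F : FBBMod k) {A B A' B' P Q : Type} [Finite A] [Finite B]
    [Finite P] [Finite Q] [Finite A'] [Finite B'] (u : F.ev A B) (v : F.ev A' B')
    (z : F.sym.ev P Q) :
    F.symCons u (F.symCons v z) =
      F.sym.act (sumLeftComm A' A P) (sumLeftComm B' B Q) (F.symCons v (F.symCons u z)) := by
  refine LinearMap.congr_fun (f := F.symCons u ∘ₗ F.symCons v)
    (g := F.sym.act (sumLeftComm A' A P) (sumLeftComm B' B Q) ∘ₗ F.symCons v ∘ₗ F.symCons u)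
    (F.sym_hom_ext fun d r s b => ?_) z
  simp only [LinearMap.comp_apply]
  -- The labels other than `1` are enumerated by `Fin.succAbove 1`, so the remaining family starts
  -- with `u` and continues with the entries of `z`.
  have h : F.IsConsFam (consDec (consDec r)) (consDec (consDec s)) (F.consFam u (F.consFam v b))
      1 v (consDec r) (consDec s) (F.consFam u b) (Fin.succAbove 1) (sumLeftComm A' A P)
        (sumLeftComm B' B Q) := by
    have h1 : ∀ l : Fin d, (1 : Fin (d + 2)).succAbove l.succ = l.succ.succ := fun l => by
      rw [show (1 : Fin (d + 2)) = Fin.succ 0 from rfl, Fin.succ_succAbove_succ,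
        Fin.succAbove_zero]
    refine ⟨Fin.succAbove_right_injective, Fin.succAbove_ne 1,
      fun l hl => Fin.exists_succAbove_eq hl, fun x => rfl, ?_, fun x => rfl, ?_,
      fun w w' hw hw' => ?_, fun l => ?_⟩
    · rintro (x | x)
      · rfl
      · exact (h1 _).symm
    · rintro (x | x)
      · rfl
      · exact (h1 _).symm
    · change F.act (consFibSucc A (consDec r) 0) (consFibSucc B (consDec s) 0)
        (F.act (consFibZero A' r) (consFibZero B' s) v) = _
      rw [F.act_act]
      exact F.act_congr (fun x => Subtype.ext (hw x).symm) (fun x => Subtype.ext (hw' x).symm) _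
    · refine Fin.cases (fun w w' hw hw' => ?_) (fun l => ?_) l
      · change F.act (consFibZero A (consDec r)) (consFibZero B (consDec s)) u =
          F.act w w' (F.act (consFibZero A r) (consFibZero B s) u)
        rw [F.act_act]
        exact F.act_congr (fun x => Subtype.ext (hw (consFibZero A r x)).symm)
          (fun x => Subtype.ext (hw' (consFibZero B s x)).symm) _
      · rw [h1]
        intro w w' hw hw'
        change F.act (consFibSucc A (consDec r) l.succ) (consFibSucc B (consDec s) l.succ)
          (F.act (consFibSucc A' r l) (consFibSucc B' s l) (b l)) =
          F.act w w' (F.act (consFibSucc A r l) (consFibSucc B s l) (b l))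
        rw [F.act_act, F.act_act]
        exact F.act_congr (fun x => Subtype.ext (hw (consFibSucc A r l x)).symm)
          (fun x => Subtype.ext (hw' (consFibSucc B s l x)).symm) _
  rw [F.symCons_mkI, F.symCons_mkI, h.symMkI_eq, F.symCons_mkI, F.symCons_mkI, F.symCons_mkI]

/-- The splitting depends only on the decompositions `f`, `g` and the label `i`. Head and tail
entries are obtained from `a` by fixed linear maps `U` and `T`. This uniformity in `a` is what later
makes the contraction multilinear. -/
theorem FBBMod.exists_isConsFam (F : FBBMod k) {I X Y : Type} [Finite I] [Finite X] [Finite Y]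
    (f : X → I) (g : Y → I) (i : I) :
    ∃ (A B P Q K : Type) (_ : Finite A) (_ : Finite B) (_ : Finite P) (_ : Finite Q)
      (_ : Finite K) (f' : P → K) (g' : Q → K) (ε : K → I) (e : A ⊕ P ≃ X) (e' : B ⊕ Q ≃ Y)
      (U : F.ev (Fib f i) (Fib g i) →ₗ[k] F.ev A B)
      (T : ∀ l, F.ev (Fib f (ε l)) (Fib g (ε l)) →ₗ[k] F.ev (Fib f' l) (Fib g' l)),
      (∀ x, f (e (Sum.inl x)) = i) ∧ (∀ x, g (e' (Sum.inl x)) = i) ∧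
      ∀ a : ∀ i, F.ev (Fib f i) (Fib g i),
        F.IsConsFam f g a i (U (a i)) f' g' (fun l => T l (a (ε l))) ε e e' := by
  classical
  let K := {l : I // ¬ l = i}
  have w : ∀ {Z : Type} (h : Z → I) (l : K), ∃ w : Fib h l.1 ≃
      Fib (fun x : {x : Z // ¬ h x = i} => (⟨h x.1, x.2⟩ : K)) l, ∀ x, (w x).1.1 = x.1 := by
    intro Z h l
    exact ⟨⟨fun x => ⟨⟨x.1, fun hx => l.2 (x.2.symm.trans hx)⟩, Subtype.ext x.2⟩,
      fun x => ⟨x.1.1, congrArg Subtype.val x.2⟩, fun _ => rfl, fun _ => rfl⟩, fun _ => rfl⟩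
  choose wf hwf using w f
  choose wg hwg using w g
  refine ⟨Fib f i, Fib g i, {x : X // ¬ f x = i}, {y : Y // ¬ g y = i}, K, inferInstance,
    inferInstance, inferInstance, inferInstance, inferInstance, fun x => ⟨f x.1, x.2⟩,
    fun x => ⟨g x.1, x.2⟩, Subtype.val,
    Equiv.sumCompl (fun x => f x = i), Equiv.sumCompl (fun y => g y = i),
    LinearMap.id, fun l => F.act (wf l) (wg l), fun x => x.2, fun x => x.2, fun a => ⟨
    Subtype.val_injective, fun l => l.2, fun l hl => ⟨⟨l, hl⟩, rfl⟩, fun x => x.2, fun x => rfl,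
    fun x => x.2, fun x => rfl, fun p p' hp hp' => F.fam_congr a rfl p p' hp hp',
    fun l p p' hp hp' => ?_⟩⟩
  rw [F.act_act]
  exact F.fam_congr a rfl _ _ (fun x => (hp _).trans (hwf l x)) (fun x => (hp' _).trans (hwg l x))

theorem FBBMod.exists_act_left (F : FBBMod k) {A B : Type} [Finite A] [Finite B] (u : F.ev A B)
    (x : A) : ∃ (A' : Type) (_ : Finite A') (e : A' ⊕ Fin 1 ≃ A) (u' : F.ev (A' ⊕ Fin 1) B),
      e (Sum.inr 0) = x ∧ u = F.act e (Equiv.refl B) u' := by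
  obtain ⟨A', _, e, he⟩ := exists_sum_one x
  refine ⟨A', inferInstance, e, F.act e.symm (Equiv.refl B) u, he, ?_⟩
  rw [F.act_act, Equiv.symm_trans_self, Equiv.refl_trans, F.act_refl]

theorem FBBMod.exists_act_right (F : FBBMod k) {A B : Type} [Finite A] [Finite B] (u : F.ev A B)
    (y : B) : ∃ (B' : Type) (_ : Finite B') (e : B' ⊕ Fin 1 ≃ B) (u' : F.ev A (B' ⊕ Fin 1)),
      e (Sum.inr 0) = y ∧ u = F.act (Equiv.refl A) e u' := by
  obtain ⟨B', _, e, he⟩ := exists_sum_one y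
  refine ⟨B', inferInstance, e, F.act (Equiv.refl A) e.symm u, he, ?_⟩
  rw [F.act_act, Equiv.symm_trans_self, Equiv.refl_trans, F.act_refl]

/-- A linear map on `S*F(X, Y)` is determined by its values on the products `u · z` where `u` is a
generator that involves a given element of `X`. -/
theorem FBBMod.sym_ext_left (F : FBBMod k) {X Y : Type} [Finite X] [Finite Y] (x : X)
    {V : Type u} [AddCommGroup V] [Module k V] {φ ψ : F.sym.ev X Y →ₗ[k] V}
    (h : ∀ (A B P Q : Type) [Finite A] [Finite B] [Finite P] [Finite Q]
      (e : (A ⊕ Fin 1) ⊕ P ≃ X) (e' : B ⊕ Q ≃ Y) (u : F.ev (A ⊕ Fin 1) B) (z : F.sym.ev P Q),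
      e (Sum.inl (Sum.inr 0)) = x →
      φ (F.sym.act e e' (F.symCons u z)) = ψ (F.sym.act e e' (F.symCons u z)))
    (z : F.sym.ev X Y) : φ z = ψ z := by
  refine LinearMap.congr_fun (F.sym_hom_ext fun d f g a => ?_) z
  -- Splitting at the label of `x` forces `x` into the head factor, since no label of the tail
  -- equals `f x`.
  obtain ⟨A, B, P, Q, K, _, _, _, _, _, f', g', ε, e, e', U, T, -, -, hc⟩ :=
    F.exists_isConsFam f g (f x)
  replace hc := hc a
  generalize U (a (f x)) = u at hc
  rw [hc.symMkI_eq]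
  obtain ⟨x' | x', hx⟩ := e.surjective x
  · obtain ⟨A', _, p, u', hp, rfl⟩ := F.exists_act_left u x'
    rw [F.symCons_act_left, F.sym.act_act]
    exact h _ _ _ _ _ _ _ _ (by rw [← hx, ← hp]; rfl)
  · exact absurd ((hc.left_inr x').symm.trans (congrArg f hx)) (hc.ne _)

/-- A linear map on `S*F(X, Y)` is determined by its values on the products `u · z` where `u` is a
generator that involves a given element of `Y`. -/
theorem FBBMod.sym_ext_right (F : FBBMod k) {X Y : Type} [Finite X] [Finite Y] (y : Y)
    {V : Type u} [AddCommGroup V] [Module k V] {φ ψ : F.sym.ev X Y →ₗ[k] V}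
    (h : ∀ (A B P Q : Type) [Finite A] [Finite B] [Finite P] [Finite Q]
      (e : A ⊕ P ≃ X) (e' : (B ⊕ Fin 1) ⊕ Q ≃ Y) (u : F.ev A (B ⊕ Fin 1)) (z : F.sym.ev P Q),
      e' (Sum.inl (Sum.inr 0)) = y →
      φ (F.sym.act e e' (F.symCons u z)) = ψ (F.sym.act e e' (F.symCons u z)))
    (z : F.sym.ev X Y) : φ z = ψ z := by
  refine LinearMap.congr_fun (F.sym_hom_ext fun d f g a => ?_) z
  obtain ⟨A, B, P, Q, K, _, _, _, _, _, f', g', ε, e, e', U, T, -, -, hc⟩ :=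
    F.exists_isConsFam f g (g y)
  replace hc := hc a
  generalize U (a (g y)) = u at hc
  rw [hc.symMkI_eq]
  obtain ⟨y' | y', hy⟩ := e'.surjective y
  · obtain ⟨B', _, p, u', hp, rfl⟩ := F.exists_act_right u y'
    rw [F.symCons_act_left, F.sym.act_act]
    exact h _ _ _ _ _ _ _ _ (by rw [← hy, ← hp]; rfl)
  · exact absurd ((hc.right_inr y').symm.trans (congrArg g hy)) (hc.ne _)

end

/-! ### Uniqueness of splittings and multilinearity -/

theorem exists_overEquiv {A B T : Type} {p : A → T} {q : B → T} (hp : Function.Injective p)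
    (hq : Function.Injective q) (h : ∀ a, ∃ b, q b = p a) (h' : ∀ b, ∃ a, p a = q b) :
    ∃ w : A ≃ B, ∀ a, q (w a) = p a :=
  ⟨overEquiv p q hp hq h h', overEquiv_spec hp hq h h'⟩

section

variable {k : Type u} [Field k]

theorem FBBMod.eq_act_symm (F : FBBMod k) {X Y X' Y' : Type} [Finite X] [Finite Y] [Finite X']
    [Finite Y'] {e : X ≃ X'} {f : Y ≃ Y'} {x : F.ev X Y} {y : F.ev X' Y'} (h : F.act e f x = y) :
    x = F.act e.symm f.symm y := by
  rw [← h, F.act_act, Equiv.self_trans_symm, Equiv.self_trans_symm, F.act_refl]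

/-- The bijections `e`, `e'` and `ρ` carry the family `a` to the family `a'`. -/
structure FBBMod.IsFamIso (F : FBBMod k) {I J X Y X' Y' : Type} [Finite X]
    [Finite Y] [Finite X'] [Finite Y'] (f : X → I) (g : Y → I) (a : ∀ i, F.ev (Fib f i) (Fib g i))
    (f' : X' → J) (g' : Y' → J) (a' : ∀ i, F.ev (Fib f' i) (Fib g' i))
    (e : X ≃ X') (e' : Y ≃ Y') (ρ : I ≃ J) : Prop where
  left : ∀ x, f' (e x) = ρ (f x)
  right : ∀ y, g' (e' y) = ρ (g y)
  fam : ∀ (i : I) (p : Fib f i ≃ Fib f' (ρ i)) (p' : Fib g i ≃ Fib g' (ρ i)),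
      (∀ x, (p x).1 = e x.1) → (∀ x, (p' x).1 = e' x.1) → a' (ρ i) = F.act p p' (a i)

variable {F : FBBMod k}

theorem FBBMod.IsFamIso.fam' {I J X Y X' Y' : Type} [Finite X]
    [Finite Y] [Finite X'] [Finite Y'] {f : X → I} {g : Y → I} {a : ∀ i, F.ev (Fib f i) (Fib g i)}
    {f' : X' → J} {g' : Y' → J} {a' : ∀ i, F.ev (Fib f' i) (Fib g' i)}
    {e : X ≃ X'} {e' : Y ≃ Y'} {ρ : I ≃ J} (h : F.IsFamIso f g a f' g' a' e e' ρ)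
    {i : I} {j : J} (hj : j = ρ i) (p : Fib f i ≃ Fib f' j) (p' : Fib g i ≃ Fib g' j)
    (hp : ∀ x, (p x).1 = e x.1) (hp' : ∀ x, (p' x).1 = e' x.1) : a' j = F.act p p' (a i) := by
  subst hj
  exact h.fam i p p' hp hp'

/-- Two decompositions of isomorphic families are isomorphic. -/
theorem FBBMod.IsConsFam.unique {I K X Y A B P Q : Type} [Finite X] [Finite Y] [Finite A]
    [Finite B] [Finite P] [Finite Q] {f : X → I} {g : Y → I}
    {a : ∀ i, F.ev (Fib f i) (Fib g i)} {i : I} {u : F.ev A B} {f' : P → K} {g' : Q → K}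
    {b : ∀ i, F.ev (Fib f' i) (Fib g' i)} {ε : K → I} {e : A ⊕ P ≃ X} {e' : B ⊕ Q ≃ Y}
    (h : F.IsConsFam f g a i u f' g' b ε e e')
    {I₂ K₂ X₂ Y₂ A₂ B₂ P₂ Q₂ : Type} [Finite X₂] [Finite Y₂] [Finite A₂]
    [Finite B₂] [Finite P₂] [Finite Q₂] {f₂ : X₂ → I₂} {g₂ : Y₂ → I₂}
    {a₂ : ∀ i, F.ev (Fib f₂ i) (Fib g₂ i)} {i₂ : I₂} {u₂ : F.ev A₂ B₂} {f₂' : P₂ → K₂}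
    {g₂' : Q₂ → K₂} {b₂ : ∀ i, F.ev (Fib f₂' i) (Fib g₂' i)} {ε₂ : K₂ → I₂} {e₂ : A₂ ⊕ P₂ ≃ X₂}
    {e₂' : B₂ ⊕ Q₂ ≃ Y₂} (h₂ : F.IsConsFam f₂ g₂ a₂ i₂ u₂ f₂' g₂' b₂ ε₂ e₂ e₂')
    {χ : X ≃ X₂} {υ : Y ≃ Y₂} {ρ : I ≃ I₂} (ha : F.IsFamIso f g a f₂ g₂ a₂ χ υ ρ)
    (hi : i₂ = ρ i) :
    ∃ (α : A ≃ A₂) (β : B ≃ B₂) (π : P ≃ P₂) (κ : Q ≃ Q₂) (τ : K ≃ K₂),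
      (∀ x, e₂ (Sum.inl (α x)) = χ (e (Sum.inl x))) ∧
      (∀ x, e₂' (Sum.inl (β x)) = υ (e' (Sum.inl x))) ∧
      (∀ x, e₂ (Sum.inr (π x)) = χ (e (Sum.inr x))) ∧
      (∀ x, e₂' (Sum.inr (κ x)) = υ (e' (Sum.inr x))) ∧
      (∀ l, ε₂ (τ l) = ρ (ε l)) ∧
      u₂ = F.act α β u ∧ F.IsFamIso f' g' b f₂' g₂' b₂ π κ τ := by
  -- A point lies in the head exactly when its label is the distinguished one, and `χ` respects
  -- labels. Hence `χ` restricts to the heads and to the tails. The argument serves both inputs and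
  -- outputs.
  have key : ∀ {Z Z₂ A A₂ P P₂ : Type} {f : Z → I} {f₂ : Z₂ → I₂} {f' : P → K} {f₂' : P₂ → K₂}
      {χ : Z ≃ Z₂} {e : A ⊕ P ≃ Z} {e₂ : A₂ ⊕ P₂ ≃ Z₂} (_ : ∀ x, f₂ (χ x) = ρ (f x))
      (_ : ∀ x, f (e (Sum.inl x)) = i) (_ : ∀ x, f (e (Sum.inr x)) = ε (f' x))
      (_ : ∀ x, f₂ (e₂ (Sum.inl x)) = i₂) (_ : ∀ x, f₂ (e₂ (Sum.inr x)) = ε₂ (f₂' x)),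
      (∃ α : A ≃ A₂, ∀ x, e₂ (Sum.inl (α x)) = χ (e (Sum.inl x))) ∧
      (∃ π : P ≃ P₂, ∀ x, e₂ (Sum.inr (π x)) = χ (e (Sum.inr x))) := by
    intro Z Z₂ A A₂ P P₂ f f₂ f' f₂' χ e e₂ h0 h1 h2 h3 h4
    constructor
    · refine exists_overEquiv (p := fun x => χ (e (Sum.inl x))) (q := fun x => e₂ (Sum.inl x))
        (χ.injective.comp (e.injective.comp Sum.inl_injective))
        (e₂.injective.comp Sum.inl_injective) (fun x => ?_) (fun x => ?_)
      · obtain ⟨y | y, hy⟩ := e₂.surjective (χ (e (Sum.inl x)))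
        · exact ⟨y, hy⟩
        · refine absurd ?_ (h₂.ne (f₂' y))
          rw [← h4, hy, h0, h1, hi]
      · obtain ⟨y | y, hy⟩ := (e.trans χ).surjective (e₂ (Sum.inl x))
        · exact ⟨y, hy⟩
        · refine absurd ?_ (h.ne (f' y))
          apply ρ.injective
          rw [← h2, ← h0, ← hi, ← h3 x, ← hy]
          rfl
    · refine exists_overEquiv (p := fun x => χ (e (Sum.inr x))) (q := fun x => e₂ (Sum.inr x))
        (χ.injective.comp (e.injective.comp Sum.inr_injective))
        (e₂.injective.comp Sum.inr_injective) (fun x => ?_) (fun x => ?_)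
      · obtain ⟨y | y, hy⟩ := e₂.surjective (χ (e (Sum.inr x)))
        · refine absurd ?_ (h.ne (f' x))
          apply ρ.injective
          rw [← h2, ← h0, ← hi, ← h3 y, ← hy]
        · exact ⟨y, hy⟩
      · obtain ⟨y | y, hy⟩ := (e.trans χ).surjective (e₂ (Sum.inr x))
        · refine absurd ?_ (h₂.ne (f₂' x))
          rw [← h4, ← hy, hi, ← h1 y, ← h0]
          rfl
        · exact ⟨y, hy⟩
  obtain ⟨⟨α, hα⟩, π, hπ⟩ := key ha.left h.left_inl h.left_inr h₂.left_inl h₂.left_inr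
  obtain ⟨⟨β, hβ⟩, κ, hκ⟩ := key ha.right h.right_inl h.right_inr h₂.right_inl h₂.right_inr
  obtain ⟨τ, hτ⟩ : ∃ τ : K ≃ K₂, ∀ l, ε₂ (τ l) = ρ (ε l) :=
    ⟨overEquiv (fun l => ρ (ε l)) ε₂ (ρ.injective.comp h.inj) h₂.inj
      (fun l => h₂.surj _ (fun hl => h.ne l (ρ.injective (hl.trans hi))))
      (fun l => by
        obtain ⟨m, hm⟩ := h.surj (ρ.symm (ε₂ l)) (fun hl => h₂.ne l (by
          rw [hi, ← hl, Equiv.apply_symm_apply]))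
        exact ⟨m, by rw [hm, Equiv.apply_symm_apply]⟩), overEquiv_spec _ _ _ _⟩
  refine ⟨α, β, π, κ, τ, hα, hβ, hπ, hκ, hτ, ?_, ?_, ?_, ?_⟩
  · obtain ⟨w, hw⟩ := exists_fib_inl h.left_inl h.left_inr h.ne
    obtain ⟨w', hw'⟩ := exists_fib_inl h.right_inl h.right_inr h.ne
    obtain ⟨v, hv⟩ := exists_fib_inl h₂.left_inl h₂.left_inr h₂.ne
    obtain ⟨v', hv'⟩ := exists_fib_inl h₂.right_inl h₂.right_inr h₂.ne
    -- The entries at corresponding labels are related by `ha`. Rewriting both through their heads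
    -- and inverting the bijections yields the relation between `u` and `u₂`.
    have h1 := ha.fam' hi (w.symm.trans (α.trans v)) (w'.symm.trans (β.trans v'))
      (fun x => by
        obtain ⟨x, rfl⟩ := w.surjective x
        simp [hv, hw, hα])
      (fun x => by
        obtain ⟨x, rfl⟩ := w'.surjective x
        simp [hv', hw', hβ])
    rw [h.head w w' hw hw', h₂.head v v' hv hv', F.act_act] at h1
    rw [F.eq_act_symm h1, F.act_act]
    apply F.act_congr <;> intro x <;> simp
  · intro x
    apply h₂.inj
    rw [← h₂.left_inr, hπ, ha.left, h.left_inr, hτ]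
  · intro x
    apply h₂.inj
    rw [← h₂.right_inr, hκ, ha.right, h.right_inr, hτ]
  · intro l p p' hp hp'
    obtain ⟨w, hw⟩ := exists_fib_inr h.left_inl h.left_inr h.ne h.inj l
    obtain ⟨w', hw'⟩ := exists_fib_inr h.right_inl h.right_inr h.ne h.inj l
    obtain ⟨v, hv⟩ := exists_fib_inr h₂.left_inl h₂.left_inr h₂.ne h₂.inj (τ l)
    obtain ⟨v', hv'⟩ := exists_fib_inr h₂.right_inl h₂.right_inr h₂.ne h₂.inj (τ l)
    have h1 := ha.fam' (hτ l) (w.symm.trans (p.trans v)) (w'.symm.trans (p'.trans v'))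
      (fun x => by
        obtain ⟨x, rfl⟩ := w.surjective x
        simp [hv, hw, hp, hπ])
      (fun x => by
        obtain ⟨x, rfl⟩ := w'.surjective x
        simp [hv', hw', hp', hκ])
    rw [h.tail l w w' hw hw', h₂.tail _ v v' hv hv', F.act_act] at h1
    rw [F.eq_act_symm h1, F.act_act]
    apply F.act_congr <;> intro x <;> simp

theorem FBBMod.IsFamIso.act_symMkI {I J X Y X' Y' : Type} [Finite I] [Finite J] [Finite X]
    [Finite Y] [Finite X'] [Finite Y'] {f : X → I} {g : Y → I} {a : ∀ i, F.ev (Fib f i) (Fib g i)}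
    {f' : X' → J} {g' : Y' → J} {a' : ∀ i, F.ev (Fib f' i) (Fib g' i)}
    {e : X ≃ X'} {e' : Y ≃ Y'} {ρ : I ≃ J} (h : F.IsFamIso f g a f' g' a' e e' ρ) :
    F.sym.act e e' (F.symMkI f g a) = F.symMkI f' g' a' :=
  F.act_symMkI e e' ρ h.left h.right h.fam

/-- The multilinear map `a ↦ B(aᵢ, R((aₗ)_{l ≠ i}))`. -/
def multilinearPick {I J : Type} {M : I → Type u} [∀ i, AddCommGroup (M i)] [∀ i, Module k (M i)]
    {N V : Type u} [AddCommGroup N] [Module k N] [AddCommGroup V] [Module k V] (i : I)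
    (B : M i →ₗ[k] N →ₗ[k] V) {s : J → I} (R : MultilinearMap k (fun n => M (s n)) N)
    (hs : Function.Injective s) (hne : ∀ n, s n ≠ i) (hsurj : ∀ l, l ≠ i → ∃ n, s n = l) :
    MultilinearMap k M V where
  toFun a := B (a i) (R fun n => a (s n))
  map_update_add' {_} a l x y := by
    classical
    by_cases hl : l = i
    · subst hl
      have h : ∀ z, (fun n => Function.update a l z (s n)) = fun n => a (s n) := fun z =>
        funext fun n => Function.update_of_ne (hne n) _ _
      simp only [h, Function.update_self, map_add, LinearMap.add_apply]
    · obtain ⟨n, rfl⟩ := hsurj l hl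
      have h : ∀ z, (fun m => Function.update a (s n) z (s m)) =
          Function.update (fun m => a (s m)) n z := fun z =>
        Function.update_comp_eq_of_injective' a hs n z
      simp only [h, Function.update_of_ne (hne n).symm, R.map_update_add, map_add]
  map_update_smul' {_} a l c x := by
    classical
    by_cases hl : l = i
    · subst hl
      have h : ∀ z, (fun n => Function.update a l z (s n)) = fun n => a (s n) := fun z =>
        funext fun n => Function.update_of_ne (hne n) _ _
      simp only [h, Function.update_self, map_smul, LinearMap.smul_apply]
    · obtain ⟨n, rfl⟩ := hsurj l hl
      have h : ∀ z, (fun m => Function.update a (s n) z (s m)) =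
          Function.update (fun m => a (s m)) n z := fun z =>
        Function.update_comp_eq_of_injective' a hs n z
      simp only [h, Function.update_of_ne (hne n).symm, R.map_update_smul, map_smul]

/-- The multilinear map `a ↦ R(a ∘ s)` for a bijection `s`. -/
def multilinearReindex {I J : Type} {M : I → Type u} [∀ i, AddCommGroup (M i)]
    [∀ i, Module k (M i)] {V : Type u} [AddCommGroup V] [Module k V] {s : J → I}
    (R : MultilinearMap k (fun n => M (s n)) V) (hs : Function.Bijective s) :
    MultilinearMap k M V where
  toFun a := R fun n => a (s n)
  map_update_add' {_} a l x y := by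
    classical
    obtain ⟨n, rfl⟩ := hs.2 l
    have h : ∀ z, (fun m => Function.update a (s n) z (s m)) =
        Function.update (fun m => a (s m)) n z := fun z =>
      Function.update_comp_eq_of_injective' a hs.1 n z
    simp only [h, R.map_update_add]
  map_update_smul' {_} a l c x := by
    classical
    obtain ⟨n, rfl⟩ := hs.2 l
    have h : ∀ z, (fun m => Function.update a (s n) z (s m)) =
        Function.update (fun m => a (s m)) n z := fun z =>
      Function.update_comp_eq_of_injective' a hs.1 n z
    simp only [h, R.map_update_smul]

/-- The class of a pure tensor is multilinear in its entries. -/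
theorem FBBMod.exists_multilinear_symMkI (F : FBBMod k) {I X Y : Type} [Finite I] [Finite X]
    [Finite Y] (f : X → I) (g : Y → I) :
    ∃ R : MultilinearMap k (fun i => F.ev (Fib f i) (Fib g i)) (F.sym.ev X Y),
      ∀ a, R a = F.symMkI f g a := by
  let ρ := Finite.equivFin I
  refine ⟨multilinearReindex (s := ρ.symm) (MultilinearMap.compLinearMap
    ((F.symIncl (ρ ∘ f) (ρ ∘ g)).compMultilinearMap (PiTensorProduct.tprod k))
    (fun n => F.act (fibEquiv (i := ρ.symm n) (Equiv.refl X) (fun _ => ρ.eq_symm_apply))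
      (fibEquiv (i := ρ.symm n) (Equiv.refl Y) (fun _ => ρ.eq_symm_apply)))) ρ.symm.bijective,
    fun a => rfl⟩

/-- Used to rename the head after one of its points has been exhibited as the marked point of a set
of the form `A ⨿ 1`. -/
theorem FBBMod.IsConsFam.act_head {F : FBBMod k} {I K X Y A B P Q A' B' : Type} [Finite X]
    [Finite Y] [Finite A] [Finite B] [Finite P] [Finite Q] [Finite A'] [Finite B'] {f : X → I}
    {g : Y → I} {a : ∀ i, F.ev (Fib f i) (Fib g i)} {i : I} {u : F.ev A B} {f' : P → K} {g' : Q → K}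
    {b : ∀ i, F.ev (Fib f' i) (Fib g' i)} {ε : K → I} {e : A ⊕ P ≃ X} {e' : B ⊕ Q ≃ Y}
    (h : F.IsConsFam f g a i u f' g' b ε e e') (p : A' ≃ A) (q : B' ≃ B) :
    F.IsConsFam f g a i (F.act p.symm q.symm u) f' g' b ε
      ((Equiv.sumCongr p (Equiv.refl P)).trans e) ((Equiv.sumCongr q (Equiv.refl Q)).trans e') :=
  ⟨h.inj, h.ne, h.surj, fun x => h.left_inl (p x), h.left_inr, fun x => h.right_inl (q x),
    h.right_inr, fun w w' hw hw' => by
      rw [F.act_act]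
      refine h.head _ _ (fun x => (hw _).trans ?_) (fun x => (hw' _).trans ?_) <;> simp,
    h.tail⟩

/-! ### Gluing structures and the contraction of a family -/

/-- The gluing operations on the `k(FB × FB)`-module `M`, with the compatibilities that make the
contraction of `S*M` they induce a `k dwb`-module structure. -/
structure EdgeStr (M : FBBMod k) where
  /-- Gluing an input of one element to an output of another one. -/
  pair : ∀ {X₁ Y₁ X₂ Y₂ : Type} [Finite X₁] [Finite Y₁] [Finite X₂] [Finite Y₂],
    M.ev (X₁ ⊕ Fin 1) Y₁ →ₗ[k] M.ev X₂ (Y₂ ⊕ Fin 1) →ₗ[k] M.ev (X₁ ⊕ X₂) (Y₁ ⊕ Y₂)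
  /-- Gluing an input and an output of the same element. -/
  trace : ∀ {X Y : Type} [Finite X] [Finite Y], M.ev (X ⊕ Fin 1) (Y ⊕ Fin 1) →ₗ[k] M.ev X Y
  pair_act : ∀ {X₁ Y₁ X₂ Y₂ X₁' Y₁' X₂' Y₂' : Type} [Finite X₁] [Finite Y₁] [Finite X₂] [Finite Y₂]
    [Finite X₁'] [Finite Y₁'] [Finite X₂'] [Finite Y₂']
    (e₁ : X₁ ≃ X₁') (f₁ : Y₁ ≃ Y₁') (e₂ : X₂ ≃ X₂') (f₂ : Y₂ ≃ Y₂')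
    (u : M.ev (X₁ ⊕ Fin 1) Y₁) (v : M.ev X₂ (Y₂ ⊕ Fin 1)),
    pair (M.act (Equiv.sumCongr e₁ (Equiv.refl (Fin 1))) f₁ u)
        (M.act e₂ (Equiv.sumCongr f₂ (Equiv.refl (Fin 1))) v) =
      M.act (Equiv.sumCongr e₁ e₂) (Equiv.sumCongr f₁ f₂) (pair u v)
  trace_act : ∀ {X Y X' Y' : Type} [Finite X] [Finite Y] [Finite X'] [Finite Y']
    (e : X ≃ X') (f : Y ≃ Y') (u : M.ev (X ⊕ Fin 1) (Y ⊕ Fin 1)),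
    trace (M.act (Equiv.sumCongr e (Equiv.refl (Fin 1))) (Equiv.sumCongr f (Equiv.refl (Fin 1))) u)
      = M.act e f (trace u)
  -- This removes the configurations in which both edges leave the same factor.
  eq_zero : ∀ {X Y : Type} [Finite X] [Finite Y] (u : M.ev X Y) (y y' : Y), y ≠ y' → u = 0
  -- Two edges forming a chain of three factors.
  assoc : ∀ {X₁ Y₁ X₂ Y₂ X₃ Y₃ : Type} [Finite X₁] [Finite Y₁] [Finite X₂] [Finite Y₂]
    [Finite X₃] [Finite Y₃]
    (u : M.ev (X₁ ⊕ Fin 1) Y₁) (v : M.ev (X₂ ⊕ Fin 1) (Y₂ ⊕ Fin 1))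
    (w : M.ev X₃ (Y₃ ⊕ Fin 1)),
    M.act (Equiv.sumAssoc X₁ X₂ X₃) (Equiv.sumAssoc Y₁ Y₂ Y₃)
        (pair (M.act (Equiv.sumAssoc X₁ X₂ (Fin 1)).symm (Equiv.refl (Y₁ ⊕ Y₂)) (pair u v)) w) =
      pair u (M.act (Equiv.refl (X₂ ⊕ X₃)) (sumRot Y₂ (Fin 1) Y₃) (pair v w))
  -- Two edges entering different inputs of one factor.
  parallel : ∀ {X₁ Y₁ X₂ Y₂ X₃ Y₃ : Type} [Finite X₁] [Finite Y₁] [Finite X₂] [Finite Y₂]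
    [Finite X₃] [Finite Y₃]
    (u : M.ev ((X₁ ⊕ Fin 1) ⊕ Fin 1) Y₁) (v : M.ev X₂ (Y₂ ⊕ Fin 1))
    (w : M.ev X₃ (Y₃ ⊕ Fin 1)),
    M.act (sumRot X₁ X₂ X₃) (sumRot Y₁ Y₂ Y₃)
        (pair (M.act (sumRot X₁ (Fin 1) X₂) (Equiv.refl (Y₁ ⊕ Y₂)) (pair u v)) w) =
      pair (M.act (sumRot X₁ (Fin 1) X₃) (Equiv.refl (Y₁ ⊕ Y₃))
        (pair (M.act (sumRot X₁ (Fin 1) (Fin 1)) (Equiv.refl Y₁) u) w)) v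
  -- Two edges forming a cycle through `u` and `v`: whichever is contracted first, the other becomes
  -- a loop.
  trace_pair_comm : ∀ {X₁ Y₁ X₂ Y₂ : Type} [Finite X₁] [Finite Y₁] [Finite X₂] [Finite Y₂]
    (u : M.ev (X₁ ⊕ Fin 1) (Y₁ ⊕ Fin 1)) (v : M.ev (X₂ ⊕ Fin 1) (Y₂ ⊕ Fin 1)),
    trace (M.act (Equiv.sumAssoc X₁ X₂ (Fin 1)).symm (sumRot Y₁ (Fin 1) Y₂) (pair u v)) =
      M.act (Equiv.sumComm X₂ X₁) (Equiv.sumComm Y₂ Y₁)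
        (trace (M.act (Equiv.sumAssoc X₂ X₁ (Fin 1)).symm (sumRot Y₂ (Fin 1) Y₁) (pair v u)))
  -- A loop at `u` together with an edge from another input of `u` to the output of `v`.
  pair_trace : ∀ {X₁ Y₁ X₂ Y₂ : Type} [Finite X₁] [Finite Y₁] [Finite X₂] [Finite Y₂]
    (u : M.ev ((X₁ ⊕ Fin 1) ⊕ Fin 1) (Y₁ ⊕ Fin 1)) (v : M.ev X₂ (Y₂ ⊕ Fin 1)),
    pair (trace u) v = trace (M.act (sumRot X₁ (Fin 1) X₂) (sumRot Y₁ (Fin 1) Y₂)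
      (pair (M.act (sumRot X₁ (Fin 1) (Fin 1)) (Equiv.refl (Y₁ ⊕ Fin 1)) u) v))

namespace EdgeStr

variable {M : FBBMod k} (E : EdgeStr M)

/-- The element `r` of `S*M` is obtained from the pure tensor of the family `a` by gluing the marked
input and the marked output. -/
inductive IsContraction {I X Y : Type} [Finite X] [Finite Y] (f : X ⊕ Fin 1 → I)
    (g : Y ⊕ Fin 1 → I) (a : ∀ i, M.ev (Fib f i) (Fib g i)) : M.sym.ev X Y → Prop
  | trace {K A B P Q : Type} [Finite K] [Finite A] [Finite B] [Finite P] [Finite Q] (i : I)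
      (u : M.ev (A ⊕ Fin 1) (B ⊕ Fin 1)) (f' : P → K) (g' : Q → K)
      (b : ∀ i, M.ev (Fib f' i) (Fib g' i)) (ε : K → I) (e : (A ⊕ Fin 1) ⊕ P ≃ X ⊕ Fin 1)
      (e' : (B ⊕ Fin 1) ⊕ Q ≃ Y ⊕ Fin 1) (h : M.IsConsFam f g a i u f' g' b ε e e')
      (t : A ⊕ P ≃ X) (t' : B ⊕ Q ≃ Y)
      (ht : ∀ x, e ((sumRot A (Fin 1) P).symm x) = Equiv.sumCongr t (Equiv.refl (Fin 1)) x)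
      (ht' : ∀ x, e' ((sumRot B (Fin 1) Q).symm x) = Equiv.sumCongr t' (Equiv.refl (Fin 1)) x) :
      IsContraction f g a (M.sym.act t t' (M.symCons (E.trace u) (M.symMkI f' g' b)))
  | pair {K L A B C D P Q P' Q' : Type} [Finite K] [Finite L] [Finite A] [Finite B] [Finite C]
      [Finite D] [Finite P] [Finite Q] [Finite P'] [Finite Q'] (i : I)
      (u : M.ev (A ⊕ Fin 1) B) (f' : P → K) (g' : Q → K)
      (b : ∀ i, M.ev (Fib f' i) (Fib g' i)) (ε : K → I) (e : (A ⊕ Fin 1) ⊕ P ≃ X ⊕ Fin 1)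
      (e' : B ⊕ Q ≃ Y ⊕ Fin 1) (h : M.IsConsFam f g a i u f' g' b ε e e')
      (j : K) (v : M.ev C (D ⊕ Fin 1)) (f'' : P' → L) (g'' : Q' → L)
      (c : ∀ i, M.ev (Fib f'' i) (Fib g'' i)) (ε' : L → K) (d : C ⊕ P' ≃ P)
      (d' : (D ⊕ Fin 1) ⊕ Q' ≃ Q) (h' : M.IsConsFam f' g' b j v f'' g'' c ε' d d')
      (t : (A ⊕ C) ⊕ P' ≃ X) (t' : (B ⊕ D) ⊕ Q' ≃ Y)
      (ht : ∀ x, e (Equiv.sumCongr (Equiv.refl _) d ((sumPullOut' A C P').symm x)) =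
        Equiv.sumCongr t (Equiv.refl (Fin 1)) x)
      (ht' : ∀ x, e' (Equiv.sumCongr (Equiv.refl _) d' ((sumPullOut B D Q').symm x)) =
        Equiv.sumCongr t' (Equiv.refl (Fin 1)) x) :
      IsContraction f g a (M.sym.act t t' (M.symCons (E.pair u v) (M.symMkI f'' g'' c)))

variable {E}

/-- Whether the two marked points carry the same label decides which constructor applies, and
isomorphic families agree on this. For a given constructor, `IsConsFam.unique` supplies isomorphisms
of the pieces that preserve the marked points, and naturality of `trace` or `pair` carries one
result to the other. With `ρ` a permutation of labels this gives symmetric invariance; with `χ` and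
`υ` arbitrary it gives naturality. -/
theorem IsContraction.unique {I X Y : Type} [Finite X] [Finite Y] {f : X ⊕ Fin 1 → I}
    {g : Y ⊕ Fin 1 → I} {a : ∀ i, M.ev (Fib f i) (Fib g i)} {r : M.sym.ev X Y}
    (h : E.IsContraction f g a r)
    {I₂ X₂ Y₂ : Type} [Finite X₂] [Finite Y₂] {f₂ : X₂ ⊕ Fin 1 → I₂}
    {g₂ : Y₂ ⊕ Fin 1 → I₂} {a₂ : ∀ i, M.ev (Fib f₂ i) (Fib g₂ i)} {r₂ : M.sym.ev X₂ Y₂}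
    (h₂ : E.IsContraction f₂ g₂ a₂ r₂) {χ : X ≃ X₂} {υ : Y ≃ Y₂} {ρ : I ≃ I₂}
    (ha : M.IsFamIso f g a f₂ g₂ a₂ (Equiv.sumCongr χ (Equiv.refl (Fin 1)))
      (Equiv.sumCongr υ (Equiv.refl (Fin 1))) ρ) : r₂ = M.sym.act χ υ r := by
  have hl : f₂ (Sum.inr 0) = ρ (f (Sum.inr 0)) := ha.left (Sum.inr 0)
  have hr : g₂ (Sum.inr 0) = ρ (g (Sum.inr 0)) := ha.right (Sum.inr 0)
  cases h with
  | trace i u f' g' b ε e e' h t t' ht ht' =>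
    have h1 : e (Sum.inl (Sum.inr 0)) = Sum.inr 0 := ht (Sum.inr 0)
    have h1' : e' (Sum.inl (Sum.inr 0)) = Sum.inr 0 := ht' (Sum.inr 0)
    have hi : f (Sum.inr 0) = i := by rw [← h1]; exact h.left_inl _
    have hi' : g (Sum.inr 0) = i := by rw [← h1']; exact h.right_inl _
    cases h₂ with
    | trace i₂ u₂ f₂' g₂' b₂ ε₂ e₂ e₂' h₂ t₂ t₂' ht₂ ht₂' =>
      have h2 : e₂ (Sum.inl (Sum.inr 0)) = Sum.inr 0 := ht₂ (Sum.inr 0)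
      have h2' : e₂' (Sum.inl (Sum.inr 0)) = Sum.inr 0 := ht₂' (Sum.inr 0)
      have hi₂ : f₂ (Sum.inr 0) = i₂ := by rw [← h2]; exact h₂.left_inl _
      obtain ⟨α, β, π, κ, τ, hα, hβ, hπ, hκ, -, rfl, hb⟩ :=
        h.unique h₂ ha (by rw [← hi, ← hi₂, hl])
      obtain ⟨α, rfl⟩ := exists_sumCongr_one α
        (Sum.inl_injective (e₂.injective (by rw [hα, h1, h2]; rfl)))
      obtain ⟨β, rfl⟩ := exists_sumCongr_one β
        (Sum.inl_injective (e₂'.injective (by rw [hβ, h1', h2']; rfl)))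
      rw [E.trace_act, ← hb.act_symMkI, M.symCons_act, M.sym.act_act, M.sym.act_act]
      apply M.sym.act_congr
      · rintro (x | x) <;> apply Sum.inl_injective (β := Fin 1)
        · exact (ht₂ (Sum.inl (Sum.inl (α x)))).symm.trans ((hα (Sum.inl x)).trans
            (congrArg (Equiv.sumCongr χ (Equiv.refl (Fin 1))) (ht (Sum.inl (Sum.inl x)))))
        · exact (ht₂ (Sum.inl (Sum.inr (π x)))).symm.trans ((hπ x).trans
            (congrArg (Equiv.sumCongr χ (Equiv.refl (Fin 1))) (ht (Sum.inl (Sum.inr x)))))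
      · rintro (x | x) <;> apply Sum.inl_injective (β := Fin 1)
        · exact (ht₂' (Sum.inl (Sum.inl (β x)))).symm.trans ((hβ (Sum.inl x)).trans
            (congrArg (Equiv.sumCongr υ (Equiv.refl (Fin 1))) (ht' (Sum.inl (Sum.inl x)))))
        · exact (ht₂' (Sum.inl (Sum.inr (κ x)))).symm.trans ((hκ x).trans
            (congrArg (Equiv.sumCongr υ (Equiv.refl (Fin 1))) (ht' (Sum.inl (Sum.inr x)))))
    | pair i₂ u₂ f₂' g₂' b₂ ε₂ e₂ e₂' h₂ j₂ v₂ f₂'' g₂'' c₂ ε₂' d₂ d₂' h₂' t₂ t₂' ht₂ ht₂' =>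
      have h2 : e₂ (Sum.inl (Sum.inr 0)) = Sum.inr 0 := ht₂ (Sum.inr 0)
      have h2' : e₂' (Sum.inr (d₂' (Sum.inl (Sum.inr 0)))) = Sum.inr 0 := ht₂' (Sum.inr 0)
      -- The mixed case is impossible: the marked points share a label in the first family and have
      -- different labels in the second.
      rw [← h2, h₂.left_inl, hi] at hl
      rw [← h2', h₂.right_inr, hi', ← hl] at hr
      exact absurd hr (h₂.ne _)
  | pair i u f' g' b ε e e' h j v f'' g'' c ε' d d' h' t t' ht ht' =>
    have h1 : e (Sum.inl (Sum.inr 0)) = Sum.inr 0 := ht (Sum.inr 0)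
    have h1' : e' (Sum.inr (d' (Sum.inl (Sum.inr 0)))) = Sum.inr 0 := ht' (Sum.inr 0)
    have hi : f (Sum.inr 0) = i := by rw [← h1]; exact h.left_inl _
    have hi' : g (Sum.inr 0) = ε j := by rw [← h1', h.right_inr, h'.right_inl]
    cases h₂ with
    | trace i₂ u₂ f₂' g₂' b₂ ε₂ e₂ e₂' h₂ t₂ t₂' ht₂ ht₂' =>
      have h2 : e₂ (Sum.inl (Sum.inr 0)) = Sum.inr 0 := ht₂ (Sum.inr 0)
      have h2' : e₂' (Sum.inl (Sum.inr 0)) = Sum.inr 0 := ht₂' (Sum.inr 0)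
      rw [← h2, h₂.left_inl, hi] at hl
      rw [← h2', h₂.right_inl, hi', hl] at hr
      exact absurd (ρ.injective hr).symm (h.ne _)
    | pair i₂ u₂ f₂' g₂' b₂ ε₂ e₂ e₂' h₂ j₂ v₂ f₂'' g₂'' c₂ ε₂' d₂ d₂' h₂' t₂ t₂' ht₂ ht₂' =>
      have h2 : e₂ (Sum.inl (Sum.inr 0)) = Sum.inr 0 := ht₂ (Sum.inr 0)
      have h2' : e₂' (Sum.inr (d₂' (Sum.inl (Sum.inr 0)))) = Sum.inr 0 := ht₂' (Sum.inr 0)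
      have hi₂ : f₂ (Sum.inr 0) = i₂ := by rw [← h2]; exact h₂.left_inl _
      have hi₂' : g₂ (Sum.inr 0) = ε₂ j₂ := by rw [← h2', h₂.right_inr, h₂'.right_inl]
      obtain ⟨α, β, π, κ, τ, hα, hβ, hπ, hκ, hτ, rfl, hb⟩ :=
        h.unique h₂ ha (by rw [← hi, ← hi₂, hl])
      obtain ⟨α, rfl⟩ := exists_sumCongr_one α
        (Sum.inl_injective (e₂.injective (by rw [hα, h1, h2]; rfl)))
      -- The second splittings correspond because `j` and `j₂` both come from the label of the
      -- marked output, which `ρ` preserves.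
      obtain ⟨γ, δ, π', κ', τ', hγ, hδ, hπ', hκ', -, rfl, hc⟩ :=
        h'.unique h₂' hb (h₂.inj (by rw [hτ, ← hi', ← hr, hi₂']))
      obtain ⟨δ, rfl⟩ := exists_sumCongr_one δ
        (Sum.inl_injective (d₂'.injective (Sum.inr_injective (e₂'.injective (by
          rw [hδ, hκ, h1', h2']; rfl)))))
      rw [E.pair_act, ← hc.act_symMkI, M.symCons_act, M.sym.act_act, M.sym.act_act]
      apply M.sym.act_congr
      · rintro ((x | x) | x) <;> apply Sum.inl_injective (β := Fin 1)
        · exact (ht₂ (Sum.inl (Sum.inl (Sum.inl (α x))))).symm.trans ((hα (Sum.inl x)).trans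
            (congrArg (Equiv.sumCongr χ (Equiv.refl (Fin 1)))
              (ht (Sum.inl (Sum.inl (Sum.inl x))))))
        · exact (ht₂ (Sum.inl (Sum.inl (Sum.inr (γ x))))).symm.trans
            ((congrArg (fun y => e₂ (Sum.inr y)) (hγ x)).trans ((hπ _).trans
            (congrArg (Equiv.sumCongr χ (Equiv.refl (Fin 1)))
              (ht (Sum.inl (Sum.inl (Sum.inr x)))))))
        · exact (ht₂ (Sum.inl (Sum.inr (π' x)))).symm.trans
            ((congrArg (fun y => e₂ (Sum.inr y)) (hπ' x)).trans ((hπ _).trans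
            (congrArg (Equiv.sumCongr χ (Equiv.refl (Fin 1))) (ht (Sum.inl (Sum.inr x))))))
      · rintro ((x | x) | x) <;> apply Sum.inl_injective (β := Fin 1)
        · exact (ht₂' (Sum.inl (Sum.inl (Sum.inl (β x))))).symm.trans ((hβ x).trans
            (congrArg (Equiv.sumCongr υ (Equiv.refl (Fin 1)))
              (ht' (Sum.inl (Sum.inl (Sum.inl x))))))
        · exact (ht₂' (Sum.inl (Sum.inl (Sum.inr (δ x))))).symm.trans
            ((congrArg (fun y => e₂' (Sum.inr y)) (hδ (Sum.inl x))).trans ((hκ _).trans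
            (congrArg (Equiv.sumCongr υ (Equiv.refl (Fin 1)))
              (ht' (Sum.inl (Sum.inl (Sum.inr x)))))))
        · exact (ht₂' (Sum.inl (Sum.inr (κ' x)))).symm.trans
            ((congrArg (fun y => e₂' (Sum.inr y)) (hκ' x)).trans ((hκ _).trans
            (congrArg (Equiv.sumCongr υ (Equiv.refl (Fin 1))) (ht' (Sum.inl (Sum.inr x))))))

/-- The factor of the marked input is split off first. If the marked output lies elsewhere, its
factor is split off next. Each splitting is uniform in `a`, so the result is a multilinear
expression in the entries. -/
theorem exists_isContraction {I X Y : Type} [Finite I] [Finite X] [Finite Y] (f : X ⊕ Fin 1 → I)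
    (g : Y ⊕ Fin 1 → I) :
    ∃ φ : MultilinearMap k (fun i => M.ev (Fib f i) (Fib g i)) (M.sym.ev X Y),
      ∀ a, E.IsContraction f g a (φ a) := by
  obtain ⟨A, B, P, Q, K, _, _, _, _, _, f', g', ε, e, e', U, T, -, -, hc⟩ :=
    M.exists_isConsFam f g (f (Sum.inr 0))
  -- The zero family serves only to extract the combinatorial part of the splitting, which is the
  -- same for every family.
  have h0 := hc 0
  obtain ⟨x | x, hx⟩ := e.surjective (Sum.inr 0)
  swap
  · exact absurd ((h0.left_inr x).symm.trans (congrArg f hx)) (h0.ne _)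
  obtain ⟨A, _, p, rfl⟩ := exists_sum_one x
  obtain ⟨y | y, hy⟩ := e'.surjective (Sum.inr 0)
  · obtain ⟨B, _, q, rfl⟩ := exists_sum_one y
    obtain ⟨t, ht⟩ := exists_sumCongr_one ((sumRot A (Fin 1) P).symm.trans
      ((Equiv.sumCongr p (Equiv.refl P)).trans e)) hx
    obtain ⟨t', ht'⟩ := exists_sumCongr_one ((sumRot B (Fin 1) Q).symm.trans
      ((Equiv.sumCongr q (Equiv.refl Q)).trans e')) hy
    obtain ⟨R, hR⟩ := M.exists_multilinear_symMkI f' g'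
    refine ⟨multilinearPick (f (Sum.inr 0))
      ((M.symCons.compr₂ (M.sym.act t t')) ∘ₗ E.trace ∘ₗ M.act p.symm q.symm ∘ₗ U)
      (R.compLinearMap T) h0.inj h0.ne h0.surj, fun a => ?_⟩
    have := IsContraction.trace (E := E) _ _ _ _ _ _ _ _ ((hc a).act_head p q) t t'
      (Equiv.congr_fun ht) (Equiv.congr_fun ht')
    rw [← hR] at this
    exact this
  · obtain ⟨C, D, P', Q', L, _, _, _, _, _, f'', g'', ε', d, d', V, W, -, -, hc'⟩ :=
      M.exists_isConsFam f' g' (g' y)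
    have h0' := hc' 0
    obtain ⟨y', hy'⟩ := d'.surjective y
    rcases y' with y' | y'
    swap
    · exact absurd ((h0'.right_inr y').symm.trans (congrArg g' hy')) (h0'.ne _)
    obtain ⟨D, _, q, rfl⟩ := exists_sum_one y'
    obtain ⟨t, ht⟩ := exists_sumCongr_one ((sumPullOut' A C P').symm.trans
      ((Equiv.sumCongr (Equiv.refl _) d).trans ((Equiv.sumCongr p (Equiv.refl P)).trans e))) hx
    obtain ⟨t', ht'⟩ := exists_sumCongr_one ((sumPullOut B D Q').symm.trans
      ((Equiv.sumCongr (Equiv.refl _) ((Equiv.sumCongr q (Equiv.refl Q')).trans d')).trans e'))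
      ((congrArg (fun y => e' (Sum.inr y)) hy').trans hy)
    obtain ⟨R, hR⟩ := M.exists_multilinear_symMkI f'' g''
    -- The inner selection treats the second factor and the remaining product and returns a linear
    -- map in the first factor. The outer selection then evaluates this map at the first factor.
    let N : M.ev C (D ⊕ Fin 1) →ₗ[k] M.sym.ev P' Q' →ₗ[k]
        (M.ev (A ⊕ Fin 1) B →ₗ[k] M.sym.ev X Y) :=
      LinearMap.mk₂ k (fun v z => M.sym.act t t' ∘ₗ M.symCons.flip z ∘ₗ E.pair.flip v)
        (fun _ _ _ => by ext; simp) (fun _ _ _ => by ext; simp) (fun _ _ _ => by ext; simp)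
        (fun _ _ _ => by ext; simp)
    refine ⟨multilinearPick (f (Sum.inr 0))
      (LinearMap.applyₗ ∘ₗ M.act p.symm (Equiv.refl B).symm ∘ₗ U)
      (MultilinearMap.compLinearMap (multilinearPick (g' y)
        (N ∘ₗ M.act (Equiv.refl C).symm q.symm ∘ₗ V) (R.compLinearMap W)
        h0'.inj h0'.ne h0'.surj) T) h0.inj h0.ne h0.surj, fun a => ?_⟩
    have := IsContraction.pair (E := E) _ _ _ _ _ _ _ _ ((hc a).act_head p (Equiv.refl B)) _ _ _ _
      _ _ _ _ ((hc' _).act_head (Equiv.refl C) q) t t' ?_ ?_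
    · rw [← hR] at this
      exact this
    · rintro (((x | x) | x) | x)
      · exact Equiv.congr_fun ht (Sum.inl (Sum.inl (Sum.inl x)))
      · exact Equiv.congr_fun ht (Sum.inl (Sum.inl (Sum.inr x)))
      · exact Equiv.congr_fun ht (Sum.inl (Sum.inr x))
      · exact Equiv.congr_fun ht (Sum.inr x)
    · rintro (((x | x) | x) | x)
      · exact Equiv.congr_fun ht' (Sum.inl (Sum.inl (Sum.inl x)))
      · exact Equiv.congr_fun ht' (Sum.inl (Sum.inl (Sum.inr x)))
      · exact Equiv.congr_fun ht' (Sum.inl (Sum.inr x))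
      · exact Equiv.congr_fun ht' (Sum.inr x)

end EdgeStr

/-! ### The contraction of the symmetric algebra as a linear map -/

theorem FBBMod.isFamIso_permFam (F : FBBMod k) {d : ℕ} {X Y : Type} [Finite X] [Finite Y]
    (σ : Equiv.Perm (Fin d)) {f f' : X → Fin d} {g g' : Y → Fin d}
    (hf : ∀ x, f' x = σ (f x)) (hg : ∀ y, g' y = σ (g y)) (a : ∀ i, F.ev (Fib f i) (Fib g i)) :
    F.IsFamIso f g a f' g' (F.permFam σ hf hg a) (Equiv.refl X) (Equiv.refl Y) σ :=
  ⟨hf, hg, fun i p p' hp hp' => by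
    rw [F.permFam_apply σ hf hg a (σ i) i rfl]
    exact F.act_congr (fun x => Subtype.ext (hp x).symm) (fun x => Subtype.ext (hp' x).symm) _⟩

theorem FBBMod.isFamIso_refl (F : FBBMod k) {I X Y : Type} [Finite X] [Finite Y]
    (f : X → I) (g : Y → I) (a : ∀ i, F.ev (Fib f i) (Fib g i)) :
    F.IsFamIso f g a f g a (Equiv.refl X) (Equiv.refl Y) (Equiv.refl I) :=
  ⟨fun _ => rfl, fun _ => rfl, fun _ p p' hp hp' => F.fam_congr a rfl p p' hp hp'⟩

namespace EdgeStr

variable {M : FBBMod k} (E : EdgeStr M)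

/-- The contraction of `S*M`. -/
noncomputable def contract (X Y : Type) [Finite X] [Finite Y] :
    M.sym.ev (X ⊕ Fin 1) (Y ⊕ Fin 1) →ₗ[k] M.sym.ev X Y :=
  M.symLift (V := M.sym.ev X Y)
    (fun _ f g => PiTensorProduct.lift (Classical.choose (E.exists_isContraction f g)))
    (by
      intro d σ f f' g g' hf hg a
      rw [PiTensorProduct.lift.tprod, PiTensorProduct.lift.tprod]
      -- A permutation of the labels is an isomorphism of families that is the identity on points,
      -- so uniqueness gives invariance under the symmetric group.
      have h := M.isFamIso_permFam σ hf hg a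
      rw [← Equiv.sumCongr_refl, ← Equiv.sumCongr_refl] at h
      have := (Classical.choose_spec (E.exists_isContraction f g) a).unique
        (Classical.choose_spec (E.exists_isContraction f' g') _) h
      rw [this, M.sym.act_refl])

variable {E}

/-- By uniqueness the multilinear map chosen in the definition is irrelevant, so `contract` may be
computed from any convenient splitting. -/
theorem IsContraction.contract_eq {X Y : Type} [Finite X] [Finite Y] {d : ℕ}
    {f : X ⊕ Fin 1 → Fin d} {g : Y ⊕ Fin 1 → Fin d} {a : ∀ i, M.ev (Fib f i) (Fib g i)}
    {r : M.sym.ev X Y} (h : E.IsContraction f g a r) : E.contract X Y (M.symMkI f g a) = r := by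
  have h1 : E.contract X Y (M.symMkI f g a) =
      Classical.choose (E.exists_isContraction f g) a := by
    rw [M.symMkI_fin]
    refine (M.symLift_mk _ _ f g a).trans ?_
    rw [PiTensorProduct.lift.tprod]
  have h2 := M.isFamIso_refl f g a
  rw [← Equiv.sumCongr_refl, ← Equiv.sumCongr_refl] at h2
  rw [h1, h.unique (Classical.choose_spec (E.exists_isContraction f g) a) h2, M.sym.act_refl]

variable (E)

theorem contract_act {X Y X' Y' : Type} [Finite X] [Finite Y] [Finite X'] [Finite Y'] (e : X ≃ X')
    (e' : Y ≃ Y') (z : M.sym.ev (X ⊕ Fin 1) (Y ⊕ Fin 1)) :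
    E.contract X' Y' (M.sym.act (Equiv.sumCongr e (Equiv.refl (Fin 1)))
      (Equiv.sumCongr e' (Equiv.refl (Fin 1))) z) = M.sym.act e e' (E.contract X Y z) := by
  refine LinearMap.congr_fun (f := E.contract X' Y' ∘ₗ M.sym.act _ _)
    (g := M.sym.act e e' ∘ₗ E.contract X Y) (M.sym_hom_ext fun d f g a => ?_) z
  have h : M.IsFamIso f g a (f ∘ (Equiv.sumCongr e (Equiv.refl (Fin 1))).symm)
      (g ∘ (Equiv.sumCongr e' (Equiv.refl (Fin 1))).symm)
      (fun i => M.act (fibMap (Equiv.sumCongr e (Equiv.refl (Fin 1))) f i)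
        (fibMap (Equiv.sumCongr e' (Equiv.refl (Fin 1))) g i) (a i))
      (Equiv.sumCongr e (Equiv.refl (Fin 1))) (Equiv.sumCongr e' (Equiv.refl (Fin 1)))
      (Equiv.refl _) :=
    ⟨fun x => congrArg f (Equiv.symm_apply_apply _ x),
      fun x => congrArg g (Equiv.symm_apply_apply _ x), fun i p p' hp hp' =>
      M.act_congr (fun x => Subtype.ext (hp x).symm) (fun x => Subtype.ext (hp' x).symm) _⟩
  obtain ⟨φ, hφ⟩ := E.exists_isContraction f g
  obtain ⟨ψ, hψ⟩ := E.exists_isContraction (f ∘ (Equiv.sumCongr e (Equiv.refl (Fin 1))).symm)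
      (g ∘ (Equiv.sumCongr e' (Equiv.refl (Fin 1))).symm)
  rw [LinearMap.comp_apply, LinearMap.comp_apply, h.act_symMkI, (hφ a).contract_eq,
    (hψ _).contract_eq, (hφ a).unique (hψ _) h]

/-- The contraction of `S*M` as a natural family of maps. -/
noncomputable def contraction : Contraction M.sym where
  c := fun X Y _ _ => E.contract X Y
  act := E.contract_act

theorem contract_trace {X Y A B P Q : Type} [Finite X] [Finite Y] [Finite A] [Finite B] [Finite P]
    [Finite Q] (u : M.ev (A ⊕ Fin 1) (B ⊕ Fin 1)) (z : M.sym.ev P Q)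
    {e : (A ⊕ Fin 1) ⊕ P ≃ X ⊕ Fin 1} {e' : (B ⊕ Fin 1) ⊕ Q ≃ Y ⊕ Fin 1} {t : A ⊕ P ≃ X}
    {t' : B ⊕ Q ≃ Y}
    (ht : ∀ x, e ((sumRot A (Fin 1) P).symm x) = Equiv.sumCongr t (Equiv.refl (Fin 1)) x)
    (ht' : ∀ x, e' ((sumRot B (Fin 1) Q).symm x) = Equiv.sumCongr t' (Equiv.refl (Fin 1)) x) :
    E.contract X Y (M.sym.act e e' (M.symCons u z)) =
      M.sym.act t t' (M.symCons (E.trace u) z) := by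
  refine LinearMap.congr_fun (f := E.contract X Y ∘ₗ M.sym.act e e' ∘ₗ M.symCons u)
    (g := M.sym.act t t' ∘ₗ M.symCons (E.trace u)) (M.sym_hom_ext fun d r s b => ?_) z
  obtain ⟨f, g, a, ha, h⟩ := M.act_symCons_symMkI u r s b e e'
  simp only [LinearMap.comp_apply]
  rw [h]
  exact (IsContraction.trace _ _ _ _ _ _ _ _ ha t t' ht ht').contract_eq

/-- On pure tensors the product with `v` and then with `u` exhibits two successive splittings, which
are the data required by `IsContraction.pair`. -/
theorem contract_pair {X Y A B C D P Q : Type} [Finite X] [Finite Y] [Finite A] [Finite B]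
    [Finite C] [Finite D] [Finite P] [Finite Q] (u : M.ev (A ⊕ Fin 1) B) (v : M.ev C (D ⊕ Fin 1))
    (z : M.sym.ev P Q)
    {e : (A ⊕ Fin 1) ⊕ (C ⊕ P) ≃ X ⊕ Fin 1} {e' : B ⊕ ((D ⊕ Fin 1) ⊕ Q) ≃ Y ⊕ Fin 1}
    {t : (A ⊕ C) ⊕ P ≃ X} {t' : (B ⊕ D) ⊕ Q ≃ Y}
    (ht : ∀ x, e ((sumPullOut' A C P).symm x) = Equiv.sumCongr t (Equiv.refl (Fin 1)) x)
    (ht' : ∀ x, e' ((sumPullOut B D Q).symm x) = Equiv.sumCongr t' (Equiv.refl (Fin 1)) x) :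
    E.contract X Y (M.sym.act e e' (M.symCons u (M.symCons v z))) =
      M.sym.act t t' (M.symCons (E.pair u v) z) := by
  refine LinearMap.congr_fun (f := E.contract X Y ∘ₗ M.sym.act e e' ∘ₗ M.symCons u ∘ₗ M.symCons v)
    (g := M.sym.act t t' ∘ₗ M.symCons (E.pair u v)) (M.sym_hom_ext fun d r s b => ?_) z
  obtain ⟨f, g, a, ha, h⟩ := M.act_symCons_symMkI v r s b (Equiv.refl _) (Equiv.refl _)
  obtain ⟨f', g', a', ha', h'⟩ := M.act_symCons_symMkI u f g a e e'
  simp only [LinearMap.comp_apply]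
  rw [M.sym.act_refl] at h
  rw [h, h']
  refine (IsContraction.pair _ _ _ _ _ _ _ _ ha' _ _ _ _ _ _ _ _ ha t t' (fun x => ?_)
    (fun x => ?_)).contract_eq
  · rw [Equiv.sumCongr_refl]
    exact ht x
  · rw [Equiv.sumCongr_refl]
    exact ht' x

/-- Contraction of an input and an output of the generator `w`, a relabelling of `u`. -/
theorem exists_contract_trace {X Y A B P Q A₀ B₀ : Type} [Finite X] [Finite Y] [Finite A]
    [Finite B] [Finite P] [Finite Q] [Finite A₀] [Finite B₀] (p : A ⊕ Fin 1 ≃ A₀)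
    (q : B ⊕ Fin 1 ≃ B₀) (u : M.ev (A ⊕ Fin 1) (B ⊕ Fin 1)) {w : M.ev A₀ B₀} (hw : w = M.act p q u)
    (z : M.sym.ev P Q) (e : A₀ ⊕ P ≃ X ⊕ Fin 1) (e' : B₀ ⊕ Q ≃ Y ⊕ Fin 1)
    (he : e (Sum.inl (p (Sum.inr 0))) = Sum.inr 0)
    (he' : e' (Sum.inl (q (Sum.inr 0))) = Sum.inr 0) :
    ∃ (t : A ⊕ P ≃ X) (t' : B ⊕ Q ≃ Y),
      (∀ x, e (Sum.inl (p (Sum.inl x))) = Sum.inl (t (Sum.inl x))) ∧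
      (∀ x, e (Sum.inr x) = Sum.inl (t (Sum.inr x))) ∧
      (∀ x, e' (Sum.inl (q (Sum.inl x))) = Sum.inl (t' (Sum.inl x))) ∧
      (∀ x, e' (Sum.inr x) = Sum.inl (t' (Sum.inr x))) ∧
      E.contract X Y (M.sym.act e e' (M.symCons w z)) =
        M.sym.act t t' (M.symCons (E.trace u) z) := by
  -- After relabelling, `e` preserves the marked point, so it restricts to the complements. The
  -- equations recorded for `t` locate every remaining point, which is what is needed to compare two
  -- orders of contraction.
  obtain ⟨t, ht⟩ := exists_sumCongr_one ((sumRot A (Fin 1) P).symm.trans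
      ((Equiv.sumCongr p (Equiv.refl P)).trans e)) he
  obtain ⟨t', ht'⟩ := exists_sumCongr_one ((sumRot B (Fin 1) Q).symm.trans
      ((Equiv.sumCongr q (Equiv.refl Q)).trans e')) he'
  refine ⟨t, t', fun x => Equiv.congr_fun ht (Sum.inl (Sum.inl x)),
    fun x => Equiv.congr_fun ht (Sum.inl (Sum.inr x)),
    fun x => Equiv.congr_fun ht' (Sum.inl (Sum.inl x)),
    fun x => Equiv.congr_fun ht' (Sum.inl (Sum.inr x)), ?_⟩
  rw [hw, M.symCons_act_left, M.sym.act_act]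
  exact E.contract_trace u z (Equiv.congr_fun ht) (Equiv.congr_fun ht')

/-- Contraction of an input of the generator `w` and an output of the generator `w'`, which are
relabellings of `u` and `v`. -/
theorem exists_contract_pair {X Y A B C D P Q A₀ B₀ C₀ D₀ : Type} [Finite X] [Finite Y] [Finite A]
    [Finite B] [Finite C] [Finite D] [Finite P] [Finite Q] [Finite A₀] [Finite B₀] [Finite C₀]
    [Finite D₀] (p : A ⊕ Fin 1 ≃ A₀) (q : B ≃ B₀) (r : C ≃ C₀) (s : D ⊕ Fin 1 ≃ D₀)
    (u : M.ev (A ⊕ Fin 1) B) {w : M.ev A₀ B₀} (hw : w = M.act p q u)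
    (v : M.ev C (D ⊕ Fin 1)) {w' : M.ev C₀ D₀} (hw' : w' = M.act r s v)
    (z : M.sym.ev P Q) (e : A₀ ⊕ (C₀ ⊕ P) ≃ X ⊕ Fin 1) (e' : B₀ ⊕ (D₀ ⊕ Q) ≃ Y ⊕ Fin 1)
    (he : e (Sum.inl (p (Sum.inr 0))) = Sum.inr 0)
    (he' : e' (Sum.inr (Sum.inl (s (Sum.inr 0)))) = Sum.inr 0) :
    ∃ (t : (A ⊕ C) ⊕ P ≃ X) (t' : (B ⊕ D) ⊕ Q ≃ Y),
      (∀ x, e (Sum.inl (p (Sum.inl x))) = Sum.inl (t (Sum.inl (Sum.inl x)))) ∧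
      (∀ x, e (Sum.inr (Sum.inl (r x))) = Sum.inl (t (Sum.inl (Sum.inr x)))) ∧
      (∀ x, e (Sum.inr (Sum.inr x)) = Sum.inl (t (Sum.inr x))) ∧
      (∀ x, e' (Sum.inl (q x)) = Sum.inl (t' (Sum.inl (Sum.inl x)))) ∧
      (∀ x, e' (Sum.inr (Sum.inl (s (Sum.inl x)))) = Sum.inl (t' (Sum.inl (Sum.inr x)))) ∧
      (∀ x, e' (Sum.inr (Sum.inr x)) = Sum.inl (t' (Sum.inr x))) ∧
      E.contract X Y (M.sym.act e e' (M.symCons w (M.symCons w' z))) =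
        M.sym.act t t' (M.symCons (E.pair u v) z) := by
  obtain ⟨t, ht⟩ := exists_sumCongr_one ((sumPullOut' A C P).symm.trans
      ((Equiv.sumCongr p (Equiv.sumCongr r (Equiv.refl P))).trans e)) he
  obtain ⟨t', ht'⟩ := exists_sumCongr_one ((sumPullOut B D Q).symm.trans
      ((Equiv.sumCongr q (Equiv.sumCongr s (Equiv.refl Q))).trans e')) he'
  refine ⟨t, t', fun x => Equiv.congr_fun ht (Sum.inl (Sum.inl (Sum.inl x))),
    fun x => Equiv.congr_fun ht (Sum.inl (Sum.inl (Sum.inr x))),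
    fun x => Equiv.congr_fun ht (Sum.inl (Sum.inr x)),
    fun x => Equiv.congr_fun ht' (Sum.inl (Sum.inl (Sum.inl x))),
    fun x => Equiv.congr_fun ht' (Sum.inl (Sum.inl (Sum.inr x))),
    fun x => Equiv.congr_fun ht' (Sum.inl (Sum.inr x)), ?_⟩
  rw [hw, hw', M.symCons_act_left r s, M.symCons_act, M.sym.act_act]
  exact E.contract_pair u v z (Equiv.congr_fun ht) (Equiv.congr_fun ht')

end EdgeStr

/-! ### Marked products, and linearity of the contraction over unmarked factors -/

/-- A linear map on `S*F(X ⨿ 1, Y ⨿ 1)` is determined by its values on products in which the two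
marked elements belong to the first one or to the first two factors. -/
theorem FBBMod.sym_ext_marked (F : FBBMod k) {X Y : Type} [Finite X] [Finite Y]
    {V : Type u} [AddCommGroup V] [Module k V] {φ ψ : F.sym.ev (X ⊕ Fin 1) (Y ⊕ Fin 1) →ₗ[k] V}
    (h : ∀ (A B P Q : Type) [Finite A] [Finite B] [Finite P] [Finite Q]
      (t : A ⊕ P ≃ X) (t' : B ⊕ Q ≃ Y) (u : F.ev (A ⊕ Fin 1) (B ⊕ Fin 1)) (z : F.sym.ev P Q),
      φ (F.sym.act ((sumRot A (Fin 1) P).trans (Equiv.sumCongr t (Equiv.refl (Fin 1))))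
        ((sumRot B (Fin 1) Q).trans (Equiv.sumCongr t' (Equiv.refl (Fin 1)))) (F.symCons u z)) =
      ψ (F.sym.act ((sumRot A (Fin 1) P).trans (Equiv.sumCongr t (Equiv.refl (Fin 1))))
        ((sumRot B (Fin 1) Q).trans (Equiv.sumCongr t' (Equiv.refl (Fin 1)))) (F.symCons u z)))
    (h' : ∀ (A B C D P Q : Type) [Finite A] [Finite B] [Finite C] [Finite D] [Finite P] [Finite Q]
      (t : (A ⊕ C) ⊕ P ≃ X) (t' : (B ⊕ D) ⊕ Q ≃ Y) (u : F.ev (A ⊕ Fin 1) B)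
      (v : F.ev C (D ⊕ Fin 1)) (z : F.sym.ev P Q),
      φ (F.sym.act ((sumPullOut' A C P).trans (Equiv.sumCongr t (Equiv.refl (Fin 1))))
        ((sumPullOut B D Q).trans (Equiv.sumCongr t' (Equiv.refl (Fin 1))))
        (F.symCons u (F.symCons v z))) =
      ψ (F.sym.act ((sumPullOut' A C P).trans (Equiv.sumCongr t (Equiv.refl (Fin 1))))
        ((sumPullOut B D Q).trans (Equiv.sumCongr t' (Equiv.refl (Fin 1))))
        (F.symCons u (F.symCons v z))))
    (z : F.sym.ev (X ⊕ Fin 1) (Y ⊕ Fin 1)) : φ z = ψ z := by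
  refine F.sym_ext_left (Sum.inr 0) (fun A B P Q _ _ _ _ e e' u z he => ?_) z
  -- The factor of the marked input is already in front. The marked output either lies in it or
  -- belongs to the rest, in which case a second factor is extracted.
  obtain ⟨y | y, hy⟩ := e'.surjective (Sum.inr 0)
  · obtain ⟨B, _, q, u, rfl, rfl⟩ := F.exists_act_right u y
    obtain ⟨t, ht⟩ := exists_sumCongr_one ((sumRot A (Fin 1) P).symm.trans e) he
    obtain ⟨t', ht'⟩ := exists_sumCongr_one ((sumRot B (Fin 1) Q).symm.trans
      ((Equiv.sumCongr q (Equiv.refl Q)).trans e')) hy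
    have := h _ _ _ _ t t' u z
    rw [← ht, ← ht', ← Equiv.trans_assoc, ← Equiv.trans_assoc, Equiv.self_trans_symm,
      Equiv.self_trans_symm, Equiv.refl_trans, Equiv.refl_trans] at this
    rw [F.symCons_act_left, F.sym.act_act, Equiv.sumCongr_refl, Equiv.refl_trans]
    exact this
  · refine F.sym_ext_right y (φ := φ ∘ₗ F.sym.act e e' ∘ₗ F.symCons u)
      (ψ := ψ ∘ₗ F.sym.act e e' ∘ₗ F.symCons u) (fun C D P' Q' _ _ _ _ d d' v z hd => ?_) z
    obtain ⟨t, ht⟩ := exists_sumCongr_one ((sumPullOut' A C P').symm.trans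
      ((Equiv.sumCongr (Equiv.refl _) d).trans e)) he
    obtain ⟨t', ht'⟩ := exists_sumCongr_one ((sumPullOut B D Q').symm.trans
      ((Equiv.sumCongr (Equiv.refl _) d').trans e')) (by rw [← hy, ← hd]; rfl)
    have h₁ : (sumPullOut' A C P').trans (Equiv.sumCongr t (Equiv.refl (Fin 1))) =
        (Equiv.sumCongr (Equiv.refl _) d).trans e := by
      rw [← ht, ← Equiv.trans_assoc, Equiv.self_trans_symm, Equiv.refl_trans]
    have h₂ : (sumPullOut B D Q').trans (Equiv.sumCongr t' (Equiv.refl (Fin 1))) =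
        (Equiv.sumCongr (Equiv.refl _) d').trans e' := by
      rw [← ht', ← Equiv.trans_assoc, Equiv.self_trans_symm, Equiv.refl_trans]
    have := h' _ _ _ _ _ _ t t' u v z
    rw [h₁, h₂] at this
    simp only [LinearMap.comp_apply]
    rw [F.symCons_act_right, F.sym.act_act]
    exact this

/-- The points that survive both contractions are not moved by the exchange of the two marked
points. This shows, point by point, that both orders induce the same relabelling. -/
theorem sumRot_inl_inl {X W : Type} (E : W ≃ (X ⊕ Fin 1) ⊕ Fin 1) {w : W} {x y : X}
    (h : (E.trans (sumRot X (Fin 1) (Fin 1))) w = Sum.inl (Sum.inl x))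
    (h' : E w = Sum.inl (Sum.inl y)) : x = y := by
  rw [Equiv.trans_apply, h'] at h
  exact (Sum.inl_injective (Sum.inl_injective h)).symm

namespace EdgeStr

variable {M : FBBMod k} (E : EdgeStr M)

/-- It suffices to treat a `z` whose marked points lie in its leading factors. Commutativity moves
`m` behind them, the rule for a loop or for an edge applies, and `m` is moved back. -/
theorem contract_symCons {A B P Q : Type} [Finite A] [Finite B] [Finite P] [Finite Q]
    (m : M.ev A B) (z : M.sym.ev (P ⊕ Fin 1) (Q ⊕ Fin 1)) :
    E.contract (A ⊕ P) (B ⊕ Q) (M.sym.act (Equiv.sumAssoc A P (Fin 1)).symm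
      (Equiv.sumAssoc B Q (Fin 1)).symm (M.symCons m z)) = M.symCons m (E.contract P Q z) := by
  refine M.sym_ext_marked (φ := E.contract (A ⊕ P) (B ⊕ Q) ∘ₗ M.sym.act _ _ ∘ₗ M.symCons m)
    (ψ := M.symCons m ∘ₗ E.contract P Q) (fun A' B' P' Q' _ _ _ _ t t' u z => ?_)
    (fun A' B' C' D' P' Q' _ _ _ _ _ _ t t' u v z => ?_) z
  · simp only [LinearMap.comp_apply]
    rw [E.contract_trace u z (t := t) (t' := t') (fun x => by simp) (fun x => by simp),
      M.symCons_act_right, M.symCons_act_right, M.symCons_comm m u,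
      M.symCons_comm m (E.trace u), M.sym.act_act, M.sym.act_act, M.sym.act_act]
    obtain ⟨τ, τ', h1, h2, h3, h4, h⟩ := E.exists_contract_trace (Equiv.refl _) (Equiv.refl _) u
      (M.act_refl u).symm (M.symCons m z)
      ((sumLeftComm (A' ⊕ Fin 1) A P').trans
        ((Equiv.sumCongr (Equiv.refl A) ((sumRot A' (Fin 1) P').trans
          (Equiv.sumCongr t (Equiv.refl (Fin 1))))).trans (Equiv.sumAssoc A P (Fin 1)).symm))
      ((sumLeftComm (B' ⊕ Fin 1) B Q').trans
        ((Equiv.sumCongr (Equiv.refl B) ((sumRot B' (Fin 1) Q').trans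
          (Equiv.sumCongr t' (Equiv.refl (Fin 1))))).trans (Equiv.sumAssoc B Q (Fin 1)).symm))
      rfl rfl
    refine h.trans (M.sym.act_congr ?_ ?_ _)
    · rintro (x | x | x) <;> apply Sum.inl_injective (β := Fin 1)
      · exact (h1 _).symm
      · exact (h2 _).symm
      · exact (h2 _).symm
    · rintro (x | x | x) <;> apply Sum.inl_injective (β := Fin 1)
      · exact (h3 _).symm
      · exact (h4 _).symm
      · exact (h4 _).symm
  · simp only [LinearMap.comp_apply]
    rw [E.contract_pair u v z (t := t) (t' := t') (fun x => by simp) (fun x => by simp),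
      M.symCons_act_right, M.symCons_act_right, M.symCons_comm m u, M.symCons_comm m v,
      M.symCons_comm m (E.pair u v), M.symCons_act_right, M.sym.act_act, M.sym.act_act,
      M.sym.act_act, M.sym.act_act]
    obtain ⟨τ, τ', h1, h2, h3, h4, h5, h6, h⟩ := E.exists_contract_pair (Equiv.refl _)
      (Equiv.refl _) (Equiv.refl _) (Equiv.refl _) u (M.act_refl u).symm v (M.act_refl v).symm
      (M.symCons m z)
      ((Equiv.sumCongr (Equiv.refl (A' ⊕ Fin 1)) (sumLeftComm C' A P')).trans
        ((sumLeftComm (A' ⊕ Fin 1) A (C' ⊕ P')).trans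
        ((Equiv.sumCongr (Equiv.refl A) ((sumPullOut' A' C' P').trans
          (Equiv.sumCongr t (Equiv.refl (Fin 1))))).trans (Equiv.sumAssoc A P (Fin 1)).symm)))
      ((Equiv.sumCongr (Equiv.refl B') (sumLeftComm (D' ⊕ Fin 1) B Q')).trans
        ((sumLeftComm B' B ((D' ⊕ Fin 1) ⊕ Q')).trans
        ((Equiv.sumCongr (Equiv.refl B) ((sumPullOut B' D' Q').trans
          (Equiv.sumCongr t' (Equiv.refl (Fin 1))))).trans (Equiv.sumAssoc B Q (Fin 1)).symm)))
      rfl rfl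
    refine h.trans (M.sym.act_congr ?_ ?_ _)
    · rintro ((x | x) | x | x) <;> apply Sum.inl_injective (β := Fin 1)
      · exact (h1 _).symm
      · exact (h2 _).symm
      · exact (h3 _).symm
      · exact (h3 _).symm
    · rintro ((x | x) | x | x) <;> apply Sum.inl_injective (β := Fin 1)
      · exact (h4 _).symm
      · exact (h5 _).symm
      · exact (h6 _).symm
      · exact (h6 _).symm

/-- Contraction of an input and an output of the second factor of a product. -/
theorem exists_contract_symCons {X Y A B P Q P₀ Q₀ : Type} [Finite X] [Finite Y] [Finite A]
    [Finite B] [Finite P] [Finite Q] [Finite P₀] [Finite Q₀] (p : P ⊕ Fin 1 ≃ P₀)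
    (q : Q ⊕ Fin 1 ≃ Q₀) (m : M.ev A B) (z : M.sym.ev (P ⊕ Fin 1) (Q ⊕ Fin 1)) {w : M.sym.ev P₀ Q₀}
    (hw : w = M.sym.act p q z) (e : A ⊕ P₀ ≃ X ⊕ Fin 1) (e' : B ⊕ Q₀ ≃ Y ⊕ Fin 1)
    (he : e (Sum.inr (p (Sum.inr 0))) = Sum.inr 0)
    (he' : e' (Sum.inr (q (Sum.inr 0))) = Sum.inr 0) :
    ∃ (t : A ⊕ P ≃ X) (t' : B ⊕ Q ≃ Y),
      (∀ x, e (Sum.inl x) = Sum.inl (t (Sum.inl x))) ∧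
      (∀ x, e (Sum.inr (p (Sum.inl x))) = Sum.inl (t (Sum.inr x))) ∧
      (∀ x, e' (Sum.inl x) = Sum.inl (t' (Sum.inl x))) ∧
      (∀ x, e' (Sum.inr (q (Sum.inl x))) = Sum.inl (t' (Sum.inr x))) ∧
      E.contract X Y (M.sym.act e e' (M.symCons m w)) =
        M.sym.act t t' (M.symCons m (E.contract P Q z)) := by
  obtain ⟨t, ht⟩ := exists_sumCongr_one ((Equiv.sumAssoc A P (Fin 1)).trans
      ((Equiv.sumCongr (Equiv.refl A) p).trans e)) he
  obtain ⟨t', ht'⟩ := exists_sumCongr_one ((Equiv.sumAssoc B Q (Fin 1)).trans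
      ((Equiv.sumCongr (Equiv.refl B) q).trans e')) he'
  refine ⟨t, t', fun x => Equiv.congr_fun ht (Sum.inl (Sum.inl x)),
    fun x => Equiv.congr_fun ht (Sum.inl (Sum.inr x)),
    fun x => Equiv.congr_fun ht' (Sum.inl (Sum.inl x)),
    fun x => Equiv.congr_fun ht' (Sum.inl (Sum.inr x)), ?_⟩
  rw [← E.contract_symCons, ← E.contract_act, ← ht, ← ht', hw, M.symCons_act_right, M.sym.act_act,
    M.sym.act_act]
  exact congrArg _ (M.sym.act_congr (fun x => by simp) (fun x => by simp) _)

/-! ### Exchange of two contractions, one configuration at a time -/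

/-- The two successive contractions of `act e e' z` may be exchanged. -/
def Exchange {X Y W W' : Type} [Finite X] [Finite Y] [Finite W] [Finite W']
    (e : W ≃ (X ⊕ Fin 1) ⊕ Fin 1) (e' : W' ≃ (Y ⊕ Fin 1) ⊕ Fin 1) (z : M.sym.ev W W') : Prop :=
  E.contract X Y (E.contract (X ⊕ Fin 1) (Y ⊕ Fin 1)
      (M.sym.act (e.trans (sumRot X (Fin 1) (Fin 1))) (e'.trans (sumRot Y (Fin 1) (Fin 1))) z)) =
    E.contract X Y (E.contract (X ⊕ Fin 1) (Y ⊕ Fin 1) (M.sym.act e e' z))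

variable {E}

/-- The rotation of the two marked points is an involution, so either edge may be taken as the first
one. -/
theorem Exchange.symm {X Y W W' : Type} [Finite X] [Finite Y] [Finite W] [Finite W']
    {e : W ≃ (X ⊕ Fin 1) ⊕ Fin 1} {e' : W' ≃ (Y ⊕ Fin 1) ⊕ Fin 1} {z : M.sym.ev W W'}
    (h : E.Exchange (e.trans (sumRot X (Fin 1) (Fin 1))) (e'.trans (sumRot Y (Fin 1) (Fin 1))) z) :
    E.Exchange e e' z := by
  unfold Exchange at h ⊢
  rw [← h]
  refine congrArg (fun w => E.contract X Y (E.contract (X ⊕ Fin 1) (Y ⊕ Fin 1) w)) ?_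
  refine M.sym.act_congr (fun x => ?_) (fun x => ?_) _
  · simp only [Equiv.trans_apply]
    rcases e x with (x | x) | x <;> rfl
  · simp only [Equiv.trans_apply]
    rcases e' x with (x | x) | x <;> rfl

variable (E)

/-- Disjoint configuration: a loop at `u` and an edge inside `z`. Contraction inside `z` is linear
over `u`, so only the relabellings have to be compared. -/
theorem exchange_trace_symCons {X Y A B P Q A₀ B₀ P₀ Q₀ : Type} [Finite X] [Finite Y] [Finite A]
    [Finite B] [Finite P] [Finite Q] [Finite A₀] [Finite B₀] [Finite P₀] [Finite Q₀]
    (p : A ⊕ Fin 1 ≃ A₀) (q : B ⊕ Fin 1 ≃ B₀) (r : P ⊕ Fin 1 ≃ P₀) (s : Q ⊕ Fin 1 ≃ Q₀)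
    (u : M.ev (A ⊕ Fin 1) (B ⊕ Fin 1)) (z : M.sym.ev (P ⊕ Fin 1) (Q ⊕ Fin 1))
    (e : A₀ ⊕ P₀ ≃ (X ⊕ Fin 1) ⊕ Fin 1) (e' : B₀ ⊕ Q₀ ≃ (Y ⊕ Fin 1) ⊕ Fin 1)
    (h1 : e (Sum.inl (p (Sum.inr 0))) = Sum.inr 0) (h1' : e' (Sum.inl (q (Sum.inr 0))) = Sum.inr 0)
    (h2 : e (Sum.inr (r (Sum.inr 0))) = Sum.inl (Sum.inr 0))
    (h2' : e' (Sum.inr (s (Sum.inr 0))) = Sum.inl (Sum.inr 0)) :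
    E.Exchange e e' (M.symCons (M.act p q u) (M.sym.act r s z)) := by
  obtain ⟨t₁, t₁', a1, a2, a3, a4, a⟩ := E.exists_contract_trace p q u rfl (M.sym.act r s z) e e'
    h1 h1'
  obtain ⟨t₂, t₂', b1, b2, b3, b4, b⟩ := E.exists_contract_symCons r s (E.trace u) z rfl t₁ t₁'
    (Sum.inl_injective (by rw [← a2, h2])) (Sum.inl_injective (by rw [← a4, h2']))
  obtain ⟨t₃, t₃', c1, c2, c3, c4, c⟩ := E.exists_contract_symCons r s (M.act p q u) z rfl
    (e.trans (sumRot X (Fin 1) (Fin 1))) (e'.trans (sumRot Y (Fin 1) (Fin 1)))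
    (by rw [Equiv.trans_apply, h2]; rfl) (by rw [Equiv.trans_apply, h2']; rfl)
  obtain ⟨t₄, t₄', d1, d2, d3, d4, d⟩ := E.exists_contract_trace p q u rfl (E.contract P Q z)
    t₃ t₃' (Sum.inl_injective (by rw [← c1, Equiv.trans_apply, h1]; rfl))
    (Sum.inl_injective (by rw [← c3, Equiv.trans_apply, h1']; rfl))
  unfold Exchange
  rw [a, b, c, d]
  refine M.sym.act_congr ?_ ?_ _
  · rintro (x | x)
    · exact sumRot_inl_inl e ((c1 _).trans (congrArg _ (d1 x))) ((a1 _).trans (congrArg _ (b1 x)))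
    · exact sumRot_inl_inl e ((c2 _).trans (congrArg _ (d2 x))) ((a2 _).trans (congrArg _ (b2 x)))
  · rintro (x | x)
    · exact sumRot_inl_inl e' ((c3 _).trans (congrArg _ (d3 x))) ((a3 _).trans (congrArg _ (b3 x)))
    · exact sumRot_inl_inl e' ((c4 _).trans (congrArg _ (d4 x))) ((a4 _).trans (congrArg _ (b4 x)))

/-- Disjoint configuration: an edge from `u` to `v` and an edge inside `z`. The same linearity is
used across both factors. -/
theorem exchange_pair_symCons {X Y A B C D P Q A₀ D₀ P₀ Q₀ : Type} [Finite X] [Finite Y]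
    [Finite A] [Finite B] [Finite C] [Finite D] [Finite P] [Finite Q] [Finite A₀] [Finite D₀]
    [Finite P₀] [Finite Q₀]
    (p : A ⊕ Fin 1 ≃ A₀) (q : D ⊕ Fin 1 ≃ D₀) (r : P ⊕ Fin 1 ≃ P₀) (s : Q ⊕ Fin 1 ≃ Q₀)
    (u : M.ev (A ⊕ Fin 1) B) (v : M.ev C (D ⊕ Fin 1)) (z : M.sym.ev (P ⊕ Fin 1) (Q ⊕ Fin 1))
    (e : A₀ ⊕ (C ⊕ P₀) ≃ (X ⊕ Fin 1) ⊕ Fin 1) (e' : B ⊕ (D₀ ⊕ Q₀) ≃ (Y ⊕ Fin 1) ⊕ Fin 1)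
    (h1 : e (Sum.inl (p (Sum.inr 0))) = Sum.inr 0)
    (h1' : e' (Sum.inr (Sum.inl (q (Sum.inr 0)))) = Sum.inr 0)
    (h2 : e (Sum.inr (Sum.inr (r (Sum.inr 0)))) = Sum.inl (Sum.inr 0))
    (h2' : e' (Sum.inr (Sum.inr (s (Sum.inr 0)))) = Sum.inl (Sum.inr 0)) :
    E.Exchange e e' (M.symCons (M.act p (Equiv.refl B) u)
      (M.symCons (M.act (Equiv.refl C) q v) (M.sym.act r s z))) := by
  obtain ⟨t₁, t₁', a1, a2, a3, a4, a5, a6, a⟩ := E.exists_contract_pair p (Equiv.refl B)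
    (Equiv.refl C) q u rfl v rfl (M.sym.act r s z) e e' h1 h1'
  obtain ⟨t₂, t₂', b1, b2, b3, b4, b⟩ := E.exists_contract_symCons r s (E.pair u v) z rfl t₁ t₁'
    (Sum.inl_injective (by rw [← a3, h2])) (Sum.inl_injective (by rw [← a6, h2']))
  -- In the other order the edge inside `z` comes first: the contraction passes through `u` here,
  -- and through `v` in the following rewriting by `contract_symCons`.
  obtain ⟨t₃, t₃', c1, c2, c3, c4, c⟩ := E.exists_contract_symCons
    ((Equiv.sumAssoc C P (Fin 1)).trans (Equiv.sumCongr (Equiv.refl C) r))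
    ((Equiv.sumAssoc D₀ Q (Fin 1)).trans (Equiv.sumCongr (Equiv.refl D₀) s))
    (M.act p (Equiv.refl B) u)
    (M.sym.act (Equiv.sumAssoc C P (Fin 1)).symm (Equiv.sumAssoc D₀ Q (Fin 1)).symm
      (M.symCons (M.act (Equiv.refl C) q v) z))
    (w := M.symCons (M.act (Equiv.refl C) q v) (M.sym.act r s z))
    (by rw [M.sym.act_act, M.symCons_act_right, ← Equiv.trans_assoc, ← Equiv.trans_assoc,
      Equiv.symm_trans_self, Equiv.symm_trans_self, Equiv.refl_trans, Equiv.refl_trans])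
    (e.trans (sumRot X (Fin 1) (Fin 1))) (e'.trans (sumRot Y (Fin 1) (Fin 1)))
    (congrArg (sumRot X (Fin 1) (Fin 1)) h2) (congrArg (sumRot Y (Fin 1) (Fin 1)) h2')
  rw [E.contract_symCons] at c
  obtain ⟨t₄, t₄', d1, d2, d3, d4, d5, d6, d⟩ := E.exists_contract_pair p (Equiv.refl B)
    (Equiv.refl C) q u rfl v rfl (E.contract P Q z)
    t₃ t₃' (Sum.inl_injective (by rw [← c1, Equiv.trans_apply, h1]; rfl))
    (Sum.inl_injective ((c4 _).symm.trans (congrArg (sumRot Y (Fin 1) (Fin 1)) h1')))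
  unfold Exchange
  rw [a, b, c, d]
  refine M.sym.act_congr ?_ ?_ _
  · rintro ((x | x) | x)
    · exact sumRot_inl_inl e ((c1 _).trans (congrArg _ (d1 x))) ((a1 _).trans (congrArg _ (b1 _)))
    · exact sumRot_inl_inl e ((c2 (Sum.inl x)).trans (congrArg _ (d2 x)))
        ((a2 _).trans (congrArg _ (b1 _)))
    · exact sumRot_inl_inl e ((c2 (Sum.inr x)).trans (congrArg _ (d3 x)))
        ((a3 _).trans (congrArg _ (b2 x)))
  · rintro ((x | x) | x)
    · exact sumRot_inl_inl e' ((c3 _).trans (congrArg _ (d4 x))) ((a4 _).trans (congrArg _ (b3 _)))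
    · exact sumRot_inl_inl e' ((c4 (Sum.inl _)).trans (congrArg _ (d5 x)))
        ((a5 _).trans (congrArg _ (b3 _)))
    · exact sumRot_inl_inl e' ((c4 (Sum.inr x)).trans (congrArg _ (d6 x)))
        ((a6 _).trans (congrArg _ (b4 x)))

end EdgeStr

theorem sumRot_sumRot (A B C : Type) : (sumRot A B C).trans (sumRot A C B) = Equiv.refl _ :=
  Equiv.ext (by rintro ((x | x) | x) <;> rfl)

namespace EdgeStr

variable {M : FBBMod k} {E : EdgeStr M}

theorem Exchange.act {X Y V V' W W' : Type} [Finite X] [Finite Y] [Finite V] [Finite V'] [Finite W]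
    [Finite W'] {σ : V ≃ W} {σ' : V' ≃ W'} {e : W ≃ (X ⊕ Fin 1) ⊕ Fin 1}
    {e' : W' ≃ (Y ⊕ Fin 1) ⊕ Fin 1} {z : M.sym.ev V V'}
    (h : E.Exchange (σ.trans e) (σ'.trans e') z) : E.Exchange e e' (M.sym.act σ σ' z) := by
  unfold Exchange at h ⊢
  rw [M.sym.act_act, M.sym.act_act]
  exact h

variable (E)

/-- A loop at `u` and an edge from a further input of `u` to the output of `v`. After the
relabellings are separated, the equality is `E.pair_trace`. -/
theorem exchange_trace_pair {X Y A B C D P Q A₀ B₀ D₀ : Type} [Finite X] [Finite Y]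
    [Finite A] [Finite B] [Finite C] [Finite D] [Finite P] [Finite Q] [Finite A₀] [Finite B₀]
    [Finite D₀]
    (p : (A ⊕ Fin 1) ⊕ Fin 1 ≃ A₀) (q : B ⊕ Fin 1 ≃ B₀) (s : D ⊕ Fin 1 ≃ D₀)
    (u : M.ev ((A ⊕ Fin 1) ⊕ Fin 1) (B ⊕ Fin 1)) (v : M.ev C (D ⊕ Fin 1)) (z : M.sym.ev P Q)
    (e : A₀ ⊕ (C ⊕ P) ≃ (X ⊕ Fin 1) ⊕ Fin 1) (e' : B₀ ⊕ (D₀ ⊕ Q) ≃ (Y ⊕ Fin 1) ⊕ Fin 1)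
    (h1 : e (Sum.inl (p (Sum.inr 0))) = Sum.inr 0)
    (h1' : e' (Sum.inl (q (Sum.inr 0))) = Sum.inr 0)
    (h2 : e (Sum.inl (p (Sum.inl (Sum.inr 0)))) = Sum.inl (Sum.inr 0))
    (h2' : e' (Sum.inr (Sum.inl (s (Sum.inr 0)))) = Sum.inl (Sum.inr 0)) :
    E.Exchange e e' (M.symCons (M.act p q u) (M.symCons (M.act (Equiv.refl C) s v) z)) := by
  obtain ⟨t₁, t₁', a1, a2, a3, a4, a⟩ := E.exists_contract_trace p q u rfl
    (M.symCons (M.act (Equiv.refl C) s v) z) e e' h1 h1'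
  obtain ⟨t₂, t₂', b1, b2, b3, b4, b5, b6, b⟩ := E.exists_contract_pair (Equiv.refl _)
    (Equiv.refl _) (Equiv.refl C) s (E.trace u) (M.act_refl _).symm v rfl z t₁ t₁'
    (Sum.inl_injective ((a1 _).symm.trans h2)) (Sum.inl_injective ((a4 _).symm.trans h2'))
  obtain ⟨t₃, t₃', c1, c2, c3, c4, c5, c6, c⟩ := E.exists_contract_pair
    ((sumRot A (Fin 1) (Fin 1)).trans p) q (Equiv.refl C) s
    (M.act (sumRot A (Fin 1) (Fin 1)) (Equiv.refl (B ⊕ Fin 1)) u) (w := M.act p q u)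
    (by rw [M.act_act, ← Equiv.trans_assoc, sumRot_sumRot]; rfl) v rfl z
    (e.trans (sumRot X (Fin 1) (Fin 1))) (e'.trans (sumRot Y (Fin 1) (Fin 1)))
    (congrArg (sumRot X (Fin 1) (Fin 1)) h2) (congrArg (sumRot Y (Fin 1) (Fin 1)) h2')
  obtain ⟨t₄, t₄', d1, d2, d3, d4, d⟩ := E.exists_contract_trace (sumRot A C (Fin 1))
    (sumRot B D (Fin 1)) (M.act (sumRot A (Fin 1) C) (sumRot B (Fin 1) D)
      (E.pair (M.act (sumRot A (Fin 1) (Fin 1)) (Equiv.refl (B ⊕ Fin 1)) u) v))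
    (w := E.pair (M.act (sumRot A (Fin 1) (Fin 1)) (Equiv.refl (B ⊕ Fin 1)) u) v)
    (by rw [M.act_act, sumRot_sumRot, sumRot_sumRot, M.act_refl]) z
    t₃ t₃' (Sum.inl_injective ((c1 _).symm.trans (congrArg (sumRot X (Fin 1) (Fin 1)) h1)))
    (Sum.inl_injective ((c4 _).symm.trans (congrArg (sumRot Y (Fin 1) (Fin 1)) h1')))
  unfold Exchange
  rw [a, b, c, d, E.pair_trace]
  refine M.sym.act_congr ?_ ?_ _
  · rintro ((x | x) | x)
    · exact sumRot_inl_inl e ((c1 (Sum.inl x)).trans (congrArg _ (d1 (Sum.inl x))))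
        ((a1 (Sum.inl x)).trans (congrArg _ (b1 _)))
    · exact sumRot_inl_inl e ((c2 _).trans (congrArg _ (d1 (Sum.inr x))))
        ((a2 (Sum.inl x)).trans (congrArg _ (b2 _)))
    · exact sumRot_inl_inl e ((c3 _).trans (congrArg _ (d2 x)))
        ((a2 (Sum.inr x)).trans (congrArg _ (b3 _)))
  · rintro ((x | x) | x)
    · exact sumRot_inl_inl e' ((c4 (Sum.inl x)).trans (congrArg _ (d3 (Sum.inl x))))
        ((a3 _).trans (congrArg _ (b4 _)))
    · exact sumRot_inl_inl e' ((c5 _).trans (congrArg _ (d3 (Sum.inr x))))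
        ((a4 (Sum.inl _)).trans (congrArg _ (b5 _)))
    · exact sumRot_inl_inl e' ((c6 _).trans (congrArg _ (d4 x)))
        ((a4 (Sum.inr x)).trans (congrArg _ (b6 _)))

/-- Each of `u` and `v` feeds the other. Contracting one edge creates a single factor on which the
other edge is a loop, and the two results agree by `E.trace_pair_comm`. -/
theorem exchange_cycle {X Y A B C D P Q A₀ B₀ C₀ D₀ : Type} [Finite X] [Finite Y]
    [Finite A] [Finite B] [Finite C] [Finite D] [Finite P] [Finite Q] [Finite A₀] [Finite B₀]
    [Finite C₀] [Finite D₀]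
    (p : A ⊕ Fin 1 ≃ A₀) (q : B ⊕ Fin 1 ≃ B₀) (r : C ⊕ Fin 1 ≃ C₀) (s : D ⊕ Fin 1 ≃ D₀)
    (u : M.ev (A ⊕ Fin 1) (B ⊕ Fin 1)) (v : M.ev (C ⊕ Fin 1) (D ⊕ Fin 1)) (z : M.sym.ev P Q)
    (e : A₀ ⊕ (C₀ ⊕ P) ≃ (X ⊕ Fin 1) ⊕ Fin 1) (e' : B₀ ⊕ (D₀ ⊕ Q) ≃ (Y ⊕ Fin 1) ⊕ Fin 1)
    (h1 : e (Sum.inl (p (Sum.inr 0))) = Sum.inr 0)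
    (h1' : e' (Sum.inr (Sum.inl (s (Sum.inr 0)))) = Sum.inr 0)
    (h2 : e (Sum.inr (Sum.inl (r (Sum.inr 0)))) = Sum.inl (Sum.inr 0))
    (h2' : e' (Sum.inl (q (Sum.inr 0))) = Sum.inl (Sum.inr 0)) :
    E.Exchange e e' (M.symCons (M.act p q u) (M.symCons (M.act r s v) z)) := by
  obtain ⟨t₁, t₁', a1, a2, a3, a4, a5, a6, a⟩ := E.exists_contract_pair p q r s u rfl v rfl z e e'
    h1 h1'
  obtain ⟨t₂, t₂', b1, b2, b3, b4, b⟩ := E.exists_contract_trace (Equiv.sumAssoc A C (Fin 1))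
    (sumRot B D (Fin 1)) _ (w := E.pair u v)
    (by rw [M.act_act (Equiv.sumAssoc A C (Fin 1)).symm (sumRot B (Fin 1) D), sumRot_sumRot,
      Equiv.symm_trans_self, M.act_refl]) z t₁ t₁'
    (Sum.inl_injective ((a2 _).symm.trans h2)) (Sum.inl_injective ((a4 _).symm.trans h2'))
  -- In the other order the receiving factor is `v`, so it is first brought to the front.
  obtain ⟨t₃, t₃', c1, c2, c3, c4, c5, c6, c⟩ := E.exists_contract_pair r s p q v rfl u rfl z
    ((sumLeftComm C₀ A₀ P).trans (e.trans (sumRot X (Fin 1) (Fin 1))))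
    ((sumLeftComm D₀ B₀ Q).trans (e'.trans (sumRot Y (Fin 1) (Fin 1))))
    (congrArg (sumRot X (Fin 1) (Fin 1)) h2) (congrArg (sumRot Y (Fin 1) (Fin 1)) h2')
  obtain ⟨t₄, t₄', d1, d2, d3, d4, d⟩ := E.exists_contract_trace (Equiv.sumAssoc C A (Fin 1))
    (sumRot D B (Fin 1)) _ (w := E.pair v u)
    (by rw [M.act_act (Equiv.sumAssoc C A (Fin 1)).symm (sumRot D (Fin 1) B), sumRot_sumRot,
      Equiv.symm_trans_self, M.act_refl]) z t₃ t₃'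
    (Sum.inl_injective ((c2 _).symm.trans (congrArg (sumRot X (Fin 1) (Fin 1)) h1)))
    (Sum.inl_injective ((c4 _).symm.trans (congrArg (sumRot Y (Fin 1) (Fin 1)) h1')))
  unfold Exchange
  rw [a, b, M.symCons_comm (M.act p q u), M.sym.act_act, c, d, E.trace_pair_comm,
    M.symCons_act_left, M.sym.act_act]
  refine M.sym.act_congr ?_ ?_ _
  · rintro ((x | x) | x)
    · exact sumRot_inl_inl e ((c2 (Sum.inl x)).trans (congrArg _ (d1 (Sum.inr x))))
        ((a1 x).trans (congrArg _ (b1 (Sum.inl x))))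
    · exact sumRot_inl_inl e ((c1 x).trans (congrArg _ (d1 (Sum.inl x))))
        ((a2 (Sum.inl x)).trans (congrArg _ (b1 (Sum.inr x))))
    · exact sumRot_inl_inl e ((c3 _).trans (congrArg _ (d2 x)))
        ((a3 x).trans (congrArg _ (b2 _)))
  · rintro ((x | x) | x)
    · exact sumRot_inl_inl e' ((c5 x).trans (congrArg _ (d3 (Sum.inr x))))
        ((a4 (Sum.inl x)).trans (congrArg _ (b3 (Sum.inl x))))
    · exact sumRot_inl_inl e' ((c4 (Sum.inl x)).trans (congrArg _ (d3 (Sum.inl x))))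
        ((a5 x).trans (congrArg _ (b3 (Sum.inr x))))
    · exact sumRot_inl_inl e' ((c6 _).trans (congrArg _ (d4 x)))
        ((a6 x).trans (congrArg _ (b4 _)))

/-- The output of `w` enters `v` and the output of `v` enters `u`. The two orders produce the two
sides of `E.assoc`. -/
theorem exchange_chain {X Y A B C D G H P Q A₀ C₀ D₀ H₀ : Type} [Finite X] [Finite Y]
    [Finite A] [Finite B] [Finite C] [Finite D] [Finite G] [Finite H] [Finite P] [Finite Q]
    [Finite A₀] [Finite C₀] [Finite D₀] [Finite H₀]
    (p : A ⊕ Fin 1 ≃ A₀) (q : C ⊕ Fin 1 ≃ C₀) (r : D ⊕ Fin 1 ≃ D₀) (s : H ⊕ Fin 1 ≃ H₀)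
    (u : M.ev (A ⊕ Fin 1) B) (v : M.ev (C ⊕ Fin 1) (D ⊕ Fin 1)) (w : M.ev G (H ⊕ Fin 1))
    (z : M.sym.ev P Q) (e : A₀ ⊕ (C₀ ⊕ (G ⊕ P)) ≃ (X ⊕ Fin 1) ⊕ Fin 1)
    (e' : B ⊕ (D₀ ⊕ (H₀ ⊕ Q)) ≃ (Y ⊕ Fin 1) ⊕ Fin 1)
    (h1 : e (Sum.inl (p (Sum.inr 0))) = Sum.inr 0)
    (h1' : e' (Sum.inr (Sum.inl (r (Sum.inr 0)))) = Sum.inr 0)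
    (h2 : e (Sum.inr (Sum.inl (q (Sum.inr 0)))) = Sum.inl (Sum.inr 0))
    (h2' : e' (Sum.inr (Sum.inr (Sum.inl (s (Sum.inr 0))))) = Sum.inl (Sum.inr 0)) :
    E.Exchange e e' (M.symCons (M.act p (Equiv.refl B) u)
      (M.symCons (M.act q r v) (M.symCons (M.act (Equiv.refl G) s w) z))) := by
  obtain ⟨t₁, t₁', a1, a2, a3, a4, a5, a6, a⟩ := E.exists_contract_pair p (Equiv.refl B) q r u rfl
    v rfl (M.symCons (M.act (Equiv.refl G) s w) z) e e' h1 h1'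
  obtain ⟨t₂, t₂', b1, b2, b3, b4, b5, b6, b⟩ := E.exists_contract_pair
    (Equiv.sumAssoc A C (Fin 1)) (Equiv.refl (B ⊕ D)) (Equiv.refl G) s _ (w := E.pair u v)
    (by rw [M.act_act (Equiv.sumAssoc A C (Fin 1)).symm (Equiv.refl _),
      Equiv.symm_trans_self, Equiv.refl_trans, M.act_refl]) w rfl z t₁ t₁'
    (Sum.inl_injective ((a2 _).symm.trans h2)) (Sum.inl_injective ((a6 _).symm.trans h2'))
  obtain ⟨t₃, t₃', c1, c2, c3, c4, c5, c6, c⟩ := E.exists_contract_pair q r (Equiv.refl G) s v rfl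
    w rfl (M.symCons (M.act p (Equiv.refl B) u) z)
    ((Equiv.sumCongr (Equiv.refl C₀) (sumLeftComm G A₀ P)).trans ((sumLeftComm C₀ A₀ (G ⊕ P)).trans
      (e.trans (sumRot X (Fin 1) (Fin 1)))))
    ((Equiv.sumCongr (Equiv.refl D₀) (sumLeftComm H₀ B Q)).trans ((sumLeftComm D₀ B (H₀ ⊕ Q)).trans
      (e'.trans (sumRot Y (Fin 1) (Fin 1)))))
    (congrArg (sumRot X (Fin 1) (Fin 1)) h2) (congrArg (sumRot Y (Fin 1) (Fin 1)) h2')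
  obtain ⟨t₄, t₄', d1, d2, d3, d4, d5, d6, d⟩ := E.exists_contract_pair p (Equiv.refl B)
    (Equiv.refl (C ⊕ G)) (sumRot D H (Fin 1)) u rfl
    (M.act (Equiv.refl _) (sumRot D (Fin 1) H) (E.pair v w)) (w' := E.pair v w)
    (by rw [M.act_act, sumRot_sumRot, Equiv.refl_trans, M.act_refl]) z
    ((sumLeftComm A₀ (C ⊕ G) P).trans t₃) ((sumLeftComm B ((D ⊕ Fin 1) ⊕ H) Q).trans t₃')
    (Sum.inl_injective ((c3 (Sum.inl _)).symm.trans (congrArg (sumRot X (Fin 1) (Fin 1)) h1)))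
    (Sum.inl_injective ((c4 _).symm.trans (congrArg (sumRot Y (Fin 1) (Fin 1)) h1')))
  unfold Exchange
  rw [a, b, M.symCons_comm (M.act p (Equiv.refl B) u) (M.act q r v),
    M.symCons_comm (M.act p (Equiv.refl B) u) (M.act (Equiv.refl G) s w), M.symCons_act_right,
    M.sym.act_act, M.sym.act_act, c, M.symCons_comm (E.pair v w), M.sym.act_act, d, ← E.assoc,
    M.symCons_act_left, M.sym.act_act]
  refine M.sym.act_congr ?_ ?_ _
  · rintro (((x | x) | x) | x)
    · exact sumRot_inl_inl e ((c3 (Sum.inl _)).trans (congrArg _ (d1 x)))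
        ((a1 x).trans (congrArg _ (b1 (Sum.inl x))))
    · exact sumRot_inl_inl e ((c1 x).trans (congrArg _ (d2 (Sum.inl x))))
        ((a2 (Sum.inl x)).trans (congrArg _ (b1 (Sum.inr x))))
    · exact sumRot_inl_inl e ((c2 x).trans (congrArg _ (d2 (Sum.inr x))))
        ((a3 (Sum.inl x)).trans (congrArg _ (b2 x)))
    · exact sumRot_inl_inl e ((c3 (Sum.inr x)).trans (congrArg _ (d3 x)))
        ((a3 (Sum.inr x)).trans (congrArg _ (b3 x)))
  · rintro (((x | x) | x) | x)
    · exact sumRot_inl_inl e' ((c6 (Sum.inl x)).trans (congrArg _ (d4 x)))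
        ((a4 x).trans (congrArg _ (b4 (Sum.inl x))))
    · exact sumRot_inl_inl e' ((c4 (Sum.inl x)).trans (congrArg _ (d5 (Sum.inl x))))
        ((a5 x).trans (congrArg _ (b4 (Sum.inr x))))
    · exact sumRot_inl_inl e' ((c5 x).trans (congrArg _ (d5 (Sum.inr x))))
        ((a6 (Sum.inl _)).trans (congrArg _ (b5 x)))
    · exact sumRot_inl_inl e' ((c6 (Sum.inr x)).trans (congrArg _ (d6 x)))
        ((a6 (Sum.inr x)).trans (congrArg _ (b6 x)))

/-- The outputs of `v` and `w` enter two different inputs of `u`. The two orders produce the two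
sides of `E.parallel`. -/
theorem exchange_parallel {X Y A B C D G H P Q A₀ D₀ H₀ : Type} [Finite X] [Finite Y]
    [Finite A] [Finite B] [Finite C] [Finite D] [Finite G] [Finite H] [Finite P] [Finite Q]
    [Finite A₀] [Finite D₀] [Finite H₀]
    (p : (A ⊕ Fin 1) ⊕ Fin 1 ≃ A₀) (r : D ⊕ Fin 1 ≃ D₀) (s : H ⊕ Fin 1 ≃ H₀)
    (u : M.ev ((A ⊕ Fin 1) ⊕ Fin 1) B) (v : M.ev C (D ⊕ Fin 1)) (w : M.ev G (H ⊕ Fin 1))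
    (z : M.sym.ev P Q) (e : A₀ ⊕ (C ⊕ (G ⊕ P)) ≃ (X ⊕ Fin 1) ⊕ Fin 1)
    (e' : B ⊕ (D₀ ⊕ (H₀ ⊕ Q)) ≃ (Y ⊕ Fin 1) ⊕ Fin 1)
    (h1 : e (Sum.inl (p (Sum.inr 0))) = Sum.inr 0)
    (h1' : e' (Sum.inr (Sum.inl (r (Sum.inr 0)))) = Sum.inr 0)
    (h2 : e (Sum.inl (p (Sum.inl (Sum.inr 0)))) = Sum.inl (Sum.inr 0))
    (h2' : e' (Sum.inr (Sum.inr (Sum.inl (s (Sum.inr 0))))) = Sum.inl (Sum.inr 0)) :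
    E.Exchange e e' (M.symCons (M.act p (Equiv.refl B) u)
      (M.symCons (M.act (Equiv.refl C) r v) (M.symCons (M.act (Equiv.refl G) s w) z))) := by
  obtain ⟨t₁, t₁', a1, a2, a3, a4, a5, a6, a⟩ := E.exists_contract_pair p (Equiv.refl B)
    (Equiv.refl C) r u rfl v rfl (M.symCons (M.act (Equiv.refl G) s w) z) e e' h1 h1'
  obtain ⟨t₂, t₂', b1, b2, b3, b4, b5, b6, b⟩ := E.exists_contract_pair
    (sumRot A C (Fin 1)) (Equiv.refl (B ⊕ D)) (Equiv.refl G) s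
    (M.act (sumRot A (Fin 1) C) (Equiv.refl _) (E.pair u v)) (w := E.pair u v)
    (by rw [M.act_act, sumRot_sumRot, Equiv.refl_trans, M.act_refl]) w rfl z t₁ t₁'
    (Sum.inl_injective ((a1 _).symm.trans h2)) (Sum.inl_injective ((a6 _).symm.trans h2'))
  obtain ⟨t₃, t₃', c1, c2, c3, c4, c5, c6, c⟩ := E.exists_contract_pair
    ((sumRot A (Fin 1) (Fin 1)).trans p) (Equiv.refl B) (Equiv.refl G) s
    (M.act (sumRot A (Fin 1) (Fin 1)) (Equiv.refl B) u) (w := M.act p (Equiv.refl B) u)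
    (by rw [M.act_act, ← Equiv.trans_assoc, sumRot_sumRot]; rfl) w rfl
    (M.symCons (M.act (Equiv.refl C) r v) z)
    ((Equiv.sumCongr (Equiv.refl A₀) (sumLeftComm G C P)).trans
      (e.trans (sumRot X (Fin 1) (Fin 1))))
    ((Equiv.sumCongr (Equiv.refl B) (sumLeftComm H₀ D₀ Q)).trans
      (e'.trans (sumRot Y (Fin 1) (Fin 1))))
    (congrArg (sumRot X (Fin 1) (Fin 1)) h2) (congrArg (sumRot Y (Fin 1) (Fin 1)) h2')
  obtain ⟨t₄, t₄', d1, d2, d3, d4, d5, d6, d⟩ := E.exists_contract_pair (sumRot A G (Fin 1))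
    (Equiv.refl (B ⊕ H)) (Equiv.refl C) r
    (M.act (sumRot A (Fin 1) G) (Equiv.refl _)
      (E.pair (M.act (sumRot A (Fin 1) (Fin 1)) (Equiv.refl B) u) w))
    (w := E.pair (M.act (sumRot A (Fin 1) (Fin 1)) (Equiv.refl B) u) w)
    (by rw [M.act_act, sumRot_sumRot, Equiv.refl_trans, M.act_refl]) v rfl z t₃ t₃'
    (Sum.inl_injective ((c1 _).symm.trans (congrArg (sumRot X (Fin 1) (Fin 1)) h1)))
    (Sum.inl_injective ((c6 (Sum.inl _)).symm.trans (congrArg (sumRot Y (Fin 1) (Fin 1)) h1')))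
  unfold Exchange
  rw [a, b, M.symCons_comm (M.act (Equiv.refl C) r v), M.symCons_act_right,
    M.sym.act_act, c, d, ← E.parallel, M.symCons_act_left, M.sym.act_act]
  refine M.sym.act_congr ?_ ?_ _
  · rintro (((x | x) | x) | x)
    · exact sumRot_inl_inl e ((c1 (Sum.inl x)).trans (congrArg _ (d1 (Sum.inl x))))
        ((a1 (Sum.inl x)).trans (congrArg _ (b1 (Sum.inl x))))
    · exact sumRot_inl_inl e ((c3 (Sum.inl x)).trans (congrArg _ (d2 x)))
        ((a2 x).trans (congrArg _ (b1 (Sum.inr x))))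
    · exact sumRot_inl_inl e ((c2 x).trans (congrArg _ (d1 (Sum.inr x))))
        ((a3 (Sum.inl x)).trans (congrArg _ (b2 x)))
    · exact sumRot_inl_inl e ((c3 (Sum.inr x)).trans (congrArg _ (d3 x)))
        ((a3 (Sum.inr x)).trans (congrArg _ (b3 x)))
  · rintro (((x | x) | x) | x)
    · exact sumRot_inl_inl e' ((c4 x).trans (congrArg _ (d4 (Sum.inl x))))
        ((a4 x).trans (congrArg _ (b4 (Sum.inl x))))
    · exact sumRot_inl_inl e' ((c6 (Sum.inl _)).trans (congrArg _ (d5 x)))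
        ((a5 x).trans (congrArg _ (b4 (Sum.inr x))))
    · exact sumRot_inl_inl e' ((c5 x).trans (congrArg _ (d4 (Sum.inr x))))
        ((a6 (Sum.inl _)).trans (congrArg _ (b5 x)))
    · exact sumRot_inl_inl e' ((c6 (Sum.inr x)).trans (congrArg _ (d6 x)))
        ((a6 (Sum.inr x)).trans (congrArg _ (b6 x)))


/-! ### Exhaustion of the configurations of two edges -/

theorem exchange_zero {X Y W W' : Type} [Finite X] [Finite Y] [Finite W] [Finite W']
    (e : W ≃ (X ⊕ Fin 1) ⊕ Fin 1) (e' : W' ≃ (Y ⊕ Fin 1) ⊕ Fin 1) : E.Exchange e e' 0 := by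
  simp only [Exchange, map_zero]

/-- Exchange is an equality of linear maps, so the remaining product may be taken with its factor of
interest in front. The map `f` multiplies by the factors already extracted. -/
theorem exchange_ext_left {X Y W W' P Q : Type} [Finite X] [Finite Y] [Finite W] [Finite W']
    [Finite P] [Finite Q] {e : W ≃ (X ⊕ Fin 1) ⊕ Fin 1} {e' : W' ≃ (Y ⊕ Fin 1) ⊕ Fin 1}
    (f : M.sym.ev P Q →ₗ[k] M.sym.ev W W') (x : P)
    (h : ∀ (A B P' Q' : Type) [Finite A] [Finite B] [Finite P'] [Finite Q']
      (d : (A ⊕ Fin 1) ⊕ P' ≃ P) (d' : B ⊕ Q' ≃ Q) (u : M.ev (A ⊕ Fin 1) B) (z : M.sym.ev P' Q'),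
      d (Sum.inl (Sum.inr 0)) = x → E.Exchange e e' (f (M.sym.act d d' (M.symCons u z))))
    (z : M.sym.ev P Q) : E.Exchange e e' (f z) :=
  M.sym_ext_left x (φ := E.contract X Y ∘ₗ E.contract (X ⊕ Fin 1) (Y ⊕ Fin 1) ∘ₗ
      M.sym.act (e.trans (sumRot X (Fin 1) (Fin 1))) (e'.trans (sumRot Y (Fin 1) (Fin 1))) ∘ₗ f)
    (ψ := E.contract X Y ∘ₗ E.contract (X ⊕ Fin 1) (Y ⊕ Fin 1) ∘ₗ M.sym.act e e' ∘ₗ f) h z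

theorem exchange_ext_right {X Y W W' P Q : Type} [Finite X] [Finite Y] [Finite W] [Finite W']
    [Finite P] [Finite Q] {e : W ≃ (X ⊕ Fin 1) ⊕ Fin 1} {e' : W' ≃ (Y ⊕ Fin 1) ⊕ Fin 1}
    (f : M.sym.ev P Q →ₗ[k] M.sym.ev W W') (y : Q)
    (h : ∀ (A B P' Q' : Type) [Finite A] [Finite B] [Finite P'] [Finite Q']
      (d : A ⊕ P' ≃ P) (d' : (B ⊕ Fin 1) ⊕ Q' ≃ Q) (u : M.ev A (B ⊕ Fin 1)) (z : M.sym.ev P' Q'),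
      d' (Sum.inl (Sum.inr 0)) = y → E.Exchange e e' (f (M.sym.act d d' (M.symCons u z))))
    (z : M.sym.ev P Q) : E.Exchange e e' (f z) :=
  M.sym_ext_right y (φ := E.contract X Y ∘ₗ E.contract (X ⊕ Fin 1) (Y ⊕ Fin 1) ∘ₗ
      M.sym.act (e.trans (sumRot X (Fin 1) (Fin 1))) (e'.trans (sumRot Y (Fin 1) (Fin 1))) ∘ₗ f)
    (ψ := E.contract X Y ∘ₗ E.contract (X ⊕ Fin 1) (Y ⊕ Fin 1) ∘ₗ M.sym.act e e' ∘ₗ f) h z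

/-- The first edge is a loop at `u`. The second output cannot lie in `u` unless `u = 0`, so it lies
in `z`. The second input lies either in `u`, which gives a loop with an edge, or in `z`, which gives
disjoint edges. -/
theorem exchange_of_trace {X Y A B P Q : Type} [Finite X] [Finite Y] [Finite A] [Finite B]
    [Finite P] [Finite Q] (u : M.ev (A ⊕ Fin 1) (B ⊕ Fin 1)) (z : M.sym.ev P Q)
    (e : (A ⊕ Fin 1) ⊕ P ≃ (X ⊕ Fin 1) ⊕ Fin 1) (e' : (B ⊕ Fin 1) ⊕ Q ≃ (Y ⊕ Fin 1) ⊕ Fin 1)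
    (h1 : e (Sum.inl (Sum.inr 0)) = Sum.inr 0) (h1' : e' (Sum.inl (Sum.inr 0)) = Sum.inr 0) :
    E.Exchange e e' (M.symCons u z) := by
  obtain ⟨y | y, hy⟩ := e'.surjective (Sum.inl (Sum.inr 0))
  -- Both marked outputs lie in `u`.
  · have hu := E.eq_zero u y (Sum.inr 0) (by rintro rfl; rw [h1'] at hy; cases hy)
    rw [hu, map_zero, LinearMap.zero_apply]
    exact E.exchange_zero e e'
  obtain ⟨(a | x) | x, hx⟩ := e.surjective (Sum.inl (Sum.inr 0))
  · obtain ⟨A, _, r, rfl⟩ := exists_sum_one a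
    refine E.exchange_ext_right (M.symCons u) y (fun C D P' Q' _ _ _ _ d d' v z hd => ?_) z
    subst hd
    rw [M.symCons_act_right]
    refine Exchange.act ?_
    have := E.exchange_trace_pair (Equiv.sumCongr r (Equiv.refl (Fin 1))) (Equiv.refl _)
      (Equiv.refl _) (M.act (Equiv.sumCongr r (Equiv.refl (Fin 1))).symm (Equiv.refl _) u) v z
      ((Equiv.sumCongr (Equiv.refl _) d).trans e) ((Equiv.sumCongr (Equiv.refl _) d').trans e')
      h1 h1' hx hy
    rwa [M.act_act, Equiv.symm_trans_self, Equiv.refl_trans, M.act_refl, M.act_refl] at this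
  · rw [Subsingleton.elim x 0, h1] at hx
    cases hx
  · obtain ⟨P, _, r, rfl⟩ := exists_sum_one x
    obtain ⟨Q, _, s, rfl⟩ := exists_sum_one y
    have := E.exchange_trace_symCons (Equiv.refl _) (Equiv.refl _) r s u (M.sym.act r.symm s.symm z)
      e e' h1 h1' hx hy
    rwa [M.sym.act_act, Equiv.symm_trans_self, Equiv.symm_trans_self, M.act_refl, M.sym.act_refl]
      at this

/-- The first edge runs from an input of `u` to the output of `v`. The second output lies in `u` or
in `z`, otherwise `v = 0`. The second input lies in `u`, `v` or `z`. A third generator is extracted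
from `z` when exactly one end of the second edge lies there. -/
theorem exchange_of_pair {X Y A B C D P Q : Type} [Finite X] [Finite Y] [Finite A] [Finite B]
    [Finite C] [Finite D] [Finite P] [Finite Q] (u : M.ev (A ⊕ Fin 1) B) (v : M.ev C (D ⊕ Fin 1))
    (z : M.sym.ev P Q) (e : (A ⊕ Fin 1) ⊕ (C ⊕ P) ≃ (X ⊕ Fin 1) ⊕ Fin 1)
    (e' : B ⊕ ((D ⊕ Fin 1) ⊕ Q) ≃ (Y ⊕ Fin 1) ⊕ Fin 1)
    (h1 : e (Sum.inl (Sum.inr 0)) = Sum.inr 0)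
    (h1' : e' (Sum.inr (Sum.inl (Sum.inr 0))) = Sum.inr 0) :
    E.Exchange e e' (M.symCons u (M.symCons v z)) := by
  obtain ⟨y | y | y, hy⟩ := e'.surjective (Sum.inl (Sum.inr 0))
  · obtain ⟨B, _, q, rfl⟩ := exists_sum_one y
    obtain ⟨(a | x) | c | x, hx⟩ := e.surjective (Sum.inl (Sum.inr 0))
    · obtain ⟨A, _, r, rfl⟩ := exists_sum_one a
      -- The second edge is a loop at `u`. After reversing the order, this is the configuration in
      -- which the loop is contracted first.
      refine Exchange.symm ?_
      have := E.exchange_trace_pair ((sumRot A (Fin 1) (Fin 1)).trans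
        (Equiv.sumCongr r (Equiv.refl (Fin 1)))) q (Equiv.refl _)
        (M.act ((sumRot A (Fin 1) (Fin 1)).trans (Equiv.sumCongr r (Equiv.refl (Fin 1)))).symm
          q.symm u) v z
        (e.trans (sumRot X (Fin 1) (Fin 1))) (e'.trans (sumRot Y (Fin 1) (Fin 1)))
        (congrArg (sumRot X (Fin 1) (Fin 1)) hx) (congrArg (sumRot Y (Fin 1) (Fin 1)) hy)
        (congrArg (sumRot X (Fin 1) (Fin 1)) h1) (congrArg (sumRot Y (Fin 1) (Fin 1)) h1')
      rwa [M.act_act, Equiv.symm_trans_self, Equiv.symm_trans_self, M.act_refl, M.act_refl]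
        at this
    · rw [Subsingleton.elim x 0, h1] at hx
      cases hx
    · obtain ⟨C, _, r, rfl⟩ := exists_sum_one c
      have := E.exchange_cycle (Equiv.refl _) q r (Equiv.refl _)
        (M.act (Equiv.refl _) q.symm u) (M.act r.symm (Equiv.refl _) v) z e e' h1 h1' hx hy
      rwa [M.act_act, M.act_act, Equiv.symm_trans_self, Equiv.symm_trans_self, Equiv.refl_trans,
        Equiv.refl_trans, M.act_refl, M.act_refl] at this
    -- The second edge joins the output of `u` to an input of a third generator `w`. Once `w` is
    -- moved to the front and the order is reversed, `w`, `u`, `v` form a chain.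
    · refine E.exchange_ext_left (M.symCons u ∘ₗ M.symCons v) x
        (fun G H P' Q' _ _ _ _ d d' w z hd => ?_) z
      subst hd
      simp only [LinearMap.comp_apply]
      rw [M.symCons_act_right, M.symCons_act_right, M.symCons_comm v w, M.symCons_act_right,
        M.symCons_comm u w]
      refine Exchange.act (Exchange.act (Exchange.act (Exchange.symm ?_)))
      have := fun e e' => E.exchange_chain (X := X) (Y := Y) (Equiv.refl _) (Equiv.refl _) q
        (Equiv.refl _) w (M.act (Equiv.refl (A ⊕ Fin 1)) q.symm u) v z e e'
      simp only [M.act_act, Equiv.symm_trans_self, Equiv.refl_trans, M.act_refl] at this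
      exact this _ _ (congrArg (sumRot X (Fin 1) (Fin 1)) hx)
        (congrArg (sumRot Y (Fin 1) (Fin 1)) hy) (congrArg (sumRot X (Fin 1) (Fin 1)) h1)
        (congrArg (sumRot Y (Fin 1) (Fin 1)) h1')
  · have hv := E.eq_zero v y (Sum.inr 0) (by rintro rfl; rw [h1'] at hy; cases hy)
    rw [hv, map_zero, LinearMap.zero_apply, map_zero]
    exact E.exchange_zero e e'
  obtain ⟨(a | x) | c | x, hx⟩ := e.surjective (Sum.inl (Sum.inr 0))
  · obtain ⟨A, _, r, rfl⟩ := exists_sum_one a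
    -- The output of a third generator `w` enters a second input of `u`: the parallel configuration.
    refine E.exchange_ext_right (M.symCons u ∘ₗ M.symCons v) y
      (fun G H P' Q' _ _ _ _ d d' w z hd => ?_) z
    subst hd
    simp only [LinearMap.comp_apply]
    rw [M.symCons_act_right, M.symCons_act_right]
    refine Exchange.act ?_
    have := fun e e' => E.exchange_parallel (X := X) (Y := Y)
      (Equiv.sumCongr r (Equiv.refl (Fin 1))) (Equiv.refl _) (Equiv.refl _)
      (M.act (Equiv.sumCongr r (Equiv.refl (Fin 1))).symm (Equiv.refl B) u) v w z e e'
    simp only [M.act_act, Equiv.symm_trans_self, Equiv.refl_trans, M.act_refl] at this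
    exact this _ _ h1 h1' hx hy
  · rw [Subsingleton.elim x 0, h1] at hx
    cases hx
  · obtain ⟨C, _, r, rfl⟩ := exists_sum_one c
    -- The output of a third generator `w` enters `v`: a chain `u`, `v`, `w`.
    refine E.exchange_ext_right (M.symCons u ∘ₗ M.symCons v) y
      (fun G H P' Q' _ _ _ _ d d' w z hd => ?_) z
    subst hd
    simp only [LinearMap.comp_apply]
    rw [M.symCons_act_right, M.symCons_act_right]
    refine Exchange.act ?_
    have := fun e e' => E.exchange_chain (X := X) (Y := Y) (Equiv.refl _) r (Equiv.refl _)
      (Equiv.refl _) u (M.act r.symm (Equiv.refl (D ⊕ Fin 1)) v) w z e e'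
    simp only [M.act_act, Equiv.symm_trans_self, Equiv.refl_trans, M.act_refl] at this
    exact this _ _ h1 h1' hx hy
  · obtain ⟨P, _, r, rfl⟩ := exists_sum_one x
    obtain ⟨Q, _, s, rfl⟩ := exists_sum_one y
    have := E.exchange_pair_symCons (Equiv.refl _) (Equiv.refl _) r s u v
      (M.sym.act r.symm s.symm z) e e' h1 h1' hx hy
    rwa [M.sym.act_act, Equiv.symm_trans_self, Equiv.symm_trans_self, M.act_refl, M.act_refl,
      M.sym.act_refl] at this

/-- Marked products span, so the edge contracted first may be assumed to be a loop at the first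
factor or to join the first two. -/
theorem contraction_isComm : E.contraction.IsComm := by
  intro X Y _ _ z
  refine M.sym_ext_marked (φ := E.contract X Y ∘ₗ E.contract (X ⊕ Fin 1) (Y ⊕ Fin 1) ∘ₗ
      M.sym.act (sumRot X (Fin 1) (Fin 1)) (sumRot Y (Fin 1) (Fin 1)))
    (ψ := E.contract X Y ∘ₗ E.contract (X ⊕ Fin 1) (Y ⊕ Fin 1)) (fun A B P Q _ _ _ _ t t' u z => ?_)
    (fun A B C D P Q _ _ _ _ _ _ t t' u v z => ?_) z
  · simp only [LinearMap.comp_apply]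
    rw [M.sym.act_act]
    exact E.exchange_of_trace u z _ _ rfl rfl
  · simp only [LinearMap.comp_apply]
    rw [M.sym.act_act]
    exact E.exchange_of_pair u v z _ _ rfl rfl

/-- The `k dwb`-module structure on `S*M`. -/
noncomputable def dwbStr : DwbStr M.sym := E.contraction_isComm.dwbStr

theorem dwbStr_contract (X Y : Type) [Finite X] [Finite Y] :
    E.dwbStr.contract X Y = E.contract X Y :=
  E.contraction_isComm.dwbStr_contract X Y

end EdgeStr

end

/-! ### The gluing structures attached to an operad -/

section

variable {k : Type u} [Field k] (O : Operad k)

theorem Operad.proj_surjective {X Y : Type} [Finite X] [Finite Y] :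
    Function.Surjective (O.proj (X := X) (Y := Y)) :=
  Submodule.mkQ_surjective _

theorem Operad.eq_zero {X Y : Type} [Finite X] [Finite Y] (u : O.toMod.ev X Y) {y y' : Y}
    (h : y ≠ y') : u = 0 := by
  have := O.supp X Y (fun hY => h ((Nat.card_eq_one_iff_unique.mp hY).1.elim y y'))
  exact Subsingleton.elim u 0

/-- A representative of a wheel has the marked output in addition to those in `Y`. If `Y` has a
point, it therefore has two outputs and vanishes. -/
theorem Operad.wheel_eq_zero {X Y : Type} [Finite X] [Finite Y] (w : O.wheel.ev X Y) (y : Y) :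
    w = 0 := by
  obtain ⟨a, rfl⟩ := O.proj_surjective w
  rw [O.eq_zero a (y := Sum.inl y) (y' := Sum.inr 0) Sum.inl_ne_inr, map_zero]

theorem Operad.wheelAct_act {X₁ Y₁ X₂ Y₂ X₁' Y₁' X₂' Y₂' : Type} [Finite X₁] [Finite Y₁]
    [Finite X₂] [Finite Y₂] [Finite X₁'] [Finite Y₁'] [Finite X₂'] [Finite Y₂']
    (e₁ : X₁ ≃ X₁') (f₁ : Y₁ ≃ Y₁') (e₂ : X₂ ≃ X₂') (f₂ : Y₂ ≃ Y₂')
    (w : O.wheel.ev (X₁ ⊕ Fin 1) Y₁) (v : O.toMod.ev X₂ (Y₂ ⊕ Fin 1)) :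
    O.wheelAct (O.wheel.act (Equiv.sumCongr e₁ (Equiv.refl (Fin 1))) f₁ w)
        (O.toMod.act e₂ (Equiv.sumCongr f₂ (Equiv.refl (Fin 1))) v) =
      O.wheel.act (Equiv.sumCongr e₁ e₂) (Equiv.sumCongr f₁ f₂) (O.wheelAct w v) := by
  obtain ⟨a, rfl⟩ := O.proj_surjective w
  exact congrArg O.proj (O.barAct_act e₁ f₁ e₂ f₂ a v)

/-- This is sequential associativity of `O` while one input and the output are held aside for
closing the wheel. It is the lift of the associativity of `α`. -/
theorem Operad.barAct_assoc {X₁ Y₁ X₂ Y₂ X₃ Y₃ : Type} [Finite X₁] [Finite Y₁] [Finite X₂]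
    [Finite Y₂] [Finite X₃] [Finite Y₃] (a : O.toMod.ev ((X₁ ⊕ Fin 1) ⊕ Fin 1) (Y₁ ⊕ Fin 1))
    (v : O.toMod.ev (X₂ ⊕ Fin 1) (Y₂ ⊕ Fin 1)) (w : O.toMod.ev X₃ (Y₃ ⊕ Fin 1)) :
    O.toMod.act (Equiv.sumCongr (Equiv.sumAssoc X₁ X₂ X₃) (Equiv.refl (Fin 1)))
        (Equiv.sumCongr (Equiv.sumAssoc Y₁ Y₂ Y₃) (Equiv.refl (Fin 1)))
        (O.barAct (O.toMod.act
          (Equiv.sumCongr (Equiv.sumAssoc X₁ X₂ (Fin 1)).symm (Equiv.refl (Fin 1)))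
          (Equiv.sumCongr (Equiv.refl (Y₁ ⊕ Y₂)) (Equiv.refl (Fin 1))) (O.barAct a v)) w) =
      O.barAct a (O.toMod.act (Equiv.refl (X₂ ⊕ X₃)) (sumRot Y₂ (Fin 1) Y₃) (O.comp v w)) := by
  have h := O.assoc (O.toMod.act (sumRot X₁ (Fin 1) (Fin 1)) (Equiv.refl (Y₁ ⊕ Fin 1)) a) v w
  simp only [barAct, LinearMap.comp_apply, LinearMap.compr₂_apply]
  rw [← h]
  have h2 : ∀ c, O.toMod.act (sumRot (X₁ ⊕ X₂) (Fin 1) (Fin 1)) (Equiv.refl _) (O.toMod.act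
      (Equiv.sumCongr (Equiv.sumAssoc X₁ X₂ (Fin 1)).symm (Equiv.refl (Fin 1)))
      (Equiv.sumCongr (Equiv.refl (Y₁ ⊕ Y₂)) (Equiv.refl (Fin 1)))
      (O.toMod.act (sumRot X₁ (Fin 1) (X₂ ⊕ Fin 1)) (sumRot Y₁ (Fin 1) Y₂) c)) =
      O.toMod.act (Equiv.sumCongr (sumRot X₁ (Fin 1) X₂) (Equiv.refl (Fin 1)))
        (sumRot Y₁ (Fin 1) Y₂) (O.toMod.act (Equiv.sumAssoc (X₁ ⊕ Fin 1) X₂ (Fin 1)).symm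
          (Equiv.refl _) c) := by
    intro c
    simp only [FBBMod.act_act]
    apply FBBMod.act_congr
    · rintro ((x | x) | x | x) <;> rfl
    · rintro ((x | x) | x) <;> rfl
  rw [h2, O.comp_act_left, FBBMod.act_act, FBBMod.act_act, FBBMod.act_act]
  apply FBBMod.act_congr
  · rintro (((x | x) | x) | x) <;> rfl
  · rintro (((x | x) | x) | x) <;> rfl

/-- This is parallel composition in `O` at two inputs other than the one held aside for closing the
wheel. It is the lift of the corresponding identity for `α`. -/
theorem Operad.barAct_parallel {X₁ Y₁ X₂ Y₂ X₃ Y₃ : Type} [Finite X₁] [Finite Y₁] [Finite X₂]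
    [Finite Y₂] [Finite X₃] [Finite Y₃]
    (a : O.toMod.ev (((X₁ ⊕ Fin 1) ⊕ Fin 1) ⊕ Fin 1) (Y₁ ⊕ Fin 1))
    (v : O.toMod.ev X₂ (Y₂ ⊕ Fin 1)) (w : O.toMod.ev X₃ (Y₃ ⊕ Fin 1)) :
    O.toMod.act (Equiv.sumCongr (sumRot X₁ X₂ X₃) (Equiv.refl (Fin 1)))
        (Equiv.sumCongr (sumRot Y₁ Y₂ Y₃) (Equiv.refl (Fin 1)))
        (O.barAct (O.toMod.act (Equiv.sumCongr (sumRot X₁ (Fin 1) X₂) (Equiv.refl (Fin 1)))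
          (Equiv.sumCongr (Equiv.refl (Y₁ ⊕ Y₂)) (Equiv.refl (Fin 1))) (O.barAct a v)) w) =
      O.barAct (O.toMod.act (Equiv.sumCongr (sumRot X₁ (Fin 1) X₃) (Equiv.refl (Fin 1)))
        (Equiv.sumCongr (Equiv.refl (Y₁ ⊕ Y₃)) (Equiv.refl (Fin 1)))
        (O.barAct (O.toMod.act (Equiv.sumCongr (sumRot X₁ (Fin 1) (Fin 1)) (Equiv.refl (Fin 1)))
          (Equiv.sumCongr (Equiv.refl Y₁) (Equiv.refl (Fin 1))) a) w)) v := by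
  -- The element `b` is `a` with the input reserved for the wheel moved innermost. The two grafting
  -- inputs become outermost, as `O.parallel` requires.
  have hb : ∃ b : O.toMod.ev (((X₁ ⊕ Fin 1) ⊕ Fin 1) ⊕ Fin 1) (Y₁ ⊕ Fin 1),
      O.toMod.act (sumRot (X₁ ⊕ Fin 1) (Fin 1) (Fin 1)) (Equiv.refl _) a =
        O.toMod.act (Equiv.sumCongr (sumRot X₁ (Fin 1) (Fin 1)) (Equiv.refl (Fin 1)))
          (Equiv.refl _) b ∧
      O.toMod.act (sumRot (X₁ ⊕ Fin 1) (Fin 1) (Fin 1)) (Equiv.refl _)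
        (O.toMod.act (Equiv.sumCongr (sumRot X₁ (Fin 1) (Fin 1)) (Equiv.refl (Fin 1)))
          (Equiv.sumCongr (Equiv.refl Y₁) (Equiv.refl (Fin 1))) a) =
        O.toMod.act (Equiv.sumCongr (sumRot X₁ (Fin 1) (Fin 1)) (Equiv.refl (Fin 1)))
          (Equiv.refl _)
          (O.toMod.act (sumRot (X₁ ⊕ Fin 1) (Fin 1) (Fin 1)) (Equiv.refl _) b) := by
    refine ⟨O.toMod.act (sumRot (X₁ ⊕ Fin 1) (Fin 1) (Fin 1) |>.trans
      (Equiv.sumCongr (sumRot X₁ (Fin 1) (Fin 1)) (Equiv.refl (Fin 1)))) (Equiv.refl _) a, ?_, ?_⟩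
    · simp only [FBBMod.act_act]
      apply FBBMod.act_congr
      · rintro (((x | x) | x) | x) <;> rfl
      · rintro (x | x) <;> rfl
    · simp only [FBBMod.act_act]
      apply FBBMod.act_congr
      · rintro (((x | x) | x) | x) <;> rfl
      · rintro (x | x) <;> rfl
  obtain ⟨b, h1, h2⟩ := hb
  have h3 : ∀ {X₂ Y₂ : Type} [Finite X₂] [Finite Y₂] (c : O.toMod.ev (((X₁ ⊕ Fin 1) ⊕ Fin 1) ⊕ X₂)
      ((Y₁ ⊕ Fin 1) ⊕ Y₂)), O.toMod.act (sumRot (X₁ ⊕ X₂) (Fin 1) (Fin 1)) (Equiv.refl _)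
      (O.toMod.act (Equiv.sumCongr (sumRot X₁ (Fin 1) X₂) (Equiv.refl (Fin 1)))
        (Equiv.sumCongr (Equiv.refl (Y₁ ⊕ Y₂)) (Equiv.refl (Fin 1)))
        (O.toMod.act (sumRot (X₁ ⊕ Fin 1) (Fin 1) X₂) (sumRot Y₁ (Fin 1) Y₂)
          (O.toMod.act (Equiv.sumCongr (sumRot X₁ (Fin 1) (Fin 1)) (Equiv.refl X₂))
            (Equiv.sumCongr (Equiv.refl (Y₁ ⊕ Fin 1)) (Equiv.refl Y₂)) c))) =
      O.toMod.act (Equiv.sumCongr (sumRot X₁ (Fin 1) X₂) (Equiv.refl (Fin 1)))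
        (sumRot Y₁ (Fin 1) Y₂)
        (O.toMod.act (sumRot (X₁ ⊕ Fin 1) (Fin 1) X₂) (Equiv.refl _) c) := by
    intro X₂ Y₂ _ _ c
    simp only [FBBMod.act_act]
    apply FBBMod.act_congr
    · rintro (((x | x) | x) | x) <;> rfl
    · rintro ((x | x) | x) <;> rfl
  have h := O.parallel b v w
  simp only [barAct, LinearMap.comp_apply, LinearMap.compr₂_apply]
  rw [h1, h2, O.comp_act_left, O.comp_act_left, h3, h3, O.comp_act_left, O.comp_act_left, ← h]
  simp only [FBBMod.act_act]
  apply FBBMod.act_congr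
  · rintro ((((x | x) | x) | x)) <;> rfl
  · rintro ((((x | x) | x) | x)) <;> rfl

/-- The difference of the two sides is the image of a generating commutator. This is the only
identity below that needs the passage to the quotient. -/
theorem Operad.proj_barMul_comm {X₁ Y₁ X₂ Y₂ : Type} [Finite X₁] [Finite Y₁] [Finite X₂]
    [Finite Y₂] (a : O.toMod.ev (X₁ ⊕ Fin 1) (Y₁ ⊕ Fin 1))
    (b : O.toMod.ev (X₂ ⊕ Fin 1) (Y₂ ⊕ Fin 1)) :
    O.proj (O.barMul a b) =
      O.wheel.act (Equiv.sumComm X₂ X₁) (Equiv.sumComm Y₂ Y₁) (O.proj (O.barMul b a)) := by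
  rw [← O.proj_act, ← sub_eq_zero, ← map_sub]
  refine (Submodule.Quotient.mk_eq_zero _).mpr (Submodule.subset_span ⟨X₁, X₂, Y₁, Y₂,
    inferInstance, inferInstance, inferInstance, inferInstance, Equiv.refl _, Equiv.refl _, a, b,
    ?_⟩)
  rw [Equiv.sumCongr_refl, Equiv.sumCongr_refl, O.toMod.act_refl, Equiv.trans_refl,
    Equiv.trans_refl]

/-- The gluing operations of an operad. -/
def Operad.edgeStr : EdgeStr O.toMod where
  pair := O.comp
  -- A loop at an element of `O` uses up its only output, and `O` vanishes when there is no output,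
  -- so zero is the only possible value.
  trace := 0
  pair_act := O.comp_act
  trace_act _ _ _ := (map_zero _).symm
  eq_zero u _ _ h := O.eq_zero u h
  assoc := O.assoc
  parallel := O.parallel
  trace_pair_comm _ _ := (map_zero _).symm
  pair_trace _ v := LinearMap.congr_fun (map_zero O.comp) v

/-- Gluing an input of an element of `O ⊕ |δ_{1,1} O|` to the output of an element of `O`. -/
def Operad.wheeledPair {X₁ Y₁ X₂ Y₂ : Type} [Finite X₁] [Finite Y₁] [Finite X₂] [Finite Y₂] :
    O.wheeled.ev (X₁ ⊕ Fin 1) Y₁ →ₗ[k] O.wheeled.ev X₂ (Y₂ ⊕ Fin 1) →ₗ[k]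
      O.wheeled.ev (X₁ ⊕ X₂) (Y₁ ⊕ Y₂) :=
  LinearMap.mk₂ k
    (fun (p : O.toMod.ev (X₁ ⊕ Fin 1) Y₁ × O.wheel.ev (X₁ ⊕ Fin 1) Y₁)
        (q : O.toMod.ev X₂ (Y₂ ⊕ Fin 1) × O.wheel.ev X₂ (Y₂ ⊕ Fin 1)) =>
      -- The wheel component of `q` plays no role: it has an output, so it vanishes.
      ((O.comp p.1 q.1, O.wheelAct p.2 q.1) :
        O.toMod.ev (X₁ ⊕ X₂) (Y₁ ⊕ Y₂) × O.wheel.ev (X₁ ⊕ X₂) (Y₁ ⊕ Y₂)))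
    (fun p p' q => Prod.ext (O.comp.map_add₂ p.1 p'.1 q.1) (O.wheelAct.map_add₂ p.2 p'.2 q.1))
    (fun c p q => Prod.ext (O.comp.map_smul₂ c p.1 q.1) (O.wheelAct.map_smul₂ c p.2 q.1))
    (fun p q q' => Prod.ext (map_add (O.comp p.1) q.1 q'.1) (map_add (O.wheelAct p.2) q.1 q'.1))
    (fun c p q => Prod.ext (map_smul (O.comp p.1) c q.1) (map_smul (O.wheelAct p.2) c q.1))

/-- Gluing an input of an element of `O ⊕ |δ_{1,1} O|` to its output. -/
def Operad.wheeledTrace {X Y : Type} [Finite X] [Finite Y] :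
    O.wheeled.ev (X ⊕ Fin 1) (Y ⊕ Fin 1) →ₗ[k] O.wheeled.ev X Y :=
  -- Closing the loop turns the operad component into a wheel. The wheel component of the source
  -- vanishes because it has an output.
  LinearMap.prod (M₂ := O.toMod.ev X Y) (M₃ := O.wheel.ev X Y) 0
    (O.proj ∘ₗ LinearMap.fst k (O.toMod.ev (X ⊕ Fin 1) (Y ⊕ Fin 1))
      (O.wheel.ev (X ⊕ Fin 1) (Y ⊕ Fin 1)))

/-- The gluing operations of `O ⊕ |δ_{1,1} O|`. -/
def Operad.wheeledEdgeStr : EdgeStr O.wheeled where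
  pair := O.wheeledPair
  trace := O.wheeledTrace
  pair_act e₁ f₁ e₂ f₂ u v :=
    Prod.ext (O.comp_act e₁ f₁ e₂ f₂ u.1 v.1) (O.wheelAct_act e₁ f₁ e₂ f₂ u.2 v.1)
  trace_act e f u := Prod.ext (map_zero (O.toMod.act e f)).symm rfl
  eq_zero u y y' h := Prod.ext (O.eq_zero u.1 h) (O.wheel_eq_zero u.2 y)
  -- The operad component is the operad axiom. The wheel component is lifted along `π`, where it
  -- becomes the identity for `barAct`.
  assoc u v w := Prod.ext (O.assoc u.1 v.1 w.1) (by
    obtain ⟨a, ha⟩ := O.proj_surjective u.2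
    have := congrArg O.proj (O.barAct_assoc a v.1 w.1)
    change _ = O.wheelAct u.2 _
    rw [← ha]
    refine Eq.trans ?_ this
    change O.wheel.act _ _ (O.wheelAct (O.wheel.act _ _ (O.wheelAct u.2 v.1)) w.1) = _
    rw [← ha]
    rfl)
  parallel u v w := Prod.ext (O.parallel u.1 v.1 w.1) (by
    obtain ⟨a, ha⟩ := O.proj_surjective u.2
    have := congrArg O.proj (O.barAct_parallel a v.1 w.1)
    change O.wheel.act _ _ (O.wheelAct (O.wheel.act _ _ (O.wheelAct u.2 v.1)) w.1) =
      O.wheelAct (O.wheel.act _ _ (O.wheelAct (O.wheel.act _ _ u.2) w.1)) v.1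
    rw [← ha]
    exact this)
  trace_pair_comm {X₁ Y₁ X₂ Y₂} _ _ _ _ u v :=
    Prod.ext (map_zero (O.toMod.act (Equiv.sumComm X₂ X₁) (Equiv.sumComm Y₂ Y₁))).symm
      (O.proj_barMul_comm u.1 v.1)
  -- On the wheel component this is the definition of `α` on representatives, hence `rfl`.
  pair_trace {X₁ Y₁ X₂ Y₂} _ _ _ _ u v :=
    Prod.ext (LinearMap.congr_fun (map_zero (O.comp (X₁ := X₁) (Y₁ := Y₁))) v.1) rfl

/-! ### Naturality, surjectivity and uniqueness -/

theorem DwbStr.contract_act {F : FBBMod k} (s : DwbStr F) {X Y X' Y' : Type} [Finite X] [Finite Y]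
    [Finite X'] [Finite Y'] (e : X ≃ X') (f : Y ≃ Y') (z : F.ev (X ⊕ Fin 1) (Y ⊕ Fin 1)) :
    s.contract X' Y' (F.act (Equiv.sumCongr e (Equiv.refl (Fin 1)))
      (Equiv.sumCongr f (Equiv.refl (Fin 1))) z) = F.act e f (s.contract X Y z) := by
  have key : ∀ {X X' : Type} (e : X ≃ X'), Uwb.glue (Equiv.refl (X' ⊕ Fin 1))
      ((Equiv.sumEmpty (X' ⊕ Fin 1) (Fin 0)).trans (Equiv.sumCongr e (Equiv.refl (Fin 1))).symm) =
      (Equiv.sumCongr (Equiv.refl X') (Equiv.refl (Fin 1))).trans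
        (Uwb.glue ((Equiv.sumEmpty X' (Fin 0)).trans e.symm) (Equiv.refl (X ⊕ Fin 1))) := by
    intro X X' e
    rw [Uwb.glue_id, Uwb.id_glue]
    ext (x | x)
    · rfl
    · rfl
  -- Inserting a pair is natural for bijections in `uwb`. Applying the functor to this relation
  -- gives naturality of the contraction of any structure.
  have h : Uwb.insertPair X' Y' ≫ Uwb.ofBij (Equiv.sumCongr e (Equiv.refl (Fin 1))).symm
      (Equiv.sumCongr f (Equiv.refl (Fin 1))).symm =
        Uwb.ofBij e.symm f.symm ≫ Uwb.insertPair X Y :=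
    Quotient.sound ⟨Equiv.refl _, key e, key f⟩
  have := congrArg (fun m => s.map m z) h
  simp only [s.map_comp, s.map_ofBij, LinearMap.comp_apply] at this
  exact this

theorem FBBMod.app_symMap_symMkI {F G : FBBMod k} (φ : F ⟶ G) {X Y : Type} [Finite X] [Finite Y]
    {d : ℕ} (f : X → Fin d) (g : Y → Fin d) (a : ∀ i, F.ev (Fib f i) (Fib g i)) :
    FBBMod.app (FBBMod.symMap φ) X Y (F.symMkI f g a) =
      G.symMkI f g (fun i => FBBMod.app φ (Fib f i) (Fib g i) (a i)) := by
  rw [F.symMkI_fin, G.symMkI_fin]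
  exact FBBMod.symMapVal_mk φ f g a

theorem FBBMod.app_symMap_symCons {F G : FBBMod k} (φ : F ⟶ G) {A B P Q : Type} [Finite A]
    [Finite B] [Finite P] [Finite Q] (u : F.ev A B) (z : F.sym.ev P Q) :
    FBBMod.app (FBBMod.symMap φ) (A ⊕ P) (B ⊕ Q) (F.symCons u z) =
      G.symCons (FBBMod.app φ A B u) (FBBMod.app (FBBMod.symMap φ) P Q z) := by
  refine LinearMap.congr_fun (f := FBBMod.app (FBBMod.symMap φ) (A ⊕ P) (B ⊕ Q) ∘ₗ F.symCons u)
    (g := G.symCons (FBBMod.app φ A B u) ∘ₗ FBBMod.app (FBBMod.symMap φ) P Q)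
    (F.sym_hom_ext fun d f g a => ?_) z
  simp only [LinearMap.comp_apply]
  rw [F.symCons_mkI, app_symMap_symMkI, app_symMap_symMkI, G.symCons_mkI]
  congr 1
  funext i
  refine Fin.cases ?_ (fun j => ?_) i
  · exact FBBMod.app_act φ _ _ u
  · exact FBBMod.app_act φ _ _ (a j)

/-- The range contains every pure tensor, since entries can be lifted one by one, and pure tensors
span. -/
theorem FBBMod.app_symMap_surjective {F G : FBBMod k} (φ : F ⟶ G)
    (h : ∀ (X Y : Type) [Finite X] [Finite Y], Function.Surjective (FBBMod.app φ X Y))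
    (X Y : Type) [Finite X] [Finite Y] :
    Function.Surjective (FBBMod.app (FBBMod.symMap φ) X Y) := by
  rw [← LinearMap.range_eq_top, ← Submodule.ker_mkQ
    (LinearMap.range (FBBMod.app (FBBMod.symMap φ) X Y)), LinearMap.ker_eq_top]
  refine G.sym_hom_ext fun d f g a => ?_
  choose b hb using fun i => h (Fib f i) (Fib g i) (a i)
  rw [LinearMap.zero_apply, Submodule.mkQ_apply, Submodule.Quotient.mk_eq_zero]
  refine ⟨F.symMkI f g b, ?_⟩
  rw [app_symMap_symMkI]
  congr 1
  funext i
  exact hb i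

/-- It is enough to compare contractions, and only on marked products, where each contraction is a
pairing or a trace of the leading factors. -/
theorem EdgeStr.isDwbHom_symMap {M N : FBBMod k} (E : EdgeStr M) (E' : EdgeStr N) (φ : M ⟶ N)
    (hp : ∀ (A B C D : Type) [Finite A] [Finite B] [Finite C] [Finite D] (u : M.ev (A ⊕ Fin 1) B)
      (v : M.ev C (D ⊕ Fin 1)), FBBMod.app φ (A ⊕ C) (B ⊕ D) (E.pair u v) =
        E'.pair (FBBMod.app φ _ _ u) (FBBMod.app φ _ _ v))
    (ht : ∀ (A B : Type) [Finite A] [Finite B] (u : M.ev (A ⊕ Fin 1) (B ⊕ Fin 1)),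
      FBBMod.app φ A B (E.trace u) = E'.trace (FBBMod.app φ _ _ u)) :
    IsDwbHom E.dwbStr E'.dwbStr (FBBMod.symMap φ) := by
  refine isDwbHom_of_contract fun X Y _ _ z => ?_
  rw [E.dwbStr_contract, E'.dwbStr_contract]
  refine M.sym_ext_marked (φ := FBBMod.app (FBBMod.symMap φ) X Y ∘ₗ E.contract X Y)
    (ψ := E'.contract X Y ∘ₗ FBBMod.app (FBBMod.symMap φ) (X ⊕ Fin 1) (Y ⊕ Fin 1))
    (fun A B P Q _ _ _ _ t t' u z => ?_) (fun A B C D P Q _ _ _ _ _ _ t t' u v z => ?_) z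
  · simp only [LinearMap.comp_apply]
    rw [FBBMod.app_act, FBBMod.app_symMap_symCons,
      E.contract_trace u z (t := t) (t' := t') (fun x => by simp) (fun x => by simp),
      E'.contract_trace _ _ (t := t) (t' := t') (fun x => by simp) (fun x => by simp),
      FBBMod.app_act, FBBMod.app_symMap_symCons, ht]
  · simp only [LinearMap.comp_apply]
    rw [FBBMod.app_act, FBBMod.app_symMap_symCons, FBBMod.app_symMap_symCons,
      E.contract_pair u v z (t := t) (t' := t') (fun x => by simp) (fun x => by simp),
      E'.contract_pair _ _ _ (t := t) (t' := t') (fun x => by simp) (fun x => by simp),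
      FBBMod.app_act, FBBMod.app_symMap_symCons, hp]

variable (O : Operad k)

theorem Operad.wheeled_eq_inl {X Y : Type} [Finite X] [Finite Y] (u : O.wheeled.ev X Y) (y : Y) :
    ∃ a : O.toMod.ev X Y, u = FBBMod.inl O.toMod O.wheel a :=
  ⟨u.1, Prod.ext rfl (O.wheel_eq_zero u.2 y)⟩

theorem Operad.wheeled_eq_add {X Y : Type} [Finite X] [Finite Y] (u : O.wheeled.ev X Y) :
    ∃ (u₁ u₂ : O.wheeled.ev X Y) (a : O.toMod.ev X Y) (w : O.wheel.ev X Y), u = u₁ + u₂ ∧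
      u₁ = FBBMod.inl O.toMod O.wheel a ∧ u₂ = FBBMod.inr O.toMod O.wheel w :=
  ⟨FBBMod.inl O.toMod O.wheel u.1, FBBMod.inr O.toMod O.wheel u.2, u.1, u.2,
    Prod.ext (add_zero u.1).symm (zero_add u.2).symm, rfl, rfl⟩

theorem Operad.isEdgeContraction : IsEdgeContraction O O.wheeledEdgeStr.dwbStr where
  comp {X₁ X₂ X₃ Y₁ Y₂ Y₃} _ _ _ _ _ _ u v z := by
    have h : O.wheeledPair (FBBMod.inl O.toMod O.wheel u) (FBBMod.inl O.toMod O.wheel v) =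
        FBBMod.inl O.toMod O.wheel (O.comp u v) :=
      Prod.ext rfl (LinearMap.congr_fun (map_zero (O.wheelAct (X₁ := X₁) (Y₁ := Y₁))) v)
    rw [O.wheeledEdgeStr.dwbStr_contract]
    refine (O.wheeledEdgeStr.contract_pair _ _ z (t := Equiv.refl _) (t' := Equiv.refl _)
      (fun x => by simp) (fun x => by simp)).trans ?_
    rw [O.wheeled.sym.act_refl]
    exact congrArg (fun w => O.wheeled.symCons w z) h
  wheelAct {X₁ X₂ X₃ Y₁ Y₂ Y₃} _ _ _ _ _ _ w v z := by
    have h : O.wheeledPair (FBBMod.inr O.toMod O.wheel w) (FBBMod.inl O.toMod O.wheel v) =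
        FBBMod.inr O.toMod O.wheel (O.wheelAct w v) :=
      Prod.ext (LinearMap.congr_fun (map_zero (O.comp (X₁ := X₁) (Y₁ := Y₁))) v) rfl
    rw [O.wheeledEdgeStr.dwbStr_contract]
    refine (O.wheeledEdgeStr.contract_pair _ _ z (t := Equiv.refl _) (t' := Equiv.refl _)
      (fun x => by simp) (fun x => by simp)).trans ?_
    rw [O.wheeled.sym.act_refl]
    exact congrArg (fun w => O.wheeled.symCons w z) h
  proj a z := by
    rw [O.wheeledEdgeStr.dwbStr_contract]
    refine (O.wheeledEdgeStr.contract_trace _ z (t := Equiv.refl _) (t' := Equiv.refl _)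
      (fun x => by simp) (fun x => by simp)).trans ?_
    rw [O.wheeled.sym.act_refl]
    rfl

variable {O}

/-- Two structures agree once their contractions agree on marked products. There the generator
carrying the marked output lies in `O`, because wheels have no outputs, so the three prescribed
formulas determine every value. -/
theorem IsEdgeContraction.unique {s s' : DwbStr O.wheeled.sym} (h : IsEdgeContraction O s)
    (h' : IsEdgeContraction O s') : s = s' := by
  refine DwbStr.ext_contract fun X Y _ _ => LinearMap.ext fun z => ?_
  refine O.wheeled.sym_ext_marked (φ := s.contract X Y) (ψ := s'.contract X Y)
    (fun A B P Q _ _ _ _ t t' u z => ?_) (fun A B C D P Q _ _ _ _ _ _ t t' u v z => ?_) z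
  · obtain ⟨a, rfl⟩ := O.wheeled_eq_inl u (Sum.inr 0)
    rw [← O.wheeled.sym.act_act, s.contract_act, s'.contract_act]
    exact congrArg _ ((h.proj a z).trans (h'.proj a z).symm)
  · obtain ⟨b, rfl⟩ := O.wheeled_eq_inl v (Sum.inr 0)
    -- The factor carrying the marked input may be a corolla or a wheel, so it is decomposed. The
    -- two summands fall under the formulas for `μ̃` and for `α`.
    obtain ⟨u₁, u₂, a, w, rfl, h₁, h₂⟩ := O.wheeled_eq_add u
    rw [← O.wheeled.sym.act_act, s.contract_act, s'.contract_act, map_add, LinearMap.add_apply,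
      map_add, map_add, map_add (s'.contract _ _), h₁, h₂]
    exact congrArg _ (congrArg₂ (· + ·) ((h.comp a b z).trans (h'.comp a b z).symm)
      ((h.wheelAct w b z).trans (h'.wheelAct w b z).symm))

variable {P : Operad k}

theorem OperadHom.isDwbHom_wheeledMap (φ : OperadHom O P) :
    IsDwbHom O.wheeledEdgeStr.dwbStr P.wheeledEdgeStr.dwbStr (FBBMod.symMap φ.wheeledMap) := by
  refine EdgeStr.isDwbHom_symMap O.wheeledEdgeStr P.wheeledEdgeStr φ.wheeledMap
    (fun A B C D _ _ _ _ u v => Prod.ext (φ.map_comp u.1 v.1) ?_)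
    (fun A B _ _ u => Prod.ext (map_zero (FBBMod.app φ.hom A B)) rfl)
  obtain ⟨a, ha⟩ := O.proj_surjective u.2
  have hb : FBBMod.app φ.hom _ _ (O.barAct a v.1) =
      P.barAct (FBBMod.app φ.hom _ _ a) (FBBMod.app φ.hom _ _ v.1) := by
    simp only [Operad.barAct, LinearMap.comp_apply, LinearMap.compr₂_apply]
    rw [FBBMod.app_act, φ.map_comp, FBBMod.app_act]
  change FBBMod.app φ.wheelMap _ _ (O.wheelAct u.2 v.1) =
    P.wheelAct (FBBMod.app φ.wheelMap _ _ u.2) (FBBMod.app φ.hom _ _ v.1)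
  rw [← ha]
  exact congrArg P.proj hb

theorem OperadHom.isDwbHom_hom (φ : OperadHom O P) :
    IsDwbHom O.edgeStr.dwbStr P.edgeStr.dwbStr (FBBMod.symMap φ.hom) :=
  EdgeStr.isDwbHom_symMap _ _ _ (fun _ _ _ _ _ _ _ _ u v => φ.map_comp u v)
    (fun _ _ _ _ _ => map_zero _)

/-- The operad component of the wheeled pairing is `O.comp` and that of the wheeled trace is zero,
which are precisely the operations of `O.edgeStr`. -/
theorem Operad.isDwbHom_wheeledProj :
    IsDwbHom O.wheeledEdgeStr.dwbStr O.edgeStr.dwbStr (FBBMod.symMap O.wheeledProj) :=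
  EdgeStr.isDwbHom_symMap _ _ _ (fun _ _ _ _ _ _ _ _ _ _ => rfl) (fun _ _ _ _ _ => rfl)

theorem Operad.app_symMap_wheeledProj_surjective (X Y : Type) [Finite X] [Finite Y] :
    Function.Surjective (FBBMod.app (FBBMod.symMap O.wheeledProj) X Y) :=
  FBBMod.app_symMap_surjective _
    (fun _ _ _ _ u => ⟨FBBMod.inl O.toMod O.wheel u, rfl⟩) X Y

theorem IsDwbHom.unique {F G : FBBMod k} {s : DwbStr F} {t t' : DwbStr G} {φ : F ⟶ G}
    (h : IsDwbHom s t φ) (h' : IsDwbHom s t' φ)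
    (hφ : ∀ (X Y : Type) [Finite X] [Finite Y], Function.Surjective (FBBMod.app φ X Y)) :
    t = t' := by
  refine DwbStr.ext ?_
  funext P Q m
  refine LinearMap.ext fun z => ?_
  obtain ⟨x, rfl⟩ := hφ Q.left Q.right z
  exact (h m x).symm.trans (h' m x)

end

theorem mainTheorem4 (k : Type u) [Field k] :
    ∃ (s : ∀ O : Operad k, DwbStr O.wheeled.sym) (t : ∀ O : Operad k, DwbStr O.toMod.sym),
      (∀ O : Operad k, IsEdgeContraction O (s O)) ∧
      (∀ (O : Operad k) (s' : DwbStr O.wheeled.sym), IsEdgeContraction O s' → s' = s O) ∧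
      (∀ (O P : Operad k) (φ : OperadHom O P),
        IsDwbHom (s O) (s P) (FBBMod.symMap φ.wheeledMap)) ∧
      (∀ (O : Operad k) (X Y : Type) [Finite X] [Finite Y],
        Function.Surjective (FBBMod.app (FBBMod.symMap O.wheeledProj) X Y)) ∧
      (∀ O : Operad k, IsDwbHom (s O) (t O) (FBBMod.symMap O.wheeledProj)) ∧
      (∀ (O : Operad k) (t' : DwbStr O.toMod.sym),
        IsDwbHom (s O) t' (FBBMod.symMap O.wheeledProj) → t' = t O) ∧
      (∀ (O P : Operad k) (φ : OperadHom O P),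
        IsDwbHom (t O) (t P) (FBBMod.symMap φ.hom)) :=
  -- The structure on `S*O` is built directly from the trace-zero gluing operations rather than as a
  -- quotient. Surjectivity of the projection then identifies it as the only compatible one.
  ⟨fun O => O.wheeledEdgeStr.dwbStr, fun O => O.edgeStr.dwbStr,
    fun O => O.isEdgeContraction,
    fun O _ h => h.unique O.isEdgeContraction,
    fun _ _ φ => φ.isDwbHom_wheeledMap,
    fun _ X Y _ _ => Operad.app_symMap_wheeledProj_surjective X Y,
    fun _ => Operad.isDwbHom_wheeledProj,
    fun _ _ h => h.unique Operad.isDwbHom_wheeledProj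
      Operad.app_symMap_wheeledProj_surjective,
    fun _ _ φ => φ.isDwbHom_hom⟩
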